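/- Consider the class of variable coefficient Gardner equations $$u_t+k(t)uu_x+f(t)u^2u_x+g(t)u_{xxx}=0,\qquad fg\neq0,\qquad(1)$$ where $k,f,g$ are smooth real functions of $t$ on an open interval $I$, and $x$, $u$ range over open intervals $A$, $B$. A point transformation is a smooth map of the variables $(t,x,u)$ with nonvanishing Jacobian. It maps one equation to another if its prolongation maps the submanifold of the third order jet space given by the first equation to the one given by the second: for every smooth function $u$ whose graph is mapped to the graph of a smooth function $\tilde u$, the jet of $u$ at a point satisfies the first equation if and only if the jet of $\tilde u$ at the image point satisfies the second. An element of the generalized extended equivalence group $\hat G^{\sim}$ of the class (1) is a transformation $(t,x,u,k,f,g)\mapsto(\tilde t,\tilde x,\tilde u,\tilde k,\tilde f,\tilde g)$ whose components are smooth functions of $t,x,u$, of the values $k,f,g$ (defined for all real values) and of (arbitrary) antiderivatives $\int k\,dt,\int f\,dt,\int g\,dt$, which is nondegenerate with respect to $(t,x,u,k,f,g)$ where $fg\ne0$, and such that for every equation (1), and every choice of the antiderivatives, inserting the coefficients gives a point transformation $(t,x,u)\mapsto(\tilde t,\tilde x,\tilde u)$ that maps this equation to the equation of the class (1) with the coefficients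 $\tilde k(\tilde t),\tilde f(\tilde t),\tilde g(\tilde t)$. An element of the usual equivalence group $G^{\sim}$ is a transformation of this kind, smooth where $fg\ne0$, for which $\tilde t,\tilde x,\tilde u$ depend on $t,x,u$ only and $\tilde k,\tilde f,\tilde g$ do not depend on the antiderivatives. **Theorem 1.** The generalized extended equivalence group $\hat G^{\sim}$ of the class (1) is formed by the transformations $$\tilde t=\alpha(t),\quad \tilde x=\delta_1 x+\frac{\delta_1\delta_3}{\delta_2^{2}}\int(\delta_2 k(t)-\delta_3 f(t))\,dt+\delta_4,\quad \tilde u=\delta_2 u+\delta_3,$$ $$\tilde k(\tilde t)=\frac{\delta_1}{\delta_2\alpha_t}\Big(k(t)-2\frac{\delta_3}{\delta_2}f(t)\Big),\quad \tilde f(\tilde t)=\frac{\delta_1}{\delta_2^{2}\alpha_t}f(t),\quad \tilde g(\tilde t)=\frac{\delta_1^{3}}{\alpha_t}g(t),$$ where $\delta_1,\dots,\delta_4$ are arbitrary constants with $\delta_1\delta_2\neq0$ and $\alpha$ is an arbitrary smooth function on $I$ with $\alpha_t\neq0$. The usual equivalence group $G^{\sim}$ of the class (1) consists of the above transformations with $\delta_3=0$.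 Moreover, whatever the way in which a family of point transformations depends on the coefficients: a point transformation maps a given equation of the class (1) to the equation of the class with the coefficients $\tilde k,\tilde f,\tilde g$ if and only if it is of the above form, with $\tilde k,\tilde f,\tilde g$ as above, for some $\alpha,\delta_1,\dots,\delta_4$ (which may depend on the equation). Both sets of transformations (with $x$, $u$ ranging over the whole line, and $t$ over an open interval) contain the identity and are closed under composition, whenever it is defined, and under inversion; in a composition the second transformation is applied to the new coefficients and to suitable antiderivatives of them with respect to the new $t$. -/

import Mathlib

open Set Filter Topology
open scoped ContDiff

noncomputable section

namespace Gardner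

/-- Triples of real numbers. They serve as points `(t, x, u)` of the space of independent and
dependent variables, as values `(k, f, g)` of the coefficients, and as values of
antiderivatives `(∫ k dt, ∫ f dt, ∫ g dt)` of the coefficients. -/
abbrev R3 : Type := ℝ × ℝ × ℝ

/-- A nonempty open interval of the real line (possibly unbounded). -/
def IsOpenInterval (I : Set ℝ) : Prop :=
  IsOpen I ∧ I.OrdConnected ∧ I.Nonempty

/-- The box `I × A × B` in the space of the variables `(t, x, u)`. -/
def box (I A B : Set ℝ) : Set R3 := {p | p.1 ∈ I ∧ p.2.1 ∈ A ∧ p.2.2 ∈ B}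

/-- The admissible values `(k, f, g)` of the coefficients: those with `f g ≠ 0`. -/
def regular : Set R3 := {a | a.2.1 * a.2.2 ≠ 0}

/-- `θ = (k, f, g)` is a triple of coefficients of an equation of the class over `S`:
the three functions are smooth on `S`, and `f g` vanishes nowhere on `S`. -/
def InClass (S : Set ℝ) (θ : ℝ → R3) : Prop :=
  ContDiffOn ℝ ∞ θ S ∧ ∀ t ∈ S, θ t ∈ regular

/-- `Θ = (∫ k dt, ∫ f dt, ∫ g dt)` on `I`, for some choice of the constants of integration. -/
def IsAntideriv (I : Set ℝ) (Θ θ : ℝ → R3) : Prop :=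
  ∀ t ∈ I, HasDerivAt Θ (θ t) t

/-- The left hand side `w_t + k(t) w w_x + f(t) w² w_x + g(t) w_xxx` of the Gardner equation with
the coefficients `θ = (k, f, g)`, evaluated on the function `w` at the point `(t, x)`. -/
def gardner (θ : ℝ → R3) (w : ℝ × ℝ → ℝ) (t x : ℝ) : ℝ :=
  deriv (fun s => w (s, x)) t
    + (θ t).1 * w (t, x) * deriv (fun y => w (t, y)) x
    + (θ t).2.1 * w (t, x) ^ 2 * deriv (fun y => w (t, y)) x
    + (θ t).2.2 * iteratedDeriv 3 (fun y => w (t, y)) x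

/-- The point transformation `P` of `(t, x, u)`, defined on `D`, maps the equation with the
coefficients `θ` to the equation with the coefficients `θ'`, the equations being regarded as
submanifolds of the space of third order jets: whenever `P` maps the graph of a smooth function
`w`, near one of its points lying in `D`, to the graph of a smooth function `w'` (with a
nondegenerate induced change of the independent variables), the third order jet of `w` at that
point satisfies the first equation if and only if the jet of `w'` at the image
point satisfies the second one. -/
def MapsEquation (D : Set R3) (P : R3 → R3) (θ θ' : ℝ → R3) : Prop :=
  ∀ (t x : ℝ) (w w' : ℝ × ℝ → ℝ),
    (t, x, w (t, x)) ∈ D →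
    ContDiffAt ℝ ∞ w (t, x) →
    Function.Bijective
      (fderiv ℝ (fun z : ℝ × ℝ => ((P (z.1, z.2, w z)).1, (P (z.1, z.2, w z)).2.1)) (t, x)) →
    ContDiffAt ℝ ∞ w' ((P (t, x, w (t, x))).1, (P (t, x, w (t, x))).2.1) →
    (∀ᶠ z : ℝ × ℝ in 𝓝 (t, x),
      w' ((P (z.1, z.2, w z)).1, (P (z.1, z.2, w z)).2.1) = (P (z.1, z.2, w z)).2.2) →
    (gardner θ w t x = 0 ↔
      gardner θ' w' (P (t, x, w (t, x))).1 (P (t, x, w (t, x))).2.1 = 0)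

/-- `P` is a nondegenerate (smooth, with nonvanishing Jacobian) point transformation on `D` that
maps the equation with the coefficients `θ` to the equation of the class with the
coefficients `θ'` (which are functions of the new variable `t`, on its range). -/
def IsAdmissible (D : Set R3) (P : R3 → R3) (θ θ' : ℝ → R3) : Prop :=
  ContDiffOn ℝ ∞ P D ∧
  (∀ p ∈ D, Function.Bijective (fderiv ℝ P p)) ∧
  InClass ((fun p => (P p).1) '' D) θ' ∧
  MapsEquation D P θ θ'

/-- Transformations of the variables `(t, x, u)` and of the coefficient values `(k, f, g)` whose
components may depend on `(t, x, u)`, on `(k, f, g)` and on antiderivatives of `k`, `f`, `g`: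
`Φ ((t, x, u), (k, f, g), (∫ k, ∫ f, ∫ g)) = ((t', x', u'), (k', f', g'))`. -/
abbrev Transf : Type := R3 × R3 × R3 → R3 × R3

/-- The part of the domain where `(t, x, u) ∈ D` and `(k, f, g) ∈ W`; the values of the
antiderivatives are unrestricted. -/
def domain (D W : Set R3) : Set (R3 × R3 × R3) := {q | q.1 ∈ D ∧ q.2.1 ∈ W}

/-- The transformation of `(t, x, u)` obtained from `Φ` by inserting given coefficients `θ` and
their antiderivatives `Θ`. -/
def Transf.at (Φ : Transf) (θ Θ : ℝ → R3) : R3 → R3 := fun p => (Φ (p, θ p.1, Θ p.1)).1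

/-- `Φ` is an equivalence transformation of the class of Gardner equations over `I`, with variables
in `I × A × B`, smooth for the coefficient values in `W`: it is nondegenerate as a transformation
of `(t, x, u, k, f, g)`, and for every equation of the class it gives a nondegenerate point
transformation to the equation of the class whose coefficients, as functions of the
new `t`, are given by the remaining components of `Φ`. -/
def IsEquivTransf (I A B : Set ℝ) (W : Set R3) (Φ : Transf) : Prop :=
  ContDiffOn ℝ ∞ Φ (domain (box I A B) W) ∧
  (∀ p ∈ box I A B, ∀ a ∈ regular, ∀ b : R3,
    Function.Bijective (fderiv ℝ (fun q : R3 × R3 => Φ (q.1, q.2, b)) (p, a))) ∧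
  ∀ θ Θ : ℝ → R3, InClass I θ → IsAntideriv I Θ θ →
    ∃ θ' : ℝ → R3,
      (∀ p ∈ box I A B, θ' (Φ.at θ Θ p).1 = (Φ (p, θ p.1, Θ p.1)).2) ∧
      IsAdmissible (box I A B) (Φ.at θ Θ) θ θ'

/-- Elements of the generalized extended equivalence group: the components for `t`, `x`, `u` may
depend on the coefficients and, nonlocally, on their antiderivatives. They are smooth
functions of all their arguments (so that one and the same smooth expression serves both signs
of `f` and of `g`); only equations with `f g ≠ 0` are transformed. -/
def IsGenExtEquiv (I A B : Set ℝ) (Φ : Transf) : Prop :=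
  IsEquivTransf I A B univ Φ

/-- Elements of the usual equivalence group: the components for `t`, `x`, `u` involve neither the
coefficients nor their antiderivatives, and the components for `k`, `f`, `g` do not involve the
antiderivatives. -/
def IsUsualEquiv (I A B : Set ℝ) (Φ : Transf) : Prop :=
  IsEquivTransf I A B regular Φ ∧
  (∀ p ∈ box I A B, ∀ a ∈ regular, ∀ a' ∈ regular, ∀ b b' : R3,
    (Φ (p, a, b)).1 = (Φ (p, a', b')).1) ∧
  (∀ p ∈ box I A B, ∀ a ∈ regular, ∀ b b' : R3, (Φ (p, a, b)).2 = (Φ (p, a, b')).2)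

/-- The function `α` and the constants `δ₁, δ₂, δ₃, δ₄`. -/
structure Params where
  α : ℝ → ℝ
  d1 : ℝ
  d2 : ℝ
  d3 : ℝ
  d4 : ℝ

/-- `α` is smooth on `I` with `α_t ≠ 0`, and `δ₁ δ₂ ≠ 0`. -/
def Params.Valid (c : Params) (I : Set ℝ) : Prop :=
  ContDiffOn ℝ ∞ c.α I ∧ (∀ t ∈ I, deriv c.α t ≠ 0) ∧ c.d1 * c.d2 ≠ 0

/-- The transformation with the given parameters:
`t' = α(t)`, `x' = δ₁ x + (δ₁ δ₃ / δ₂²) ∫ (δ₂ k - δ₃ f) dt + δ₄`, `u' = δ₂ u + δ₃`,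
`k' = δ₁ / (δ₂ α_t) (k - 2 (δ₃ / δ₂) f)`, `f' = δ₁ / (δ₂² α_t) f`, `g' = (δ₁³ / α_t) g`. -/
def Params.transf (c : Params) : Transf := fun q =>
  match q with
  | ((t, x, u), (k, f, g), (K, F, _)) =>
    ((c.α t,
      c.d1 * x + c.d1 * c.d3 / c.d2 ^ 2 * (c.d2 * K - c.d3 * F) + c.d4,
      c.d2 * u + c.d3),
     (c.d1 / (c.d2 * deriv c.α t) * (k - 2 * (c.d3 / c.d2) * f),
      c.d1 / (c.d2 ^ 2 * deriv c.α t) * f,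
      c.d1 ^ 3 / deriv c.α t * g))

/-- The identity transformation. -/
def idTransf : Transf := fun q => (q.1, q.2.1)

/-- `Χ` acts on every equation of the class over `I` as `Φ` followed by `Ψ`, where `Ψ` is applied to
the coefficients produced by `Φ` and to suitable antiderivatives of these
coefficients with respect to the new variable `t`, which lies in `J`. -/
def IsComp (I J : Set ℝ) (Ψ Φ Χ : Transf) : Prop :=
  ∀ θ Θ : ℝ → R3, InClass I θ → IsAntideriv I Θ θ →
    ∃ Θ' : ℝ → R3, ∀ p ∈ box I univ univ,
      (Φ.at θ Θ p).1 ∈ J ∧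
      HasDerivAt Θ' (Φ (p, θ p.1, Θ p.1)).2 (Φ.at θ Θ p).1 ∧
      Χ (p, θ p.1, Θ p.1) =
        Ψ (Φ.at θ Θ p, (Φ (p, θ p.1, Θ p.1)).2, Θ' (Φ.at θ Θ p).1)

/-- The transformations satisfying `M` (with `x` and `u` ranging over the whole line, and `t` over
an open interval, as indicated by the first argument of `M`) form a group with respect to
composition, whenever the composition is defined. -/
def FormGroup (M : Set ℝ → Transf → Prop) : Prop :=
  (∀ I, IsOpenInterval I → M I idTransf) ∧
  (∀ I J, IsOpenInterval I → IsOpenInterval J → ∀ Φ Ψ, M I Φ → M J Ψ →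
    (∀ p ∈ box I univ univ, ∀ a ∈ regular, ∀ b : R3, (Φ (p, a, b)).1.1 ∈ J) →
    ∃ Χ, M I Χ ∧ IsComp I J Ψ Φ Χ) ∧
  (∀ I, IsOpenInterval I → ∀ Φ, M I Φ →
    ∃ J Ψ, IsOpenInterval J ∧ M J Ψ ∧ IsComp I J Ψ Φ idTransf ∧ IsComp J I Φ Ψ idTransf)

end Gardner

end

noncomputable section

namespace Gardner

/-! Everything rests on the classification of the single point transformations `(t, x, u) ↦ (T, X,
U)` that map one given equation to another (`isAdmissible_iff`). The two groups are then found by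
letting the equation vary.

Necessity is a comparison of jets. If two functions take the same value at a point and both jets
satisfy the first equation, both image jets satisfy the second one. The difference of the two image
equations is linear, because the factor of `w_x` depends only on the common value. `compare_images`
evaluates this difference without a third-order chain rule, and `linearized_condition` records the
outcome. Functions that differ by `(t - t₀)³` look the same to the equation, so the curve mapped to
`t' = const` is tangent to `t = const`; hence `T = α(t)`. Functions that differ in `w_xxx`, with a
compensating change of `w_t`, give `g (X_x + q X_u)³ = g' α_t` for every slope `q` for which the
bracket is nonzero; hence `X_u = 0` and `X_x` depends on `t` only. After this the whole equation can
be transformed (`determining_equation`). The second derivative of the jet enters only through `U_xu`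
and `U_uu`, which therefore vanish (`second_order`), and the dependence on the slope splits the rest
in two (`reduced_equations`). Collecting powers of `u` and using `f ≠ 0` yields `U_x = 0`, then `U_t
= 0`, then that `X_x` is constant; the surviving relations are the formulas for the coefficients and
for the shift of `x`. Conversely, the left-hand sides of the two equations are proportional
(`Params.mapsEquation`).

For an equivalence transformation the parameters could a priori change with the equation. In the
generalized extended case, suitable differences of components of `Φ` are smooth functions of `t`,
the coefficients and their antiderivatives that are constant along every curve `t ↦ (t, θ t, Θ t)`.
The tangent vectors of these curves are so abundant that the differential vanishes at regular values
and, by density, everywhere, so these functions are constants (`eq_of_const_along`). The function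
`α` is not constant along the curves, only its derivative is nonzero; but an affine function without
zeros has zero linear part, which together with nondegeneracy gives `time_independent`. In the usual
case independence of the coefficients is part of the hypothesis, and `δ₃ = 0` because otherwise the
shift of `x` would feel a change of `k`. The group properties become algebra with parameters
(`formGroup_of_params`). -/

/-! ### Third-order asymptotics and local inverses. -/

theorem eq_zero_of_cubic_isLittleO {a b c d : ℝ}
    (h : (fun s : ℝ => a + b * s + c * s ^ 2 + d * s ^ 3) =o[𝓝 0] fun s => s ^ 3) :
    a = 0 ∧ b = 0 ∧ c = 0 ∧ d = 0 := by
  have h' := (h.mono (nhdsWithin_le_nhds (s := {0}ᶜ)))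
  have key : ∀ n : ℕ, n ≤ 3 → (fun s : ℝ => s ^ 3) =O[𝓝[≠] 0] fun s => s ^ n := by
    intro n hn
    refine Asymptotics.IsBigO.of_bound 1 ?_
    have : ∀ᶠ s : ℝ in 𝓝[≠] 0, |s| < 1 := by
      apply nhdsWithin_le_nhds
      filter_upwards [Metric.ball_mem_nhds (0 : ℝ) one_pos] with s hs
      simpa using hs
    filter_upwards [this] with s hs
    rw [norm_pow, norm_pow, one_mul, Real.norm_eq_abs]
    exact pow_le_pow_of_le_one (abs_nonneg s) hs.le hn
  have lim : ∀ (n : ℕ) (_ : n ≤ 3) (p : ℝ → ℝ) (_ : Continuous p)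
      (_ : (fun s : ℝ => s ^ n * p s) =o[𝓝[≠] 0] fun s => s ^ 3), p 0 = 0 := by
    intro n hn p hp ho
    have h1 := ho.trans_isBigO (key n hn)
    have h2 : Tendsto (fun s => (s ^ n * p s) / s ^ n) (𝓝[≠] 0) (𝓝 0) := h1.tendsto_div_nhds_zero
    have h3 : Tendsto p (𝓝[≠] 0) (𝓝 0) := by
      refine h2.congr' ?_
      filter_upwards [self_mem_nhdsWithin] with s hs
      have : s ≠ 0 := hs
      field_simp
    exact tendsto_nhds_unique (hp.tendsto 0 |>.mono_left nhdsWithin_le_nhds) h3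
  have ha : a = 0 := by
    have h0 := lim 0 (by norm_num) (fun s => a + b * s + c * s ^ 2 + d * s ^ 3) (by fun_prop)
      (h'.congr_left fun s => by ring)
    simpa using h0
  subst ha
  have hb : b = 0 := by
    have h0 := lim 1 (by norm_num) (fun s => b + c * s + d * s ^ 2) (by fun_prop)
      (h'.congr_left fun s => by ring)
    simpa using h0
  subst hb
  have hc : c = 0 := by
    have h0 := lim 2 (by norm_num) (fun s => c + d * s) (by fun_prop)
      (h'.congr_left fun s => by ring)
    simpa using h0
  subst hc
  have hd : d = 0 := by
    have h0 := lim 3 (by norm_num) (fun s => d) (by fun_prop)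
      (h'.congr_left fun s => by ring)
    simpa using h0
  exact ⟨rfl, rfl, rfl, hd⟩

theorem taylor_three_isLittleO {f : ℝ → ℝ} {x₀ : ℝ} (hf : ContDiffAt ℝ ∞ f x₀) :
    (fun x => f x - (f x₀ + deriv f x₀ * (x - x₀) + iteratedDeriv 2 f x₀ / 2 * (x - x₀) ^ 2
      + iteratedDeriv 3 f x₀ / 6 * (x - x₀) ^ 3)) =o[𝓝 x₀] fun x => (x - x₀) ^ 3 := by
  have h3 : ContDiffAt ℝ 3 f x₀ := hf.of_le (WithTop.coe_le_coe.2 le_top)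
  obtain ⟨r, hr, hs⟩ : ∃ r > 0, ContDiffOn ℝ 3 f (Metric.ball x₀ r) := by
    obtain ⟨u, hu, h⟩ := h3.contDiffOn (m := 3) le_rfl (by simp)
    obtain ⟨r, hr, hru⟩ := Metric.mem_nhds_iff.1 (by simpa using hu)
    exact ⟨r, hr, h.mono hru⟩
  have := taylor_isLittleO (n := 3) (convex_ball x₀ r) (Metric.mem_ball_self hr) hs
  rw [nhdsWithin_eq_nhds.2 (Metric.ball_mem_nhds x₀ hr)] at this
  refine this.congr_left fun x => ?_
  have e : ∀ n, iteratedDerivWithin n f (Metric.ball x₀ r) x₀ = iteratedDeriv n f x₀ := fun n =>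
    iteratedDerivWithin_of_isOpen Metric.isOpen_ball (Metric.mem_ball_self hr)
  simp only [taylor_within_apply, Finset.sum_range_succ, Finset.sum_range_zero, e,
    iteratedDeriv_zero, iteratedDeriv_one, smul_eq_mul, Nat.factorial]
  push_cast
  ring

/-- Subtracting the Taylor polynomial leaves a cubic that is `o(s³)`, whose coefficients all vanish.
This lets third derivatives of images be read off from asymptotics along a curve. -/
theorem iteratedDeriv_three_of_isLittleO {f : ℝ → ℝ} {c : ℝ} (hf : ContDiffAt ℝ ∞ f 0)
    (h : (fun s => f s - c * s ^ 3) =o[𝓝 0] fun s => s ^ 3) : iteratedDeriv 3 f 0 = 6 * c := by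
  have h1 := h.sub (by simpa using taylor_three_isLittleO hf)
  have h2 := eq_zero_of_cubic_isLittleO (a := f 0) (b := deriv f 0) (c := iteratedDeriv 2 f 0 / 2)
    (d := iteratedDeriv 3 f 0 / 6 - c) (h1.congr_left fun s => by ring)
  linarith [h2.2.2.2]

theorem exists_local_inverse {E : Type*} [NormedAddCommGroup E] [NormedSpace ℝ E]
    [FiniteDimensional ℝ E] {f : E → E} {a : E} (hf : ContDiffAt ℝ ∞ f a)
    (hb : Function.Bijective (fderiv ℝ f a)) :
    ∃ g : E → E, ContDiffAt ℝ ∞ g (f a) ∧ g (f a) = a ∧ (∀ᶠ x in 𝓝 a, g (f x) = x) ∧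
      ∀ᶠ y in 𝓝 (f a), f (g y) = y := by
  have : CompleteSpace E := FiniteDimensional.complete ℝ E
  let e : E ≃L[ℝ] E := (LinearEquiv.ofBijective (fderiv ℝ f a).toLinearMap hb).toContinuousLinearEquiv
  have he : HasFDerivAt f (e : E →L[ℝ] E) a := by
    have : (e : E →L[ℝ] E) = fderiv ℝ f a := by ext v; rfl
    rw [this]
    exact (hf.differentiableAt (by simp)).hasFDerivAt
  have hs := hf.hasStrictFDerivAt' he (by simp)
  exact ⟨hf.localInverse he (by simp), hf.to_localInverse he (by simp),
    hs.localInverse_apply_image, hs.eventually_left_inverse, hs.eventually_right_inverse⟩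

/-! ### Images of functions under a point transformation. -/

/-- The change of the independent variables induced by `P` on the graph of `w`. -/
def baseMap (P : R3 → R3) (w : ℝ × ℝ → ℝ) (z : ℝ × ℝ) : ℝ × ℝ :=
  ((P (z.1, z.2, w z)).1, (P (z.1, z.2, w z)).2.1)

theorem contDiffAt_graph {w : ℝ × ℝ → ℝ} {z₀ : ℝ × ℝ} (hw : ContDiffAt ℝ ∞ w z₀) :
    ContDiffAt ℝ ∞ (fun z : ℝ × ℝ => ((z.1, z.2, w z) : R3)) z₀ :=
  contDiffAt_fst.prodMk (contDiffAt_snd.prodMk hw)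

theorem contDiffAt_comp_graph {P : R3 → R3} {w : ℝ × ℝ → ℝ} {z₀ : ℝ × ℝ}
    (hP : ContDiffAt ℝ ∞ P (z₀.1, z₀.2, w z₀)) (hw : ContDiffAt ℝ ∞ w z₀) :
    ContDiffAt ℝ ∞ (fun z : ℝ × ℝ => P (z.1, z.2, w z)) z₀ :=
  ContDiffAt.comp z₀ (f := fun z : ℝ × ℝ => ((z.1, z.2, w z) : R3)) hP (contDiffAt_graph hw)

theorem contDiffAt_baseMap {P : R3 → R3} {w : ℝ × ℝ → ℝ} {z₀ : ℝ × ℝ}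
    (hP : ContDiffAt ℝ ∞ P (z₀.1, z₀.2, w z₀)) (hw : ContDiffAt ℝ ∞ w z₀) :
    ContDiffAt ℝ ∞ (baseMap P w) z₀ :=
  (contDiffAt_comp_graph hP hw).fst.prodMk (contDiffAt_comp_graph hP hw).snd.fst

theorem hasFDerivAt_graph {w : ℝ × ℝ → ℝ} {z₀ : ℝ × ℝ} (hw : DifferentiableAt ℝ w z₀) :
    HasFDerivAt (fun z : ℝ × ℝ => ((z.1, z.2, w z) : R3))
      ((ContinuousLinearMap.fst ℝ ℝ ℝ).prod
        ((ContinuousLinearMap.snd ℝ ℝ ℝ).prod (fderiv ℝ w z₀))) z₀ :=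
  hasFDerivAt_fst.prodMk (hasFDerivAt_snd.prodMk hw.hasFDerivAt)

theorem fderiv_comp_graph {F : Type*} [NormedAddCommGroup F] [NormedSpace ℝ F]
    {f : R3 → F} {w : ℝ × ℝ → ℝ} {z₀ : ℝ × ℝ}
    (hf : DifferentiableAt ℝ f (z₀.1, z₀.2, w z₀)) (hw : DifferentiableAt ℝ w z₀) (v : ℝ × ℝ) :
    fderiv ℝ (fun z : ℝ × ℝ => f (z.1, z.2, w z)) z₀ v
      = fderiv ℝ f (z₀.1, z₀.2, w z₀) (v.1, v.2, fderiv ℝ w z₀ v) := by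
  have := HasFDerivAt.comp z₀ (f := fun z : ℝ × ℝ => ((z.1, z.2, w z) : R3))
    hf.hasFDerivAt (hasFDerivAt_graph hw)
  have h2 := this.fderiv
  simp only [Function.comp_def] at h2
  rw [h2]
  rfl

/-- Every function with a nondegenerate induced change of variables has an image under `P`. -/
theorem exists_image {P : R3 → R3} {w : ℝ × ℝ → ℝ} {z₀ : ℝ × ℝ}
    (hP : ContDiffAt ℝ ∞ P (z₀.1, z₀.2, w z₀)) (hw : ContDiffAt ℝ ∞ w z₀)
    (hb : Function.Bijective (fderiv ℝ (baseMap P w) z₀)) :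
    ∃ w' : ℝ × ℝ → ℝ, ContDiffAt ℝ ∞ w' (baseMap P w z₀) ∧
      ∀ᶠ z in 𝓝 z₀, w' (baseMap P w z) = (P (z.1, z.2, w z)).2.2 := by
  obtain ⟨b, hb1, hb2, hb3, -⟩ := exists_local_inverse (contDiffAt_baseMap hP hw) hb
  refine ⟨fun y => (P ((b y).1, (b y).2, w (b y))).2.2, ?_, ?_⟩
  · have h := contDiffAt_comp_graph hP hw
    rw [← hb2] at h
    exact (ContDiffAt.comp (baseMap P w z₀) h hb1).snd.snd
  · filter_upwards [hb3] with z hz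
    simp only [hz]

/-- Comparison of the images of two functions that agree to third order along the curve which is
mapped to the line `t' = const`. -/
theorem compare_images {P : R3 → R3} {w₁ w₂ w₁' w₂' : ℝ × ℝ → ℝ} {z₀ : ℝ × ℝ}
    {γ : ℝ → ℝ × ℝ} {c : ℝ}
    (hP : ContDiffAt ℝ ∞ P (z₀.1, z₀.2, w₁ z₀))
    (hPs : Function.Surjective (fderiv ℝ P (z₀.1, z₀.2, w₁ z₀)))
    (hw₁ : ContDiffAt ℝ ∞ w₁ z₀) (hw₂ : ContDiffAt ℝ ∞ w₂ z₀) (h0 : w₂ z₀ = w₁ z₀)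
    (hw₁' : ContDiffAt ℝ ∞ w₁' (baseMap P w₁ z₀)) (hw₂' : ContDiffAt ℝ ∞ w₂' (baseMap P w₁ z₀))
    (h₁ : ∀ᶠ z in 𝓝 z₀, w₁' (baseMap P w₁ z) = (P (z.1, z.2, w₁ z)).2.2)
    (h₂ : ∀ᶠ z in 𝓝 z₀, w₂' (baseMap P w₂ z) = (P (z.1, z.2, w₂ z)).2.2)
    (hγ : ContinuousAt γ 0) (hγ0 : γ 0 = z₀)
    (hγb : ∀ᶠ s in 𝓝 0, baseMap P w₂ (γ s) = baseMap P w₁ z₀ + (0, s))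
    (hc : (fun s => w₂ (γ s) - w₁ (γ s) - c * s ^ 3) =o[𝓝 0] fun s => s ^ 3) :
    ∃ κ : ℝ, κ ≠ 0 ∧
      (∀ v, fderiv ℝ w₂' (baseMap P w₁ z₀) (fderiv ℝ (baseMap P w₂) z₀ v)
          - fderiv ℝ w₁' (baseMap P w₁ z₀) (fderiv ℝ (baseMap P w₂) z₀ v)
        = κ * (fderiv ℝ w₂ z₀ v - fderiv ℝ w₁ z₀ v)) ∧
      iteratedDeriv 3 (fun y => w₂' ((baseMap P w₁ z₀).1, y)) (baseMap P w₁ z₀).2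
        - iteratedDeriv 3 (fun y => w₁' ((baseMap P w₁ z₀).1, y)) (baseMap P w₁ z₀).2
        = 6 * (κ * c) := by
  set p₀ : R3 := (z₀.1, z₀.2, w₁ z₀) with hp₀
  set y₀ := baseMap P w₁ z₀ with hy₀
  have hy₀' : y₀ = ((P p₀).1, (P p₀).2.1) := rfl
  have hw₂0 : (z₀.1, z₀.2, w₂ z₀) = p₀ := by rw [h0]
  have hP2 : ContDiffAt ℝ ∞ P (z₀.1, z₀.2, w₂ z₀) := by rw [hw₂0]; exact hP
  have hbase : baseMap P w₂ z₀ = y₀ := by simp only [baseMap, h0, hy₀]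
  have top : (∞ : WithTop ℕ∞) ≠ 0 := by simp
  -- The defining function `u' - w₁'(t', x')` of the image graph, pulled back by `P`. On the graph
  -- of `w₂` it equals `w₂' - w₁'` at the image point; its `u`-derivative at `p₀` is the factor `κ`.
  let E : R3 → ℝ := fun q => (P q).2.2 - w₁' ((P q).1, (P q).2.1)
  have hE : ContDiffAt ℝ ∞ E p₀ := by
    refine hP.snd.snd.sub ?_
    exact ContDiffAt.comp p₀ (f := fun q : R3 => ((P q).1, (P q).2.1))
      hw₁' (hP.fst.prodMk hP.snd.fst)
  set e := fderiv ℝ E p₀ with he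
  have hEe : HasStrictFDerivAt E e p₀ := hE.hasStrictFDerivAt top
  -- `E` vanishes on the graph of `w₁`
  have hz : ∀ᶠ z : ℝ × ℝ in 𝓝 z₀, E (z.1, z.2, w₁ z) = 0 := by
    filter_upwards [h₁] with z hz
    simp only [E]
    rw [← hz]
    simp [baseMap]
  have hz' : ∀ v : ℝ × ℝ, e (v.1, v.2, fderiv ℝ w₁ z₀ v) = 0 := by
    intro v
    rw [he, hp₀, ← fderiv_comp_graph (hE.differentiableAt top) (hw₁.differentiableAt top) v,
      Filter.EventuallyEq.fderiv_eq (f := fun _ => (0 : ℝ)) hz]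
    simp
  have esplit : ∀ a b r : ℝ, e (a, b, r) = e (a, b, 0) + r * e (0, 0, 1) := by
    intro a b r
    have : ((a, b, r) : R3) = (a, b, 0) + r • ((0, 0, 1) : R3) := by simp
    rw [this, map_add, map_smul, smul_eq_mul]
  -- `e` already kills the tangent plane of the graph of `w₁`. If it also killed the `u`-direction
  -- it would be zero, but it takes the value 1 on a vector that `fderiv ℝ P p₀` sends to `(0, 0,
  -- 1)`.
  have hκ : e (0, 0, 1) ≠ 0 := by
    intro hk
    have hall : ∀ q, e q = 0 := by
      rintro ⟨a, b, r⟩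
      have h1 := hz' (a, b)
      simp only at h1
      rw [esplit, hk] at h1 ⊢
      simpa using h1
    obtain ⟨v, hv⟩ := hPs (0, 0, 1)
    have hPd := (hP.differentiableAt top).hasFDerivAt
    have hd : HasFDerivAt E ((ContinuousLinearMap.snd ℝ ℝ ℝ).comp
        ((ContinuousLinearMap.snd ℝ ℝ (ℝ × ℝ)).comp (fderiv ℝ P p₀)) -
        (fderiv ℝ w₁' y₀).comp (((ContinuousLinearMap.fst ℝ ℝ (ℝ × ℝ)).comp (fderiv ℝ P p₀)).prod
          ((ContinuousLinearMap.fst ℝ ℝ ℝ).comp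
            ((ContinuousLinearMap.snd ℝ ℝ (ℝ × ℝ)).comp (fderiv ℝ P p₀))))) p₀ := by
      refine hPd.snd.snd.sub ?_
      exact HasFDerivAt.comp p₀ (f := fun q : R3 => ((P q).1, (P q).2.1))
        (hw₁'.differentiableAt top).hasFDerivAt (hPd.fst.prodMk hPd.snd.fst)
    have h1 := hall v
    rw [he, hd.fderiv] at h1
    have hzero : ((0 : ℝ), (0 : ℝ)) = 0 := rfl
    simp [hv, hzero] at h1
  refine ⟨e (0, 0, 1), hκ, ?_, ?_⟩
  · intro v
    have hd : ∀ᶠ z : ℝ × ℝ in 𝓝 z₀,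
        w₂' (baseMap P w₂ z) - w₁' (baseMap P w₂ z) = E (z.1, z.2, w₂ z) := by
      filter_upwards [h₂] with z hz
      rw [hz]; rfl
    have hb := (contDiffAt_baseMap hP2 hw₂).differentiableAt top
    have hw₂'' : DifferentiableAt ℝ w₂' (baseMap P w₂ z₀) := by
      rw [hbase]; exact hw₂'.differentiableAt top
    have hw₁'' : DifferentiableAt ℝ w₁' (baseMap P w₂ z₀) := by
      rw [hbase]; exact hw₁'.differentiableAt top
    have h3 := (hw₂''.hasFDerivAt.comp z₀ hb.hasFDerivAt).sub
      (hw₁''.hasFDerivAt.comp z₀ hb.hasFDerivAt)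
    have h4 := h3.fderiv
    have h5 := Filter.EventuallyEq.fderiv_eq (𝕜 := ℝ) hd
    have hE2 : DifferentiableAt ℝ E (z₀.1, z₀.2, w₂ z₀) := by
      rw [hw₂0]; exact hE.differentiableAt top
    have h6 := fderiv_comp_graph hE2 (hw₂.differentiableAt top) v
    rw [← h5, hw₂0, ← he, esplit] at h6
    have h7 := hz' v
    rw [esplit] at h7
    have h8 := congrArg (fun l : ℝ × ℝ →L[ℝ] ℝ => l v) h4
    simp only [hbase] at h8
    have h9 : fderiv ℝ (fun z => w₂' (baseMap P w₂ z) - w₁' (baseMap P w₂ z)) z₀ v =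
      fderiv ℝ w₂' y₀ (fderiv ℝ (baseMap P w₂) z₀ v)
          - fderiv ℝ w₁' y₀ (fderiv ℝ (baseMap P w₂) z₀ v) := h8
    rw [← h9, h6]
    linear_combination h7
  · let φ : ℝ → ℝ := fun s => w₂' (y₀.1, y₀.2 + s) - w₁' (y₀.1, y₀.2 + s)
    have hline : ContDiffAt ℝ ∞ (fun s : ℝ => ((y₀.1, y₀.2 + s) : ℝ × ℝ)) 0 := by fun_prop
    have hA : ContDiffAt ℝ ∞ (fun s => w₂' (y₀.1, y₀.2 + s)) 0 :=
      ContDiffAt.comp 0 (f := fun s : ℝ => ((y₀.1, y₀.2 + s) : ℝ × ℝ)) (by simpa using hw₂') hline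
    have hB : ContDiffAt ℝ ∞ (fun s => w₁' (y₀.1, y₀.2 + s)) 0 :=
      ContDiffAt.comp 0 (f := fun s : ℝ => ((y₀.1, y₀.2 + s) : ℝ × ℝ)) (by simpa using hw₁') hline
    have hγt : Tendsto γ (𝓝 0) (𝓝 z₀) := by have := hγ.tendsto; rwa [hγ0] at this
    have hc1 : Tendsto (fun s => (((γ s).1, (γ s).2, w₁ (γ s)) : R3)) (𝓝 0) (𝓝 p₀) :=
      (contDiffAt_graph hw₁).continuousAt.tendsto.comp hγt
    have hc2 : Tendsto (fun s => (((γ s).1, (γ s).2, w₂ (γ s)) : R3)) (𝓝 0) (𝓝 p₀) := by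
      rw [← hw₂0]
      exact (contDiffAt_graph hw₂).continuousAt.tendsto.comp hγt
    have hO : (fun s => w₂ (γ s) - w₁ (γ s)) =O[𝓝 0] fun s : ℝ => s ^ 3 := by
      have h1 : (fun s => c * s ^ 3) =O[𝓝 (0 : ℝ)] fun s : ℝ => s ^ 3 :=
        (Asymptotics.isBigO_refl _ _).const_mul_left c
      exact (hc.isBigO.add h1).congr_left fun s => by ring
    -- Strict differentiability is what is needed here: both points move with `s`, and the error
    -- must be small relative to their distance, which is `O(s³)`.
    have hst := hEe.isLittleO.comp_tendsto (hc2.prodMk_nhds hc1)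
    have hsub : ∀ s, (((γ s).1, (γ s).2, w₂ (γ s)) : R3) - ((γ s).1, (γ s).2, w₁ (γ s))
        = (0, 0, w₂ (γ s) - w₁ (γ s)) := fun s => by simp
    have hst2 : (fun s => E ((γ s).1, (γ s).2, w₂ (γ s)) - E ((γ s).1, (γ s).2, w₁ (γ s))
        - e (0, 0, 1) * (w₂ (γ s) - w₁ (γ s))) =o[𝓝 0] fun s : ℝ => s ^ 3 := by
      have h1 : (fun s => (((γ s).1, (γ s).2, w₂ (γ s)) : R3) - ((γ s).1, (γ s).2, w₁ (γ s)))
          =O[𝓝 0] fun s : ℝ => s ^ 3 := by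
        refine (Asymptotics.IsBigO.of_norm_right ?_)
        refine Asymptotics.IsBigO.trans ?_ hO.norm_right
        refine Asymptotics.IsBigO.of_bound 1 (Eventually.of_forall fun s => ?_)
        rw [hsub]
        simp [Prod.norm_def]
      refine (hst.trans_isBigO h1).congr_left fun s => ?_
      simp only [Function.comp]
      rw [hsub, esplit]
      have : ((0 : ℝ), (0 : ℝ), (0 : ℝ)) = (0 : R3) := rfl
      rw [this, map_zero]
      ring
    have hφ : (fun s => φ s - e (0, 0, 1) * c * s ^ 3) =o[𝓝 0] fun s : ℝ => s ^ 3 := by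
      refine (hst2.add (hc.const_mul_left (e (0, 0, 1)))).congr' ?_ EventuallyEq.rfl
      filter_upwards [hγt.eventually hz, hγt.eventually h₂, hγb] with s hs1 hs2 hs3
      have h1 : φ s = E ((γ s).1, (γ s).2, w₂ (γ s)) := by
        have : E ((γ s).1, (γ s).2, w₂ (γ s)) =
          (P ((γ s).1, (γ s).2, w₂ (γ s))).2.2 - w₁' (baseMap P w₂ (γ s)) := rfl
        rw [this, ← hs2, hs3]
        simp only [φ]
        have : y₀ + (0, s) = (y₀.1, y₀.2 + s) := by ext <;> simp
        rw [this]
      rw [h1, hs1]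
      ring
    have h3 := iteratedDeriv_three_of_isLittleO (hA.sub hB) hφ
    have hA3 : ContDiffAt ℝ (3 : ℕ) (fun s => w₂' (y₀.1, y₀.2 + s)) 0 :=
      hA.of_le (WithTop.coe_le_coe.2 le_top)
    have hB3 : ContDiffAt ℝ (3 : ℕ) (fun s => w₁' (y₀.1, y₀.2 + s)) 0 :=
      hB.of_le (WithTop.coe_le_coe.2 le_top)
    have h4 := iteratedDeriv_fun_sub hA3 hB3
    have h5 := iteratedDeriv_comp_const_add 3 (fun y => w₂' (y₀.1, y)) y₀.2
    have h6 := iteratedDeriv_comp_const_add 3 (fun y => w₁' (y₀.1, y)) y₀.2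
    have h5' := congrFun h5 0
    have h6' := congrFun h6 0
    simp only [add_zero] at h5' h6'
    rw [← h5', ← h6', ← h4, ← h3]

/-! ### Polynomials with prescribed jets. -/

theorem iteratedDeriv_three_eq {f f₁ f₂ : ℝ → ℝ} {c x : ℝ}
    (h₁ : ∀ᶠ y in 𝓝 x, HasDerivAt f (f₁ y) y) (h₂ : ∀ᶠ y in 𝓝 x, HasDerivAt f₁ (f₂ y) y)
    (h₃ : HasDerivAt f₂ c x) : iteratedDeriv 3 f x = c := by
  have e1 : deriv f =ᶠ[𝓝 x] f₁ := h₁.mono fun y hy => hy.deriv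
  have e2 : deriv f₁ =ᶠ[𝓝 x] f₂ := h₂.mono fun y hy => hy.deriv
  have e3 : deriv (deriv f) =ᶠ[𝓝 x] f₂ := e1.deriv.trans e2
  rw [iteratedDeriv_succ', iteratedDeriv_succ', iteratedDeriv_succ', iteratedDeriv_zero,
    e3.deriv_eq, h₃.deriv]

/-- A polynomial with the prescribed value `u`, first derivatives `p`, `q`, second and third
derivatives `r`, `s` with respect to `x`, and third derivative `6 e` with respect to `t`. -/
def jet (z₀ : ℝ × ℝ) (u p q r s e : ℝ) (z : ℝ × ℝ) : ℝ :=
  u + p * (z.1 - z₀.1) + q * (z.2 - z₀.2) + r / 2 * (z.2 - z₀.2) ^ 2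
    + s / 6 * (z.2 - z₀.2) ^ 3 + e * (z.1 - z₀.1) ^ 3

theorem contDiff_jet (z₀ : ℝ × ℝ) (u p q r s e : ℝ) : ContDiff ℝ ∞ (jet z₀ u p q r s e) := by
  unfold jet; fun_prop

theorem jet_self (z₀ : ℝ × ℝ) (u p q r s e : ℝ) : jet z₀ u p q r s e z₀ = u := by
  simp [jet]

theorem fderiv_eq_partials {F : Type*} [NormedAddCommGroup F] [NormedSpace ℝ F]
    (L : ℝ × ℝ →L[ℝ] F) (v : ℝ × ℝ) : L v = v.1 • L (1, 0) + v.2 • L (0, 1) := by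
  rw [← map_smul, ← map_smul, ← map_add]; simp

theorem deriv_fst {w : ℝ × ℝ → ℝ} {t x : ℝ} (hw : DifferentiableAt ℝ w (t, x)) :
    HasDerivAt (fun s => w (s, x)) (fderiv ℝ w (t, x) (1, 0)) t :=
  HasFDerivAt.comp_hasDerivAt t (f := fun s : ℝ => ((s, x) : ℝ × ℝ)) hw.hasFDerivAt
    ((hasDerivAt_id t).prodMk (hasDerivAt_const t x))

theorem deriv_snd {w : ℝ × ℝ → ℝ} {t x : ℝ} (hw : DifferentiableAt ℝ w (t, x)) :
    HasDerivAt (fun y => w (t, y)) (fderiv ℝ w (t, x) (0, 1)) x :=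
  HasFDerivAt.comp_hasDerivAt x (f := fun y : ℝ => ((t, y) : ℝ × ℝ)) hw.hasFDerivAt
    ((hasDerivAt_const x t).prodMk (hasDerivAt_id x))

theorem gardner_eq {θ : ℝ → R3} {w : ℝ × ℝ → ℝ} {y : ℝ × ℝ} (hw : DifferentiableAt ℝ w y) :
    gardner θ w y.1 y.2 = fderiv ℝ w y (1, 0)
      + ((θ y.1).1 * w y + (θ y.1).2.1 * w y ^ 2) * fderiv ℝ w y (0, 1)
      + (θ y.1).2.2 * iteratedDeriv 3 (fun x => w (y.1, x)) y.2 := by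
  rw [gardner, (deriv_fst hw).deriv, (deriv_snd hw).deriv]
  ring

theorem fderiv_jet (z₀ : ℝ × ℝ) (u p q r s e : ℝ) (v : ℝ × ℝ) :
    fderiv ℝ (jet z₀ u p q r s e) z₀ v = p * v.1 + q * v.2 := by
  have hd := ((contDiff_jet z₀ u p q r s e).differentiable (by simp)) z₀
  have ht : HasDerivAt (fun y => jet z₀ u p q r s e (y, z₀.2)) p z₀.1 := by
    have h1 : HasDerivAt (fun y : ℝ => y - z₀.1) 1 z₀.1 := (hasDerivAt_id _).sub_const _
    have := ((h1.const_mul p).const_add u).add ((h1.pow 3).const_mul e)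
    refine (this.congr_deriv (by simp)).congr_of_eventuallyEq (Eventually.of_forall fun y => ?_)
    simp [jet]
  have hx : HasDerivAt (fun y => jet z₀ u p q r s e (z₀.1, y)) q z₀.2 := by
    have h1 : HasDerivAt (fun y : ℝ => y - z₀.2) 1 z₀.2 := (hasDerivAt_id _).sub_const _
    have := (((h1.const_mul q).const_add u).add ((h1.pow 2).const_mul (r / 2))).add
      ((h1.pow 3).const_mul (s / 6))
    refine (this.congr_deriv (by simp)).congr_of_eventuallyEq (Eventually.of_forall fun y => ?_)
    simp [jet]
  rw [fderiv_eq_partials, (deriv_fst hd).unique ht, (deriv_snd hd).unique hx]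
  simp only [smul_eq_mul]
  ring

theorem iteratedDeriv_jet (z₀ : ℝ × ℝ) (u p q r s e : ℝ) :
    iteratedDeriv 3 (fun y => jet z₀ u p q r s e (z₀.1, y)) z₀.2 = s := by
  have h1 : ∀ x, HasDerivAt (fun y : ℝ => y - z₀.2) 1 x := fun x => (hasDerivAt_id _).sub_const _
  refine iteratedDeriv_three_eq (f₁ := fun y => q + r * (y - z₀.2) + s / 2 * (y - z₀.2) ^ 2)
    (f₂ := fun y => r + s * (y - z₀.2)) (Eventually.of_forall fun x => ?_)
    (Eventually.of_forall fun x => ?_) ?_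
  · have := ((((h1 x).const_mul q).const_add u).add (((h1 x).pow 2).const_mul (r / 2))).add
      (((h1 x).pow 3).const_mul (s / 6))
    refine (this.congr_deriv ?_).congr_of_eventuallyEq (Eventually.of_forall fun y => ?_)
    · simp; ring
    · simp [jet]
  · have := (((h1 x).const_mul r).const_add q).add (((h1 x).pow 2).const_mul (s / 2))
    refine (this.congr_deriv ?_)
    simp; ring
  · simpa using ((h1 z₀.2).const_mul s).const_add r

theorem gardner_jet (θ : ℝ → R3) (z₀ : ℝ × ℝ) (u p q r s e : ℝ) :
    gardner θ (jet z₀ u p q r s e) z₀.1 z₀.2 =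
      p + ((θ z₀.1).1 * u + (θ z₀.1).2.1 * u ^ 2) * q + (θ z₀.1).2.2 * s := by
  have hd := ((contDiff_jet z₀ u p q r s e).differentiable (by simp)) z₀
  rw [gardner_eq hd, iteratedDeriv_jet]
  simp [fderiv_jet, jet_self]

/-! ### Comparison of solution jets: the components for `t` and `x`. -/

/-- Factor the difference of cubes: the linear factor is `o(s)`, the quadratic one `O(s²)`. -/
theorem cube_isLittleO {ξ : ℝ → ℝ} {a v : ℝ} (h : HasDerivAt ξ v 0) (h0 : ξ 0 = a) :
    (fun s => (ξ s - a) ^ 3 - v ^ 3 * s ^ 3) =o[𝓝 0] fun s => s ^ 3 := by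
  have h1 : (fun s => ξ s - a - v * s) =o[𝓝 0] fun s : ℝ => s := by
    have := hasDerivAt_iff_isLittleO.1 h
    simp only [h0, sub_zero, smul_eq_mul] at this
    exact this.congr_left fun s => by ring
  have hs : (fun s : ℝ => v * s) =O[𝓝 0] fun s : ℝ => s :=
    (Asymptotics.isBigO_refl _ _).const_mul_left v
  have h2 : (fun s => ξ s - a) =O[𝓝 0] fun s : ℝ => s :=
    (h1.isBigO.add hs).congr_left fun s => by ring
  have h3 := h1.mul_isBigO (((h2.mul h2).add (h2.mul hs)).add (hs.mul hs))
  exact (h3.congr_left fun s => by ring).congr_right fun s => by ring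

theorem fderiv_baseMap {P : R3 → R3} {w : ℝ × ℝ → ℝ} {z₀ : ℝ × ℝ}
    (hP : ContDiffAt ℝ ∞ P (z₀.1, z₀.2, w z₀)) (hw : ContDiffAt ℝ ∞ w z₀) (v : ℝ × ℝ) :
    fderiv ℝ (baseMap P w) z₀ v =
      ((fderiv ℝ P (z₀.1, z₀.2, w z₀) (v.1, v.2, fderiv ℝ w z₀ v)).1,
        (fderiv ℝ P (z₀.1, z₀.2, w z₀) (v.1, v.2, fderiv ℝ w z₀ v)).2.1) := by
  have top : (∞ : WithTop ℕ∞) ≠ 0 := by simp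
  have h := ((contDiffAt_comp_graph hP hw).differentiableAt top).hasFDerivAt
  have h2 : HasFDerivAt (baseMap P w) _ z₀ := h.fst.prodMk h.snd.fst
  rw [h2.fderiv, ← fderiv_comp_graph (hP.differentiableAt top) (hw.differentiableAt top)]
  rfl

/-- The linearized determining equation for two solution jets that differ, along the curve mapped
to `t' = const`, by terms of third order. -/
theorem linearized_condition {D : Set R3} {P : R3 → R3} {θ θ' : ℝ → R3} (hD : IsOpen D)
    (h : IsAdmissible D P θ θ') {w₁ w₂ : ℝ × ℝ → ℝ} {z₀ : ℝ × ℝ} {γ : ℝ → ℝ × ℝ} {c : ℝ}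
    (hp : (z₀.1, z₀.2, w₁ z₀) ∈ D)
    (hw₁ : ContDiffAt ℝ ∞ w₁ z₀) (hw₂ : ContDiffAt ℝ ∞ w₂ z₀) (h0 : w₂ z₀ = w₁ z₀)
    (hb₁ : Function.Bijective (fderiv ℝ (baseMap P w₁) z₀))
    (hb₂ : Function.Bijective (fderiv ℝ (baseMap P w₂) z₀))
    (hg₁ : gardner θ w₁ z₀.1 z₀.2 = 0) (hg₂ : gardner θ w₂ z₀.1 z₀.2 = 0)
    (hγ : ContinuousAt γ 0) (hγ0 : γ 0 = z₀)
    (hγb : ∀ᶠ s in 𝓝 0, baseMap P w₂ (γ s) = baseMap P w₁ z₀ + (0, s))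
    (hc : (fun s => w₂ (γ s) - w₁ (γ s) - c * s ^ 3) =o[𝓝 0] fun s => s ^ 3) :
    ∃ l : ℝ × ℝ →L[ℝ] ℝ,
      (∀ v, l (fderiv ℝ (baseMap P w₂) z₀ v) = fderiv ℝ w₂ z₀ v - fderiv ℝ w₁ z₀ v) ∧
      ∃ m, l (1, 0) + m * l (0, 1)
        + 6 * (θ' (P (z₀.1, z₀.2, w₁ z₀)).1).2.2 * c = 0 := by
  obtain ⟨hPs, hPb, -, hM⟩ := h
  have top : (∞ : WithTop ℕ∞) ≠ 0 := by simp
  have hP : ContDiffAt ℝ ∞ P (z₀.1, z₀.2, w₁ z₀) := hPs.contDiffAt (hD.mem_nhds hp)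
  have hP2 : ContDiffAt ℝ ∞ P (z₀.1, z₀.2, w₂ z₀) := by rw [h0]; exact hP
  have hbase : baseMap P w₂ z₀ = baseMap P w₁ z₀ := by simp only [baseMap, h0]
  obtain ⟨w₁', hs₁, hr₁⟩ := exists_image hP hw₁ hb₁
  obtain ⟨w₂', hs₂, hr₂⟩ := exists_image hP2 hw₂ hb₂
  have e1 : gardner θ' w₁' (baseMap P w₁ z₀).1 (baseMap P w₁ z₀).2 = 0 :=
    (hM z₀.1 z₀.2 w₁ w₁' hp hw₁ hb₁ hs₁ hr₁).1 hg₁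
  have e2 : gardner θ' w₂' (baseMap P w₂ z₀).1 (baseMap P w₂ z₀).2 = 0 :=
    (hM z₀.1 z₀.2 w₂ w₂' (by rw [Prod.mk.eta, h0]; exact hp) hw₂ hb₂ hs₂ hr₂).1 hg₂
  rw [hbase] at hs₂ e2
  obtain ⟨κ, hκ, hi, hii⟩ := compare_images hP (hPb _ hp).2 hw₁ hw₂ h0 hs₁ hs₂ hr₁ hr₂ hγ hγ0 hγb hc
  have hv₁ := hr₁.self_of_nhds
  have hv₂ := hr₂.self_of_nhds
  rw [hbase, h0] at hv₂
  rw [gardner_eq (hs₁.differentiableAt top), hv₁] at e1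
  rw [gardner_eq (hs₂.differentiableAt top), hv₂] at e2
  have hpair : (P (z₀.1, z₀.2, w₁ z₀)).1 = (baseMap P w₁ z₀).1 := rfl
  rw [hpair]
  -- The two images have the same value at the common image point, so the nonlinear factor `m` is
  -- the same in both equations and their difference is linear; dividing by `κ` normalizes it.
  refine ⟨κ⁻¹ • (fderiv ℝ w₂' (baseMap P w₁ z₀) - fderiv ℝ w₁' (baseMap P w₁ z₀)),
    fun v => ?_, ((θ' (baseMap P w₁ z₀).1).1 * (P (z₀.1, z₀.2, w₁ z₀)).2.2
      + (θ' (baseMap P w₁ z₀).1).2.1 * (P (z₀.1, z₀.2, w₁ z₀)).2.2 ^ 2), ?_⟩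
  · have := hi v
    simp only [smul_apply, sub_apply, smul_eq_mul]
    rw [this]; field_simp
  · simp only [smul_apply, sub_apply, smul_eq_mul]
    field_simp
    linear_combination e2 - e1 - (θ' (baseMap P w₁ z₀).1).2.2 * hii

theorem map_eq_partials {F : Type*} [NormedAddCommGroup F] [NormedSpace ℝ F]
    (L : R3 →L[ℝ] F) (a b c : ℝ) :
    L (a, b, c) = a • L (1, 0, 0) + b • L (0, 1, 0) + c • L (0, 0, 1) := by
  rw [← map_smul, ← map_smul, ← map_smul, ← map_add, ← map_add]; simp

theorem bijective_of_det_ne_zero {M : ℝ × ℝ →L[ℝ] ℝ × ℝ}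
    (h : (M (1, 0)).1 * (M (0, 1)).2 - (M (0, 1)).1 * (M (1, 0)).2 ≠ 0) :
    Function.Bijective M := by
  have hi : Function.Injective M.toLinearMap := by
    rw [← LinearMap.ker_eq_bot, LinearMap.ker_eq_bot']
    intro v hv
    have hv' : M v = 0 := hv
    rw [fderiv_eq_partials] at hv'
    have h1 := congrArg Prod.fst hv'
    have h2 := congrArg Prod.snd hv'
    simp only [Prod.fst_add, Prod.snd_add, Prod.smul_fst, Prod.smul_snd, smul_eq_mul, Prod.fst_zero,
      Prod.snd_zero] at h1 h2
    ext
    · refine (mul_eq_zero.1 (?_ : _ * v.1 = 0)).resolve_left h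
      linear_combination (M (0, 1)).2 * h1 - (M (0, 1)).1 * h2
    · refine (mul_eq_zero.1 (?_ : _ * v.2 = 0)).resolve_left h
      linear_combination (M (1, 0)).1 * h2 - (M (1, 0)).2 * h1
  exact ⟨hi, LinearMap.injective_iff_surjective.1 hi⟩

/-- The product of the two affine functions vanishes on the whole plane, and polynomials have no
zero divisors; five values suffice to compare the coefficients. -/
theorem eq_zero_of_mul_affine {m n c₀ c₁ c₂ : ℝ}
    (h : ∀ p q : ℝ, c₀ + c₁ * p + c₂ * q ≠ 0 → m + n * q = 0)
    (hc : ¬ (c₀ = 0 ∧ c₁ = 0 ∧ c₂ = 0)) : m = 0 ∧ n = 0 := by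
  have h' : ∀ p q : ℝ, (m + n * q) * (c₀ + c₁ * p + c₂ * q) = 0 := by
    intro p q
    by_cases hz : c₀ + c₁ * p + c₂ * q = 0
    · rw [hz, mul_zero]
    · rw [h p q hz, zero_mul]
  have e00 := h' 0 0
  have e01 := h' 0 1
  have e02 := h' 0 (-1)
  have e10 := h' 1 0
  have e11 := h' 1 1
  have hm0 : m * c₀ = 0 := by linear_combination e00
  have hm1 : m * c₁ = 0 := by linear_combination e10 - e00
  have hn2 : n * c₂ = 0 := by linear_combination (e01 + e02) / 2 - e00
  have hmn : m * c₂ + n * c₀ = 0 := by linear_combination (e01 - e02) / 2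
  have hn1 : n * c₁ = 0 := by linear_combination e11 - e01 - e10 + e00
  have hm : m = 0 := by
    by_contra hm
    have a0 := (mul_eq_zero.1 hm0).resolve_left hm
    have a1 := (mul_eq_zero.1 hm1).resolve_left hm
    rw [a0, mul_zero, add_zero] at hmn
    exact hc ⟨a0, a1, (mul_eq_zero.1 hmn).resolve_left hm⟩
  refine ⟨hm, ?_⟩
  by_contra hn
  rw [hm, zero_mul, zero_add] at hmn
  exact hc ⟨(mul_eq_zero.1 hmn).resolve_left hn, (mul_eq_zero.1 hn1).resolve_left hn,
    (mul_eq_zero.1 hn2).resolve_left hn⟩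

theorem fderiv_baseMap_jet {P : R3 → R3} {z₀ : ℝ × ℝ} {u : ℝ} (p q r s e : ℝ)
    (hP : ContDiffAt ℝ ∞ P (z₀.1, z₀.2, u)) (v : ℝ × ℝ) :
    fderiv ℝ (baseMap P (jet z₀ u p q r s e)) z₀ v =
      ((fderiv ℝ P (z₀.1, z₀.2, u) (v.1, v.2, p * v.1 + q * v.2)).1,
        (fderiv ℝ P (z₀.1, z₀.2, u) (v.1, v.2, p * v.1 + q * v.2)).2.1) := by
  have := fderiv_baseMap (w := jet z₀ u p q r s e) (by rw [jet_self]; exact hP)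
    (contDiff_jet z₀ u p q r s e).contDiffAt v
  rw [jet_self, fderiv_jet] at this
  exact this

theorem bijective_fderiv_baseMap_jet {P : R3 → R3} {z₀ : ℝ × ℝ} {u : ℝ} (p q r s e : ℝ)
    (hP : ContDiffAt ℝ ∞ P (z₀.1, z₀.2, u))
    (h : (fderiv ℝ P (z₀.1, z₀.2, u) (1, 0, p)).1 * (fderiv ℝ P (z₀.1, z₀.2, u) (0, 1, q)).2.1
      - (fderiv ℝ P (z₀.1, z₀.2, u) (0, 1, q)).1 * (fderiv ℝ P (z₀.1, z₀.2, u) (1, 0, p)).2.1 ≠ 0) :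
    Function.Bijective (fderiv ℝ (baseMap P (jet z₀ u p q r s e)) z₀) := by
  apply bijective_of_det_ne_zero
  simpa [fderiv_baseMap_jet p q r s e hP] using h

/-- The test functions `w₁`, `w₂` differ by `(t - t₀)³`, which affects neither the gradient nor the
equation at `z₀`, so `l = 0` in `linearized_condition`. What remains is `g' v.1 ^ 3 = 0` for the
tangent `v` of the curve mapped to `t' = const`. Hence `v` points along `x`, and the total
derivative `T_x + q T_u` vanishes. -/
theorem time_derivative_along {D : Set R3} {P : R3 → R3} {θ θ' : ℝ → R3} (hD : IsOpen D)
    (h : IsAdmissible D P θ θ') (hθ : ∀ p ∈ D, θ p.1 ∈ regular) {z₀ : ℝ × ℝ} {u : ℝ}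
    (hp : (z₀.1, z₀.2, u) ∈ D) (p q : ℝ)
    (hJ : (fderiv ℝ P (z₀.1, z₀.2, u) (1, 0, p)).1 * (fderiv ℝ P (z₀.1, z₀.2, u) (0, 1, q)).2.1
      - (fderiv ℝ P (z₀.1, z₀.2, u) (0, 1, q)).1 * (fderiv ℝ P (z₀.1, z₀.2, u) (1, 0, p)).2.1 ≠ 0) :
    (fderiv ℝ P (z₀.1, z₀.2, u) (0, 1, q)).1 = 0 := by
  have top : (∞ : WithTop ℕ∞) ≠ 0 := by simp
  have hP : ContDiffAt ℝ ∞ P (z₀.1, z₀.2, u) := h.1.contDiffAt (hD.mem_nhds hp)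
  have hg : (θ z₀.1).2.2 ≠ 0 := right_ne_zero_of_mul (hθ _ hp)
  -- The third derivative that puts the jet on the equation, available because `g ≠ 0`.
  set s := -(p + ((θ z₀.1).1 * u + (θ z₀.1).2.1 * u ^ 2) * q) / (θ z₀.1).2.2 with hs
  have hgs : p + ((θ z₀.1).1 * u + (θ z₀.1).2.1 * u ^ 2) * q + (θ z₀.1).2.2 * s = 0 := by
    rw [hs]; field_simp; ring
  set w₁ := jet z₀ u p q 0 s 0 with hw₁
  set w₂ := jet z₀ u p q 0 s 1 with hw₂
  have h1 : w₁ z₀ = u := jet_self ..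
  have h2 : w₂ z₀ = u := jet_self ..
  have hb₁ := bijective_fderiv_baseMap_jet p q 0 s 0 hP hJ
  have hb₂ := bijective_fderiv_baseMap_jet p q 0 s 1 hP hJ
  have hsm := contDiffAt_baseMap (w := w₂) (z₀ := z₀) (by rw [h2]; exact hP)
    (contDiff_jet ..).contDiffAt
  have hbase : baseMap P w₂ z₀ = baseMap P w₁ z₀ := by simp only [baseMap, h1, h2]
  obtain ⟨b, hbs, hb0, -, hbr⟩ := exists_local_inverse hsm hb₂
  rw [hbase] at hbs hb0 hbr
  set y₀ := baseMap P w₁ z₀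
  let γ : ℝ → ℝ × ℝ := fun σ => b (y₀ + (0, σ))
  have hline : HasDerivAt (fun σ : ℝ => y₀ + ((0, σ) : ℝ × ℝ)) (0, 1) 0 :=
    ((hasDerivAt_const (0 : ℝ) (0 : ℝ)).prodMk (hasDerivAt_id (0 : ℝ))).const_add y₀
  have hz : y₀ + ((0 : ℝ), (0 : ℝ)) = y₀ := by
    rw [show ((0 : ℝ), (0 : ℝ)) = 0 from rfl, add_zero]
  have hγ0 : γ 0 = z₀ := by simp only [γ, hz, hb0]
  have hγd : HasDerivAt γ (fderiv ℝ b y₀ (0, 1)) 0 := by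
    refine HasFDerivAt.comp_hasDerivAt (0 : ℝ) (f := fun σ : ℝ => y₀ + ((0, σ) : ℝ × ℝ)) ?_ hline
    rw [hz]
    exact (hbs.differentiableAt top).hasFDerivAt
  set v := fderiv ℝ b y₀ (0, 1)
  have hγb : ∀ᶠ σ in 𝓝 0, baseMap P w₂ (γ σ) = y₀ + (0, σ) := by
    have : Tendsto (fun σ : ℝ => y₀ + ((0, σ) : ℝ × ℝ)) (𝓝 0) (𝓝 y₀) := by
      have := hline.continuousAt.tendsto
      rwa [hz] at this
    exact this.eventually hbr
  have hMv : fderiv ℝ (baseMap P w₂) z₀ v = (0, 1) := by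
    have e1 : HasDerivAt (fun σ => baseMap P w₂ (γ σ)) (fderiv ℝ (baseMap P w₂) z₀ v) 0 := by
      refine HasFDerivAt.comp_hasDerivAt (0 : ℝ) (l := baseMap P w₂) (f := γ) ?_ hγd
      rw [hγ0]
      exact (hsm.differentiableAt top).hasFDerivAt
    exact e1.unique (hline.congr_of_eventuallyEq hγb)
  have hc : (fun σ => w₂ (γ σ) - w₁ (γ σ) - v.1 ^ 3 * σ ^ 3) =o[𝓝 0] fun σ => σ ^ 3 := by
    refine (cube_isLittleO (ξ := fun σ => (γ σ).1) (a := z₀.1) hγd.fst (by simp [hγ0])).congr_left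
      fun σ => ?_
    simp only [hw₁, hw₂, jet]
    ring
  obtain ⟨l, hl, m, hm⟩ := linearized_condition hD h (w₁ := w₁) (w₂ := w₂) (z₀ := z₀) (γ := γ)
    (by rw [h1]; exact hp) (contDiff_jet ..).contDiffAt
    (contDiff_jet ..).contDiffAt (by rw [h1, h2]) hb₁ hb₂
    (by rw [hw₁, gardner_jet]; exact hgs) (by rw [hw₂, gardner_jet]; exact hgs)
    hγd.continuousAt hγ0 hγb hc
  have hl0 : ∀ y, l y = 0 := by
    intro y
    obtain ⟨x, rfl⟩ := hb₂.2 y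
    rw [hl x, hw₁, hw₂, fderiv_jet, fderiv_jet, sub_self]
  have hg' : (θ' (P (z₀.1, z₀.2, w₁ z₀)).1).2.2 ≠ 0 := by
    rw [h1]
    exact right_ne_zero_of_mul (h.2.2.1.2 _ ⟨_, hp, rfl⟩)
  rw [hl0, hl0] at hm
  have hv1 : v.1 = 0 := by
    have : v.1 ^ 3 = 0 := by
      refine (mul_eq_zero.1 (?_ : (θ' (P (z₀.1, z₀.2, w₁ z₀)).1).2.2 * v.1 ^ 3 = 0)).resolve_left hg'
      linear_combination hm / 6
    exact pow_eq_zero_iff (by norm_num) |>.1 this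
  rw [hw₂, fderiv_baseMap_jet _ _ _ _ _ hP, hv1] at hMv
  have e : (((0 : ℝ), v.2, p * 0 + q * v.2) : R3) = v.2 • ((0, 1, q) : R3) := by
    ext <;> simp [mul_comm]
  rw [e, map_smul] at hMv
  have e1 := congrArg Prod.fst hMv
  have e2 := congrArg Prod.snd hMv
  simp only [Prod.smul_fst, Prod.smul_snd, smul_eq_mul] at e1 e2
  refine (mul_eq_zero.1 e1).resolve_left ?_
  rintro h0
  rw [h0, zero_mul] at e2
  exact zero_ne_one e2

/-- `time_derivative_along` applies whenever the Jacobian of `(T, X)` formed with total derivatives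
is nonzero. The products `p q` cancel in this Jacobian, so it is affine in `(p, q)`; up to sign its
coefficients are the 2×2 minors of the differential of `(T, X)`, which has rank 2. -/
theorem time_derivative_eq_zero {D : Set R3} {P : R3 → R3} {θ θ' : ℝ → R3} (hD : IsOpen D)
    (h : IsAdmissible D P θ θ') (hθ : ∀ p ∈ D, θ p.1 ∈ regular) {p₀ : R3} (hp : p₀ ∈ D) :
    (fderiv ℝ P p₀ (0, 1, 0)).1 = 0 ∧ (fderiv ℝ P p₀ (0, 0, 1)).1 = 0 := by
  obtain ⟨t, x, u⟩ := p₀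
  set L := fderiv ℝ P (t, x, u) with hL
  refine eq_zero_of_mul_affine (c₀ := (L (1, 0, 0)).1 * (L (0, 1, 0)).2.1
      - (L (0, 1, 0)).1 * (L (1, 0, 0)).2.1)
    (c₁ := (L (0, 0, 1)).1 * (L (0, 1, 0)).2.1 - (L (0, 1, 0)).1 * (L (0, 0, 1)).2.1)
    (c₂ := (L (1, 0, 0)).1 * (L (0, 0, 1)).2.1 - (L (0, 0, 1)).1 * (L (1, 0, 0)).2.1) ?_ ?_
  · intro p q hJ
    have := time_derivative_along hD h hθ (z₀ := (t, x)) (u := u) hp p q ?_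
    · simp only [← hL] at this
      rw [map_eq_partials] at this
      simp only [Prod.fst_add, Prod.smul_fst, smul_eq_mul] at this
      linear_combination this
    · simp only [← hL]
      rw [map_eq_partials L 1 0 p, map_eq_partials L 0 1 q]
      simp only [Prod.fst_add, Prod.snd_add, Prod.smul_fst, Prod.smul_snd, smul_eq_mul]
      convert hJ using 1
      ring
  · rintro ⟨h0, h1, h2⟩
    have hs := (h.2.1 _ hp).2
    rw [← hL] at hs
    obtain ⟨⟨a, b, c⟩, hv⟩ := hs (1, 0, 0)
    obtain ⟨⟨a', b', c'⟩, hv'⟩ := hs (0, 1, 0)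
    rw [map_eq_partials] at hv hv'
    have e1 := congrArg Prod.fst hv
    have e2 := congrArg (fun y => y.2.1) hv
    have e3 := congrArg (fun y => y.2.1) hv'
    simp only [Prod.fst_add, Prod.snd_add, Prod.smul_fst, Prod.smul_snd, smul_eq_mul] at e1 e2 e3
    -- If all minors vanish, the `X`-row is a multiple of the `T`-row; the vector sent to `(1, 0,
    -- 0)` shows that the multiple is zero. Then `(0, 1, 0)` cannot be attained.
    have f1 : (L (1, 0, 0)).2.1 = 0 := by
      linear_combination (-(L (1, 0, 0)).2.1) * e1 + (L (1, 0, 0)).1 * e2 - b * h0 - c * h2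
    have f2 : (L (0, 1, 0)).2.1 = 0 := by
      linear_combination (-(L (0, 1, 0)).2.1) * e1 + (L (0, 1, 0)).1 * e2 + a * h0 + c * h1
    have f3 : (L (0, 0, 1)).2.1 = 0 := by
      linear_combination (-(L (0, 0, 1)).2.1) * e1 + (L (0, 0, 1)).1 * e2 + a * h2 - b * h1
    rw [f1, f2, f3] at e3
    simp at e3

theorem isOpen_box {I A B : Set ℝ} (hI : IsOpen I) (hA : IsOpen A) (hB : IsOpen B) :
    IsOpen (box I A B) :=
  hI.prod (hA.prod hB)

theorem mem_box {I A B : Set ℝ} {t x u : ℝ} (ht : t ∈ I) (hx : x ∈ A) (hu : u ∈ B) :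
    ((t, x, u) : R3) ∈ box I A B := ⟨ht, hx, hu⟩

theorem eq_of_partials_eq_zero {I A B : Set ℝ} (hA : IsOpenInterval A) (hB : IsOpenInterval B)
    {F : R3 → ℝ} (hF : ∀ p ∈ box I A B, DifferentiableAt ℝ F p)
    (h₁ : ∀ p ∈ box I A B, fderiv ℝ F p (0, 1, 0) = 0)
    (h₂ : ∀ p ∈ box I A B, fderiv ℝ F p (0, 0, 1) = 0) {t x x' u u' : ℝ} (ht : t ∈ I)
    (hx : x ∈ A) (hx' : x' ∈ A) (hu : u ∈ B) (hu' : u' ∈ B) : F (t, x, u) = F (t, x', u') := by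
  have hd : ∀ y ∈ A ×ˢ B, HasFDerivAt (fun y : ℝ × ℝ => F (t, y.1, y.2))
      ((fderiv ℝ F (t, y.1, y.2)).comp (ContinuousLinearMap.inr ℝ ℝ (ℝ × ℝ))) y := by
    intro y hy
    exact HasFDerivAt.comp y (f := fun y : ℝ × ℝ => ((t, y.1, y.2) : R3))
      (hF _ (mem_box ht hy.1 hy.2)).hasFDerivAt (hasFDerivAt_prodMk_right t y)
  refine (hA.1.prod hB.1).is_const_of_fderiv_eq_zero (𝕜 := ℝ)
    (f := fun y : ℝ × ℝ => F (t, y.1, y.2)) (hA.2.1.convex.prod hB.2.1.convex).isPreconnected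
    (fun y hy => (hd y hy).differentiableAt.differentiableWithinAt) ?_
    (x := (x, u)) (y := (x', u')) ⟨hx, hu⟩ ⟨hx', hu'⟩
  intro y hy
  rw [(hd y hy).fderiv]
  ext
  · simpa using h₁ _ (mem_box ht hy.1 hy.2)
  · simpa using h₂ _ (mem_box ht hy.1 hy.2)

theorem fderiv_fst_apply {P : R3 → R3} {p : R3} (hP : DifferentiableAt ℝ P p) (v : R3) :
    fderiv ℝ (fun q => (P q).1) p v = (fderiv ℝ P p v).1 := by
  rw [hP.hasFDerivAt.fst.fderiv]; rfl

theorem fderiv_snd_fst_apply {P : R3 → R3} {p : R3} (hP : DifferentiableAt ℝ P p) (v : R3) :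
    fderiv ℝ (fun q => (P q).2.1) p v = (fderiv ℝ P p v).2.1 := by
  rw [hP.hasFDerivAt.snd.fst.fderiv]; rfl

theorem fderiv_snd_snd_apply {P : R3 → R3} {p : R3} (hP : DifferentiableAt ℝ P p) (v : R3) :
    fderiv ℝ (fun q => (P q).2.2) p v = (fderiv ℝ P p v).2.2 := by
  rw [hP.hasFDerivAt.snd.snd.fderiv]; rfl

theorem time_component {I A B : Set ℝ} (hI : IsOpenInterval I) (hA : IsOpenInterval A)
    (hB : IsOpenInterval B) {P : R3 → R3} {θ θ' : ℝ → R3} (hθ : InClass I θ)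
    (h : IsAdmissible (box I A B) P θ θ') {t x x' u u' : ℝ} (ht : t ∈ I)
    (hx : x ∈ A) (hx' : x' ∈ A) (hu : u ∈ B) (hu' : u' ∈ B) :
    (P (t, x, u)).1 = (P (t, x', u')).1 := by
  have hD := isOpen_box hI.1 hA.1 hB.1
  have hP : ∀ p ∈ box I A B, DifferentiableAt ℝ P p := fun p hp =>
    (h.1.contDiffAt (hD.mem_nhds hp)).differentiableAt (by simp)
  have key := fun p (hp : p ∈ box I A B) =>
    time_derivative_eq_zero hD h (fun p hp => hθ.2 _ hp.1) hp
  exact eq_of_partials_eq_zero hA hB (F := fun q => (P q).1)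
    (fun p hp => (hP p hp).fst)
    (fun p hp => by rw [fderiv_fst_apply (hP p hp)]; exact (key p hp).1)
    (fun p hp => by rw [fderiv_fst_apply (hP p hp)]; exact (key p hp).2) ht hx hx' hu hu'

theorem time_derivative_ne_zero {P : R3 → R3} {p : R3}
    (hs : Function.Surjective (fderiv ℝ P p)) (h₁ : (fderiv ℝ P p (0, 1, 0)).1 = 0)
    (h₂ : (fderiv ℝ P p (0, 0, 1)).1 = 0) : (fderiv ℝ P p (1, 0, 0)).1 ≠ 0 := by
  intro h
  obtain ⟨⟨a, b, c⟩, hv⟩ := hs (1, 0, 0)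
  rw [map_eq_partials] at hv
  have := congrArg Prod.fst hv
  simp [h, h₁, h₂] at this

/-- Raising `w_xxx` by 6 and lowering `w_t` by `6 g` keeps a jet on the equation. Lines `t = const`
now go to lines `t' = const`, so the comparison curve stays in `t = t₀` and has speed `1/X` there,
where `X = X_x + q X_u`. Up to the common factor `κ`, the images differ by `-6 g / T_t` in the
`t'`-derivative, by nothing in the `x'`-derivative and by `6 / X³` in the third derivative. -/
theorem space_derivative_along {D : Set R3} {P : R3 → R3} {θ θ' : ℝ → R3} (hD : IsOpen D)
    (h : IsAdmissible D P θ θ') (hθ : ∀ p ∈ D, θ p.1 ∈ regular) {z₀ : ℝ × ℝ} {u : ℝ}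
    (hp : (z₀.1, z₀.2, u) ∈ D)
    (hT : ∀ᶠ y : ℝ × ℝ in 𝓝 (z₀.2, u), (P (z₀.1, y.1, y.2)).1 = (P (z₀.1, z₀.2, u)).1) (q : ℝ)
    (hX : (fderiv ℝ P (z₀.1, z₀.2, u) (0, 1, q)).2.1 ≠ 0) :
    (θ z₀.1).2.2 * (fderiv ℝ P (z₀.1, z₀.2, u) (0, 1, q)).2.1 ^ 3 =
      (θ' (P (z₀.1, z₀.2, u)).1).2.2 * (fderiv ℝ P (z₀.1, z₀.2, u) (1, 0, 0)).1 := by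
  have top : (∞ : WithTop ℕ∞) ≠ 0 := by simp
  have hP : ContDiffAt ℝ ∞ P (z₀.1, z₀.2, u) := h.1.contDiffAt (hD.mem_nhds hp)
  obtain ⟨hTx, hTu⟩ := time_derivative_eq_zero hD h hθ hp
  have hTt := time_derivative_ne_zero (h.2.1 _ hp).2 hTx hTu
  set L := fderiv ℝ P (z₀.1, z₀.2, u) with hL
  have hT1 : ∀ a b c : ℝ, (L (a, b, c)).1 = a * (L (1, 0, 0)).1 := by
    intro a b c
    rw [map_eq_partials]
    simp [hTx, hTu]
  set g := (θ z₀.1).2.2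
  set p := -(((θ z₀.1).1 * u + (θ z₀.1).2.1 * u ^ 2) * q) with hpdef
  set w₁ := jet z₀ u p q 0 0 0 with hw₁
  set w₂ := jet z₀ u (p - 6 * g) q 0 6 0 with hw₂
  have h1 : w₁ z₀ = u := jet_self ..
  have h2 : w₂ z₀ = u := jet_self ..
  have hJ : ∀ p, (L (1, 0, p)).1 * (L (0, 1, q)).2.1 - (L (0, 1, q)).1 * (L (1, 0, p)).2.1 ≠ 0 := by
    intro p
    rw [hT1 1 0 p, hT1 0 1 q]
    simpa using ⟨hTt, hX⟩
  have hb₁ := bijective_fderiv_baseMap_jet p q 0 0 0 hP (hJ _)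
  have hb₂ := bijective_fderiv_baseMap_jet (p - 6 * g) q 0 6 0 hP (hJ _)
  have hsm := contDiffAt_baseMap (w := w₂) (z₀ := z₀) (by rw [h2]; exact hP)
    (contDiff_jet ..).contDiffAt
  have hbase : baseMap P w₂ z₀ = baseMap P w₁ z₀ := by simp only [baseMap, h1, h2]
  have hMv := fun v => fderiv_baseMap_jet (u := u) (p - 6 * g) q 0 6 0 hP v
  simp only [← hL] at hMv
  let f : ℝ → ℝ := fun x => (baseMap P w₂ (z₀.1, x)).2
  have hline : ContDiffAt ℝ ∞ (fun x : ℝ => ((z₀.1, x) : ℝ × ℝ)) z₀.2 := by fun_prop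
  have hf : ContDiffAt ℝ ∞ f z₀.2 :=
    (ContDiffAt.comp z₀.2 (f := fun x : ℝ => ((z₀.1, x) : ℝ × ℝ)) hsm hline).snd
  have hf' : HasDerivAt f (L (0, 1, q)).2.1 z₀.2 := by
    have e1 : HasDerivAt (fun x => baseMap P w₂ (z₀.1, x))
        (fderiv ℝ (baseMap P w₂) z₀ (0, 1)) z₀.2 :=
      HasFDerivAt.comp_hasDerivAt z₀.2 (l := baseMap P w₂) (f := fun x : ℝ => ((z₀.1, x) : ℝ × ℝ))
        (hsm.differentiableAt top).hasFDerivAt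
        ((hasDerivAt_const z₀.2 z₀.1).prodMk (hasDerivAt_id z₀.2))
    rw [hMv] at e1
    exact (HasFDerivAt.comp_hasDerivAt z₀.2 (hasFDerivAt_snd (𝕜 := ℝ)) e1).congr_deriv (by simp)
  have hfb : Function.Bijective (fderiv ℝ f z₀.2) := by
    rw [hf'.hasFDerivAt.fderiv]
    constructor
    · intro a b hab
      simpa [hX] using hab
    · intro a
      exact ⟨a / (L (0, 1, q)).2.1, by simp [hX]⟩
  obtain ⟨ξ, hξs, hξ0, hξl, hξr⟩ := exists_local_inverse hf hfb
  set y₀ := baseMap P w₁ z₀ with hy₀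
  have hfy : f z₀.2 = y₀.2 := by rw [← hbase]
  rw [hfy] at hξs hξ0 hξr
  have hshift : HasDerivAt (fun σ : ℝ => y₀.2 + σ) 1 0 := (hasDerivAt_id (0 : ℝ)).const_add _
  have hξd : HasDerivAt (fun σ : ℝ => ξ (y₀.2 + σ)) (deriv ξ y₀.2) 0 := by
    have : HasDerivAt ξ (deriv ξ y₀.2) (y₀.2 + 0) := by
      rw [add_zero]; exact (hξs.differentiableAt top).hasDerivAt
    exact (HasDerivAt.comp (0 : ℝ) this hshift).congr_deriv (mul_one _)
  have hξv : deriv ξ y₀.2 * (L (0, 1, q)).2.1 = 1 := by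
    have e1 : HasDerivAt (fun x => ξ (f x)) (deriv ξ y₀.2 * (L (0, 1, q)).2.1) z₀.2 := by
      refine HasDerivAt.comp z₀.2 ?_ hf'
      rw [hfy]; exact (hξs.differentiableAt top).hasDerivAt
    exact e1.unique ((hasDerivAt_id z₀.2).congr_of_eventuallyEq hξl)
  let γ : ℝ → ℝ × ℝ := fun σ => (z₀.1, ξ (y₀.2 + σ))
  have hγ0 : γ 0 = z₀ := by simp only [γ, add_zero, hξ0]
  have hγc : ContinuousAt γ 0 := continuousAt_const.prodMk hξd.continuousAt
  have htend : Tendsto (fun σ : ℝ => y₀.2 + σ) (𝓝 0) (𝓝 y₀.2) := by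
    simpa using hshift.continuousAt.tendsto
  have hγb : ∀ᶠ σ in 𝓝 0, baseMap P w₂ (γ σ) = y₀ + (0, σ) := by
    have e1 : Tendsto (fun σ => ((γ σ).2, w₂ (γ σ))) (𝓝 0) (𝓝 (z₀.2, u)) := by
      have hcont : ContinuousAt (fun z : ℝ × ℝ => (z.2, w₂ z)) (γ 0) :=
        continuousAt_snd.prodMk ((contDiff_jet ..).continuous.continuousAt)
      have := hcont.tendsto.comp hγc.tendsto
      rwa [hγ0, h2] at this
    filter_upwards [htend.eventually hξr, e1.eventually hT] with σ h3 h4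
    ext
    · simp only [baseMap, γ] at h4 ⊢
      rw [h4]
      simp [hy₀, baseMap, h1]
    · exact h3
  have hc : (fun σ => w₂ (γ σ) - w₁ (γ σ) - deriv ξ y₀.2 ^ 3 * σ ^ 3) =o[𝓝 0] fun σ => σ ^ 3 := by
    refine (cube_isLittleO (a := z₀.2) hξd (by simp [hξ0])).congr_left
      fun σ => ?_
    simp only [hw₁, hw₂, jet, γ]
    ring
  obtain ⟨l, hl, m, hm⟩ := linearized_condition hD h (w₁ := w₁) (w₂ := w₂) (z₀ := z₀) (γ := γ)
    (by rw [h1]; exact hp) (contDiff_jet ..).contDiffAt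
    (contDiff_jet ..).contDiffAt (by rw [h1, h2]) hb₁ hb₂
    (by rw [hw₁, gardner_jet, hpdef]; ring) (by rw [hw₂, gardner_jet, hpdef]; simp only [g]; ring)
    hγc hγ0 hγb hc
  have hl1 := hl (0, 1)
  have hl2 := hl (1, 0)
  rw [hMv, hw₁, hw₂, fderiv_jet, fderiv_jet, fderiv_eq_partials l] at hl1 hl2
  simp only [smul_eq_mul, mul_one, mul_zero, add_zero, zero_add] at hl1 hl2
  rw [hT1 0 1] at hl1
  rw [hT1 1 0] at hl2
  have l01 : l (0, 1) = 0 := by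
    have : (L (0, 1, q)).2.1 * l (0, 1) = 0 := by linear_combination hl1
    exact (mul_eq_zero.1 this).resolve_left hX
  rw [l01] at hl2 hm
  rw [h1] at hm
  set d := deriv ξ y₀.2
  set X := (L (0, 1, q)).2.1
  set T := (L (1, 0, 0)).1
  set g' := (θ' (P (z₀.1, z₀.2, u)).1).2.2
  linear_combination X ^ 3 / 6 * hl2 - T * X ^ 3 / 6 * hm
    + g' * T * ((d * X) ^ 2 + d * X + 1) * hξv

theorem space_derivative {D : Set R3} {P : R3 → R3} {θ θ' : ℝ → R3} (hD : IsOpen D)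
    (h : IsAdmissible D P θ θ') (hθ : ∀ p ∈ D, θ p.1 ∈ regular) {t x u : ℝ}
    (hp : (t, x, u) ∈ D)
    (hT : ∀ᶠ y : ℝ × ℝ in 𝓝 (x, u), (P (t, y.1, y.2)).1 = (P (t, x, u)).1) :
    (fderiv ℝ P (t, x, u) (0, 0, 1)).2.1 = 0 ∧ (fderiv ℝ P (t, x, u) (0, 1, 0)).2.1 ≠ 0 ∧
    (θ t).2.2 * (fderiv ℝ P (t, x, u) (0, 1, 0)).2.1 ^ 3 =
      (θ' (P (t, x, u)).1).2.2 * (fderiv ℝ P (t, x, u) (1, 0, 0)).1 := by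
  have key := space_derivative_along hD h hθ (z₀ := (t, x)) hp hT
  simp only at key
  obtain ⟨hTx, hTu⟩ := time_derivative_eq_zero hD h hθ hp
  set L := fderiv ℝ P (t, x, u) with hL
  have hg : (θ t).2.2 ≠ 0 := right_ne_zero_of_mul (hθ _ hp)
  have hsplit : ∀ q, (L (0, 1, q)).2.1 = (L (0, 1, 0)).2.1 + q * (L (0, 0, 1)).2.1 := by
    intro q
    rw [map_eq_partials L 0 1 q]; simp
  have hXu : (L (0, 0, 1)).2.1 = 0 := by
    by_contra hne
    -- Slopes for which `X_x + q X_u` equals 1 and 2: the cubic relation would give `g = 8 g`.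
    have k1 := key ((1 - (L (0, 1, 0)).2.1) / (L (0, 0, 1)).2.1)
    have k2 := key ((2 - (L (0, 1, 0)).2.1) / (L (0, 0, 1)).2.1)
    rw [hsplit, div_mul_cancel₀ _ hne, add_sub_cancel] at k1 k2
    have := (k1 (by norm_num)).trans (k2 (by norm_num)).symm
    apply hg
    linear_combination -this / 7
  have hXx : (L (0, 1, 0)).2.1 ≠ 0 := by
    intro h0
    obtain ⟨⟨a, b, c⟩, hv⟩ := (h.2.1 _ hp).2 (0, 1, 0)
    rw [← hL, map_eq_partials] at hv
    have e1 := congrArg Prod.fst hv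
    have e2 := congrArg (fun y => y.2.1) hv
    simp only [Prod.fst_add, Prod.snd_add, Prod.smul_fst, Prod.smul_snd, smul_eq_mul, hTx, hTu,
      hXu, h0, mul_zero, add_zero] at e1 e2
    have hTt := time_derivative_ne_zero (h.2.1 _ hp).2 hTx hTu
    rw [(mul_eq_zero.1 e1).resolve_right hTt] at e2
    simp at e2
  exact ⟨hXu, hXx, key 0 hXx⟩

/-! ### Partial derivatives and third-order chain rules. -/

/-- The partial derivative with respect to `t`. -/
def dt (H : R3 → ℝ) (p : R3) : ℝ := fderiv ℝ H p (1, 0, 0)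

/-- The partial derivative with respect to `x`. -/
def dx (H : R3 → ℝ) (p : R3) : ℝ := fderiv ℝ H p (0, 1, 0)

/-- The partial derivative with respect to `u`. -/
def du (H : R3 → ℝ) (p : R3) : ℝ := fderiv ℝ H p (0, 0, 1)

theorem contDiffAt_fderiv_apply {H : R3 → ℝ} {p : R3} (hH : ContDiffAt ℝ ∞ H p) (v : R3) :
    ContDiffAt ℝ ∞ (fun q => fderiv ℝ H q v) p :=
  (hH.fderiv_right (m := ∞) (by simp)).clm_apply contDiffAt_const

theorem fderiv_eq_dt_dx_du {H : R3 → ℝ} {p : R3} (a b c : ℝ) :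
    fderiv ℝ H p (a, b, c) = a * dt H p + b * dx H p + c * du H p :=
  map_eq_partials _ a b c

theorem dx_du_comm {H : R3 → ℝ} {p : R3} (hH : ContDiffAt ℝ ∞ H p) :
    dx (du H) p = du (dx H) p := by
  have hs := (hH.isSymmSndFDerivAt 
    (by rw [minSmoothness_of_isRCLikeNormedField]; exact WithTop.coe_le_coe.2 le_top)) (0, 1, 0) (0, 0, 1)
  have hd : DifferentiableAt ℝ (fderiv ℝ H) p :=
    (hH.fderiv_right (m := ∞) (by simp)).differentiableAt (by simp)
  have e : ∀ v w : R3, fderiv ℝ (fun q => fderiv ℝ H q v) p w = fderiv ℝ (fderiv ℝ H) p w v := by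
    intro v w
    rw [fderiv_clm_apply hd (differentiableAt_const v)]
    simp
  show fderiv ℝ (fun q => fderiv ℝ H q (0, 0, 1)) p (0, 1, 0) =
    fderiv ℝ (fun q => fderiv ℝ H q (0, 1, 0)) p (0, 0, 1)
  rw [e, e, hs]

theorem hasDerivAt_comp_slice {H : R3 → ℝ} {t x : ℝ} {c : ℝ → ℝ} {c' : ℝ}
    (hH : DifferentiableAt ℝ H (t, x, c x)) (hc : HasDerivAt c c' x) :
    HasDerivAt (fun y => H (t, y, c y)) (dx H (t, x, c x) + du H (t, x, c x) * c') x := by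
  have := HasFDerivAt.comp_hasDerivAt x (l := H) (f := fun y : ℝ => ((t, y, c y) : R3))
    hH.hasFDerivAt ((hasDerivAt_const x t).prodMk ((hasDerivAt_id x).prodMk hc))
  refine this.congr_deriv ?_
  rw [fderiv_eq_dt_dx_du]; ring

/-- The third derivative of `x ↦ H (t, x, c x)`. -/
theorem iteratedDeriv_three_comp_slice {H : R3 → ℝ} {t x : ℝ} {c c₁ c₂ : ℝ → ℝ} {c₃ : ℝ}
    (hH : ContDiffAt ℝ ∞ H (t, x, c x)) (h₁ : ∀ y, HasDerivAt c (c₁ y) y)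
    (h₂ : ∀ y, HasDerivAt c₁ (c₂ y) y) (h₃ : HasDerivAt c₂ c₃ x) :
    iteratedDeriv 3 (fun y => H (t, y, c y)) x =
      (dx (dx (dx H)) (t, x, c x) + du (dx (dx H)) (t, x, c x) * c₁ x
        + (dx (du (dx H)) (t, x, c x) + du (du (dx H)) (t, x, c x) * c₁ x) * c₁ x
        + ((dx (dx (du H)) (t, x, c x) + du (dx (du H)) (t, x, c x) * c₁ x)
          + (dx (du (du H)) (t, x, c x) + du (du (du H)) (t, x, c x) * c₁ x) * c₁ x) * c₁ x)
      + 3 * (dx (du H) (t, x, c x) + du (du H) (t, x, c x) * c₁ x) * c₂ x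
      + du H (t, x, c x) * c₃ := by
  have top : (∞ : WithTop ℕ∞) ≠ 0 := by simp
  have hpath : Tendsto (fun y : ℝ => ((t, y, c y) : R3)) (𝓝 x) (𝓝 (t, x, c x)) :=
    (continuousAt_const.prodMk (continuousAt_id.prodMk (h₁ x).continuousAt)).tendsto
  have hev : ∀ {G : R3 → ℝ}, ContDiffAt ℝ ∞ G (t, x, c x) →
      ∀ᶠ y in 𝓝 x, HasDerivAt (fun y => G (t, y, c y))
        (dx G (t, y, c y) + du G (t, y, c y) * c₁ y) y := by
    intro G hG
    have h1 : ContDiffAt ℝ 1 G (t, x, c x) := hG.of_le (WithTop.coe_le_coe.2 le_top)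
    filter_upwards [hpath.eventually (h1.eventually (by simp))] with y hy
    exact hasDerivAt_comp_slice (hy.differentiableAt (by simp)) (h₁ y)
  have hX : ContDiffAt ℝ ∞ (dx H) (t, x, c x) := contDiffAt_fderiv_apply hH (0, 1, 0)
  have hU : ContDiffAt ℝ ∞ (du H) (t, x, c x) := contDiffAt_fderiv_apply hH (0, 0, 1)
  have hXX : ContDiffAt ℝ ∞ (dx (dx H)) (t, x, c x) := contDiffAt_fderiv_apply hX (0, 1, 0)
  have hXU : ContDiffAt ℝ ∞ (du (dx H)) (t, x, c x) := contDiffAt_fderiv_apply hX (0, 0, 1)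
  have hUX : ContDiffAt ℝ ∞ (dx (du H)) (t, x, c x) := contDiffAt_fderiv_apply hU (0, 1, 0)
  have hUU : ContDiffAt ℝ ∞ (du (du H)) (t, x, c x) := contDiffAt_fderiv_apply hU (0, 0, 1)
  have main := iteratedDeriv_three_eq (x := x) (hev hH)
    (f₂ := fun y => (dx (dx H) (t, y, c y) + du (dx H) (t, y, c y) * c₁ y)
      + ((dx (du H) (t, y, c y) + du (du H) (t, y, c y) * c₁ y) * c₁ y
        + du H (t, y, c y) * c₂ y)) ?_
    (((hev hXX).self_of_nhds.add ((hev hXU).self_of_nhds.mul (h₂ x))).add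
      ((((hev hUX).self_of_nhds.add ((hev hUU).self_of_nhds.mul (h₂ x))).mul (h₂ x)).add
        ((hev hU).self_of_nhds.mul h₃)))
  · rw [main]
    simp only [Pi.add_apply, Pi.mul_apply]
    -- The factor of `c₂` contains `dx (du H)` twice and `du (dx H)` once; symmetry turns this into
    -- the factor 3.
    linear_combination (-c₂ x) * dx_du_comm hH
  · filter_upwards [hev hX, hev hU] with y hy1 hy2
    exact hy1.add (hy2.mul (h₂ y))

theorem iteratedDeriv_three_comp_affine {f : ℝ → ℝ} {a x₀ y₀ : ℝ} (hf : ContDiffAt ℝ ∞ f y₀) :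
    iteratedDeriv 3 (fun x => f (y₀ + a * (x - x₀))) x₀ = a ^ 3 * iteratedDeriv 3 f y₀ := by
  have haff : ∀ x, HasDerivAt (fun x => y₀ + a * (x - x₀)) a x := fun x => by
    simpa using (((hasDerivAt_id x).sub_const x₀).const_mul a).const_add y₀
  have htend : Tendsto (fun x => y₀ + a * (x - x₀)) (𝓝 x₀) (𝓝 y₀) := by
    simpa using (haff x₀).continuousAt.tendsto
  have hev : ∀ {h : ℝ → ℝ}, ContDiffAt ℝ ∞ h y₀ → ∀ᶠ x in 𝓝 x₀,
      HasDerivAt (fun x => h (y₀ + a * (x - x₀))) (a * deriv h (y₀ + a * (x - x₀))) x := by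
    intro h hh
    have h1 : ContDiffAt ℝ 1 h y₀ := hh.of_le (WithTop.coe_le_coe.2 le_top)
    filter_upwards [htend.eventually (h1.eventually (by simp))] with x hx
    have := (hx.differentiableAt (by simp)).hasDerivAt.comp x (haff x)
    exact this.congr_deriv (mul_comm _ _)
  have hderiv : ∀ {h : ℝ → ℝ}, ContDiffAt ℝ ∞ h y₀ → ContDiffAt ℝ ∞ (deriv h) y₀ := by
    intro h hh
    exact (hh.fderiv_right (m := ∞) (by simp)).clm_apply contDiffAt_const
  have h1 := hderiv hf
  have h2 := hderiv h1
  have h3 := (hev h2).self_of_nhds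
  refine iteratedDeriv_three_eq (hev hf)
    (f₂ := fun x => a * (a * deriv (deriv f) (y₀ + a * (x - x₀)))) ?_ ?_
  · filter_upwards [hev h1] with x hx using hx.const_mul a
  · refine ((h3.const_mul a).const_mul a).congr_deriv ?_
    rw [iteratedDeriv_succ', iteratedDeriv_succ', iteratedDeriv_succ', iteratedDeriv_zero]
    simp only [sub_self, mul_zero, add_zero]
    ring

/-- The `t`-component of a point transformation. -/
def compT (P : R3 → R3) (p : R3) : ℝ := (P p).1

/-- The `x`-component of a point transformation. -/
def compX (P : R3 → R3) (p : R3) : ℝ := (P p).2.1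

/-- The `u`-component of a point transformation. -/
def compU (P : R3 → R3) (p : R3) : ℝ := (P p).2.2

theorem fderiv_eq_components {P : R3 → R3} {p : R3} (hP : DifferentiableAt ℝ P p) (v : R3) :
    fderiv ℝ P p v = (fderiv ℝ (compT P) p v, fderiv ℝ (compX P) p v, fderiv ℝ (compU P) p v) := by
  have h1 := fderiv_fst_apply hP v
  have h2 := fderiv_snd_fst_apply hP v
  have h3 := fderiv_snd_snd_apply hP v
  ext
  · exact h1.symm
  · exact h2.symm
  · exact h3.symm

/-! ### The determining equation. -/

section Admissible

variable {I A B : Set ℝ} {P : R3 → R3} {θ θ' : ℝ → R3}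

theorem IsAdmissible.contDiffAt (hI : IsOpenInterval I) (hA : IsOpenInterval A)
    (hB : IsOpenInterval B) (h : IsAdmissible (box I A B) P θ θ') {p : R3} (hp : p ∈ box I A B) :
    ContDiffAt ℝ ∞ P p :=
  h.1.contDiffAt ((isOpen_box hI.1 hA.1 hB.1).mem_nhds hp)

theorem IsAdmissible.first_order (hI : IsOpenInterval I) (hA : IsOpenInterval A)
    (hB : IsOpenInterval B) (hθ : InClass I θ) (h : IsAdmissible (box I A B) P θ θ') {p : R3}
    (hp : p ∈ box I A B) :
    dx (compT P) p = 0 ∧ du (compT P) p = 0 ∧ dt (compT P) p ≠ 0 ∧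
    du (compX P) p = 0 ∧ dx (compX P) p ≠ 0 ∧
    (θ p.1).2.2 * dx (compX P) p ^ 3 = (θ' (compT P p)).2.2 * dt (compT P) p := by
  have hD := isOpen_box hI.1 hA.1 hB.1
  have hP := (h.contDiffAt hI hA hB hp).differentiableAt (by simp)
  have hθ' : ∀ p ∈ box I A B, θ p.1 ∈ regular := fun p hp => hθ.2 _ hp.1
  obtain ⟨h1, h2⟩ := time_derivative_eq_zero hD h hθ' hp
  have h3 := time_derivative_ne_zero (h.2.1 _ hp).2 h1 h2
  obtain ⟨t, x, u⟩ := p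
  have hT : ∀ᶠ y : ℝ × ℝ in 𝓝 (x, u), (P (t, y.1, y.2)).1 = (P (t, x, u)).1 := by
    filter_upwards [(hA.1.prod hB.1).mem_nhds (Set.mk_mem_prod hp.2.1 hp.2.2)] with y hy
    exact time_component hI hA hB hθ h hp.1 hy.1 hp.2.1 hy.2 hp.2.2
  obtain ⟨h4, h5, h6⟩ := space_derivative hD h hθ' hp hT
  simp only [fderiv_eq_components hP] at h1 h2 h3 h4 h5 h6
  exact ⟨h1, h2, h3, h4, h5, h6⟩

theorem contDiffAt_components {p : R3} (hP : ContDiffAt ℝ ∞ P p) :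
    ContDiffAt ℝ ∞ (compT P) p ∧ ContDiffAt ℝ ∞ (compX P) p ∧ ContDiffAt ℝ ∞ (compU P) p :=
  ⟨hP.fst, hP.snd.fst, hP.snd.snd⟩

theorem compT_eq (hI : IsOpenInterval I) (hA : IsOpenInterval A)
    (hB : IsOpenInterval B) (hθ : InClass I θ) (h : IsAdmissible (box I A B) P θ θ')
    {t x x' u u' : ℝ} (ht : t ∈ I)
    (hx : x ∈ A) (hx' : x' ∈ A) (hu : u ∈ B) (hu' : u' ∈ B) :
    compT P (t, x, u) = compT P (t, x', u') :=
  time_component hI hA hB hθ h ht hx hx' hu hu'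

theorem dt_eq_of_eq {H : R3 → ℝ} (hI : IsOpen I) {t x x' u u' : ℝ} (ht : t ∈ I)
    (hH : DifferentiableAt ℝ H (t, x, u)) (hH' : DifferentiableAt ℝ H (t, x', u'))
    {c : ℝ} (he : ∀ s ∈ I, H (s, x, u) = H (s, x', u') + c) :
    dt H (t, x, u) = dt H (t, x', u') := by
  have key : ∀ {x u}, DifferentiableAt ℝ H (t, x, u) →
      HasDerivAt (fun s => H (s, x, u)) (dt H (t, x, u)) t := fun {x u} hd =>
    HasFDerivAt.comp_hasDerivAt t (l := H) (f := fun s : ℝ => ((s, x, u) : R3)) hd.hasFDerivAt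
      ((hasDerivAt_id t).prodMk ((hasDerivAt_const t x).prodMk (hasDerivAt_const t u)))
  refine (key hH).unique (((key hH').add_const c).congr_of_eventuallyEq ?_)
  filter_upwards [hI.mem_nhds ht] with s hs using he s hs

/-- In `g X_x³ = g' T_t` all the other factors depend on `t` alone, and cubing is injective on the
reals. -/
theorem dx_compX_eq (hI : IsOpenInterval I) (hA : IsOpenInterval A)
    (hB : IsOpenInterval B) (hθ : InClass I θ) (h : IsAdmissible (box I A B) P θ θ')
    {t x x' u u' : ℝ} (ht : t ∈ I)
    (hx : x ∈ A) (hx' : x' ∈ A) (hu : u ∈ B) (hu' : u' ∈ B) :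
    dx (compX P) (t, x, u) = dx (compX P) (t, x', u') := by
  have hp := mem_box ht hx hu
  have hp' := mem_box ht hx' hu'
  obtain ⟨-, -, -, -, -, h1⟩ := h.first_order hI hA hB hθ hp
  obtain ⟨-, -, -, -, -, h2⟩ := h.first_order hI hA hB hθ hp'
  have hd : dt (compT P) (t, x, u) = dt (compT P) (t, x', u') :=
    dt_eq_of_eq hI.1 ht
      ((contDiffAt_components (h.contDiffAt hI hA hB hp)).1.differentiableAt (by simp))
      ((contDiffAt_components (h.contDiffAt hI hA hB hp')).1.differentiableAt (by simp)) (c := 0)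
      fun s hs => by rw [add_zero]; exact compT_eq hI hA hB hθ h hs hx hx' hu hu'
  rw [compT_eq hI hA hB hθ h ht hx hx' hu hu', hd, ← h2] at h1
  have hg : (θ t).2.2 ≠ 0 := right_ne_zero_of_mul (hθ.2 _ ht)
  exact (Odd.strictMono_pow (by decide : Odd 3)).injective (mul_left_cancel₀ hg h1)

theorem sub_eq_of_partials {H : R3 → ℝ} (hA : IsOpenInterval A) (hB : IsOpenInterval B)
    {t a b : ℝ} (hH : ∀ x ∈ A, ∀ u ∈ B, DifferentiableAt ℝ H (t, x, u))
    (h₁ : ∀ x ∈ A, ∀ u ∈ B, dx H (t, x, u) = a)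
    (h₂ : ∀ x ∈ A, ∀ u ∈ B, du H (t, x, u) = b) {x x' u u' : ℝ}
    (hx : x ∈ A) (hx' : x' ∈ A) (hu : u ∈ B) (hu' : u' ∈ B) :
    H (t, x, u) = H (t, x', u') + a * (x - x') + b * (u - u') := by
  have hd : ∀ p ∈ box {t} A B, HasFDerivAt (fun p : R3 => H p - (a * p.2.1 + b * p.2.2))
      (fderiv ℝ H p - (a • (ContinuousLinearMap.fst ℝ ℝ ℝ).comp (ContinuousLinearMap.snd ℝ ℝ (ℝ × ℝ))
        + b • (ContinuousLinearMap.snd ℝ ℝ ℝ).comp (ContinuousLinearMap.snd ℝ ℝ (ℝ × ℝ)))) p := by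
    rintro ⟨s, x, u⟩ ⟨hs, hx, hu⟩
    obtain rfl : s = t := hs
    exact (hH x hx u hu).hasFDerivAt.sub ((hasFDerivAt_snd.fst.const_mul a).add
      (hasFDerivAt_snd.snd.const_mul b))
  have := eq_of_partials_eq_zero (I := {t}) hA hB
    (F := fun p : R3 => H p - (a * p.2.1 + b * p.2.2)) (fun p hp => (hd p hp).differentiableAt)
    (fun p hp => by
      rw [(hd p hp).fderiv]
      obtain ⟨s, x, u⟩ := p
      obtain rfl : s = t := hp.1
      have := h₁ x hp.2.1 u hp.2.2
      simp only [dx] at this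
      simp [this])
    (fun p hp => by
      rw [(hd p hp).fderiv]
      obtain ⟨s, x, u⟩ := p
      obtain rfl : s = t := hp.1
      have := h₂ x hp.2.1 u hp.2.2
      simp only [du] at this
      simp [this]) (Set.mem_singleton t) hx hx' hu hu'
  simp only at this
  linear_combination this

theorem compX_eq (hI : IsOpenInterval I) (hA : IsOpenInterval A)
    (hB : IsOpenInterval B) (hθ : InClass I θ) (h : IsAdmissible (box I A B) P θ θ')
    {t x x' u u' : ℝ} (ht : t ∈ I)
    (hx : x ∈ A) (hx' : x' ∈ A) (hu : u ∈ B) (hu' : u' ∈ B) :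
    compX P (t, x', u') = compX P (t, x, u) + dx (compX P) (t, x, u) * (x' - x) := by
  have := sub_eq_of_partials (H := compX P) (t := t) (a := dx (compX P) (t, x, u)) (b := 0) hA hB
    (fun x hx u hu => (contDiffAt_components
      (h.contDiffAt hI hA hB (mem_box ht hx hu))).2.1.differentiableAt (by simp))
    (fun y hy v hv => dx_compX_eq hI hA hB hθ h ht hy hx hv hu)
    (fun y hy v hv => (h.first_order hI hA hB hθ (mem_box ht hy hv)).2.2.2.1) hx' hx hu' hu
  rw [this]; ring

/-- The determining equation for the components of an admissible transformation. -/
theorem determining_equation (hI : IsOpenInterval I) (hA : IsOpenInterval A)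
    (hB : IsOpenInterval B) (hθ : InClass I θ) (h : IsAdmissible (box I A B) P θ θ')
    {t x u : ℝ} (ht : t ∈ I) (hx : x ∈ A) (hu : u ∈ B) {p q r s : ℝ}
    (hs : p + ((θ t).1 * u + (θ t).2.1 * u ^ 2) * q + (θ t).2.2 * s = 0) :
    dx (compX P) (t, x, u) * (dt (compU P) (t, x, u) + du (compU P) (t, x, u) * p)
      - (dx (compU P) (t, x, u) + du (compU P) (t, x, u) * q) * dt (compX P) (t, x, u)
      + dt (compT P) (t, x, u) * ((θ' (compT P (t, x, u))).1 * compU P (t, x, u)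
        + (θ' (compT P (t, x, u))).2.1 * compU P (t, x, u) ^ 2)
        * (dx (compU P) (t, x, u) + du (compU P) (t, x, u) * q)
      + (θ t).2.2 * dx (compX P) (t, x, u)
        * iteratedDeriv 3 (fun y => compU P (t, y, jet (t, x) u p q r s 0 (t, y))) x = 0 := by
  have top : (∞ : WithTop ℕ∞) ≠ 0 := by simp
  have hp := mem_box ht hx hu
  have hD := isOpen_box hI.1 hA.1 hB.1
  have hP := h.contDiffAt hI hA hB hp
  obtain ⟨hTs, hXs, hUs⟩ := contDiffAt_components hP
  obtain ⟨hTx, hTu, hTt, hXu, hXx, hg⟩ := h.first_order hI hA hB hθ hp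
  set w := jet (t, x) u p q r s 0 with hw
  have hw0 : w (t, x) = u := jet_self ..
  have hws : ContDiffAt ℝ ∞ w (t, x) := (contDiff_jet ..).contDiffAt
  have hM : ∀ v : ℝ × ℝ, fderiv ℝ (baseMap P w) (t, x) v =
      (v.1 * dt (compT P) (t, x, u), v.1 * dt (compX P) (t, x, u) + v.2 * dx (compX P) (t, x, u)) := by
    intro v
    rw [hw, fderiv_baseMap_jet (z₀ := (t, x)) (u := u) p q r s 0 hP,
      fderiv_eq_components (hP.differentiableAt top)]
    simp only [fderiv_eq_dt_dx_du, hTx, hTu, hXu, mul_zero, add_zero]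
  have hb : Function.Bijective (fderiv ℝ (baseMap P w) (t, x)) := by
    apply bijective_of_det_ne_zero
    simp only [hM]
    simpa using ⟨hTt, hXx⟩
  have hPw : ContDiffAt ℝ ∞ P ((t, x).1, (t, x).2, w (t, x)) := by rw [hw0]; exact hP
  obtain ⟨w', hs', hr'⟩ := exists_image hPw hws hb
  set y₀ := baseMap P w (t, x) with hy₀
  have e1 : gardner θ' w' y₀.1 y₀.2 = 0 := by
    refine (h.2.2.2 t x w w' (by rw [hw0]; exact hp) hws hb hs' hr').1 ?_
    have := gardner_jet θ (t, x) u p q r s 0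
    exact this.trans hs
  rw [gardner_eq (hs'.differentiableAt top), hr'.self_of_nhds] at e1
  simp only [hw0] at e1
  -- the first derivatives of the image
  have hbd := (contDiffAt_baseMap hPw hws).differentiableAt top
  have hcomp : ∀ v : ℝ × ℝ, fderiv ℝ w' y₀ (fderiv ℝ (baseMap P w) (t, x) v)
      = fderiv ℝ (compU P) (t, x, u) (v.1, v.2, p * v.1 + q * v.2) := by
    intro v
    have h1 := ((hs'.differentiableAt top).hasFDerivAt.comp (t, x) hbd.hasFDerivAt).fderiv
    have h2 : w' ∘ baseMap P w =ᶠ[𝓝 (t, x)] fun z => compU P (z.1, z.2, w z) := hr'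
    rw [h2.fderiv_eq] at h1
    have hU2 : DifferentiableAt ℝ (compU P) ((t, x).1, (t, x).2, w (t, x)) := by
      rw [hw0]; exact hUs.differentiableAt top
    have h3 := fderiv_comp_graph hU2 (hws.differentiableAt top) v
    rw [h1, hw0] at h3
    rw [← fderiv_jet (t, x) u p q r s 0, ← hw]
    exact h3
  have hc1 := hcomp (0, 1)
  have hc2 := hcomp (1, 0)
  rw [hM, fderiv_eq_partials, fderiv_eq_dt_dx_du] at hc1 hc2
  simp only [smul_eq_mul, zero_mul, one_mul, mul_zero, mul_one, zero_add, add_zero] at hc1 hc2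
  -- the third derivative
  have hslice : ContDiffAt ℝ ∞ (fun y => w' (y₀.1, y)) y₀.2 :=
    ContDiffAt.comp y₀.2 (f := fun y : ℝ => ((y₀.1, y) : ℝ × ℝ)) hs' (by fun_prop)
  have h3 := iteratedDeriv_three_comp_affine (a := dx (compX P) (t, x, u)) (x₀ := x) hslice
  have hev : (fun y => w' (y₀.1, y₀.2 + dx (compX P) (t, x, u) * (y - x))) =ᶠ[𝓝 x]
      fun y => compU P (t, y, w (t, y)) := by
    have hc : Tendsto (fun y : ℝ => ((t, y) : ℝ × ℝ)) (𝓝 x) (𝓝 (t, x)) :=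
      (continuousAt_const.prodMk continuousAt_id).tendsto
    have hwB : ∀ᶠ y in 𝓝 x, w (t, y) ∈ B := by
      have := (hws.continuousAt.tendsto.comp hc)
      rw [hw0] at this
      exact this.eventually (hB.1.mem_nhds hu)
    filter_upwards [hc.eventually hr', hA.1.mem_nhds hx, hwB] with y hy1 hy2 hy3
    rw [show compU P (t, y, w (t, y)) = w' (baseMap P w (t, y)) from hy1.symm]
    congr 1
    ext
    · have : y₀.1 = compT P (t, x, u) := by rw [hy₀, ← hw0]; rfl
      rw [this]
      exact compT_eq hI hA hB hθ h ht hx hy2 hu hy3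
    · have : y₀.2 = compX P (t, x, u) := by rw [hy₀, ← hw0]; rfl
      rw [this]
      exact (compX_eq hI hA hB hθ h ht hx hy2 hu hy3).symm
  rw [hev.iteratedDeriv_eq] at h3
  have hy1 : y₀.1 = compT P (t, x, u) := by rw [hy₀, ← hw0]; rfl
  have hU0 : (P (t, x, u)).2.2 = compU P (t, x, u) := rfl
  rw [hU0, hy1] at e1
  rw [h3, hy1]
  simp only at hg
  set m := (θ' (compT P (t, x, u))).1 * compU P (t, x, u)
    + (θ' (compT P (t, x, u))).2.1 * compU P (t, x, u) ^ 2
  set a := dx (compX P) (t, x, u)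
  -- The image equation multiplied by `X_x T_t`. The chain rule in `hc1`, `hc2` eliminates the first
  -- derivatives of `w'`, and `hg` replaces `g' T_t` by `g X_x³`, the power that the affine change
  -- of `x` contributes.
  linear_combination a * dt (compT P) (t, x, u) * e1 - a * hc2
    - (dt (compT P) (t, x, u) * m - dt (compX P) (t, x, u)) * hc1
    + a * iteratedDeriv 3 (fun y => w' (compT P (t, x, u), y)) y₀.2 * hg

end Admissible

/-! ### Solving the determining equation. -/

theorem eq_zero_of_quadratic {B : Set ℝ} (hB : IsOpenInterval B) {a b c : ℝ}
    (h : ∀ u ∈ B, a + b * u + c * u ^ 2 = 0) : a = 0 ∧ b = 0 ∧ c = 0 := by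
  obtain ⟨u, hu⟩ := hB.2.2
  obtain ⟨ε, hε, hb⟩ := Metric.isOpen_iff.1 hB.1 u hu
  have h0 := h u hu
  have h1 := h (u + ε / 2) (hb (by simp [abs_of_pos hε, hε]))
  have h2 := h (u - ε / 2) (hb (by simp [abs_of_pos hε, hε]))
  have hc : c = 0 := by
    refine (mul_eq_zero.1 (?_ : c * ε ^ 2 = 0)).resolve_right (by positivity)
    linear_combination 2 * (h1 + h2 - 2 * h0)
  subst hc
  have hb' : b = 0 := by
    refine (mul_eq_zero.1 (?_ : b * ε = 0)).resolve_right hε.ne'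
    linear_combination (h1 - h2)
  subst hb'
  exact ⟨by linear_combination h0, rfl, rfl⟩

theorem exists_antideriv {I : Set ℝ} (hI : IsOpenInterval I) {θ : ℝ → R3}
    (hθ : ContinuousOn θ I) {t₀ : ℝ} (ht₀ : t₀ ∈ I) (b : R3) :
    ∃ Θ : ℝ → R3, IsAntideriv I Θ θ ∧ Θ t₀ = b := by
  refine ⟨fun t => (∫ s in t₀..t, θ s) + b, fun t ht => ?_, by simp⟩
  have hsub : Set.uIcc t₀ t ⊆ I := hI.2.1.uIcc_subset ht₀ ht
  refine (intervalIntegral.integral_hasDerivAt_right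
    (hθ.mono hsub).intervalIntegrable ?_ (hθ.continuousAt (hI.1.mem_nhds ht))).add_const b
  exact hθ.stronglyMeasurableAtFilter hI.1 t ht

theorem eq_of_hasDerivAt_zero {I : Set ℝ} (hI : IsOpenInterval I) {f : ℝ → ℝ}
    (h : ∀ t ∈ I, HasDerivAt f 0 t) {t t' : ℝ} (ht : t ∈ I) (ht' : t' ∈ I) : f t = f t' :=
  hI.1.is_const_of_deriv_eq_zero hI.2.1.convex.isPreconnected
    (fun s hs => (h s hs).differentiableAt.differentiableWithinAt) (fun s hs => (h s hs).deriv)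
    ht ht'

theorem hasDerivAt_dt {H : R3 → ℝ} {t x u : ℝ} (hd : DifferentiableAt ℝ H (t, x, u)) :
    HasDerivAt (fun s => H (s, x, u)) (dt H (t, x, u)) t :=
  HasFDerivAt.comp_hasDerivAt t (l := H) (f := fun s : ℝ => ((s, x, u) : R3)) hd.hasFDerivAt
    ((hasDerivAt_id t).prodMk ((hasDerivAt_const t x).prodMk (hasDerivAt_const t u)))

theorem fderiv_eq_zero_of_eqOn {S : Set R3} (hS : IsOpen S) {G : R3 → ℝ}
    (h : ∀ p ∈ S, G p = 0) {p : R3} (hp : p ∈ S) : fderiv ℝ G p = 0 := by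
  have : G =ᶠ[𝓝 p] fun _ => (0 : ℝ) := by
    filter_upwards [hS.mem_nhds hp] with q hq using h q hq
  rw [this.fderiv_eq]
  simp

theorem dx_eq_zero_of_eqOn {S : Set R3} (hS : IsOpen S) {G : R3 → ℝ}
    (h : ∀ p ∈ S, G p = 0) {p : R3} (hp : p ∈ S) : dx G p = 0 := by
  rw [dx, fderiv_eq_zero_of_eqOn hS h hp]; rfl

theorem du_eq_zero_of_eqOn {S : Set R3} (hS : IsOpen S) {G : R3 → ℝ}
    (h : ∀ p ∈ S, G p = 0) {p : R3} (hp : p ∈ S) : du G p = 0 := by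
  rw [du, fderiv_eq_zero_of_eqOn hS h hp]; rfl

section Admissible

variable {I A B : Set ℝ} {P : R3 → R3} {θ θ' : ℝ → R3}

/-- The second derivative `r` of a jet is absent from the Gardner equation, but enters the third
derivative of the image with the factor `3 (U_xu + U_uu q)`. Comparing `r = 0` with `r = 1` makes
this factor vanish for every slope `q`. -/
theorem second_order (hI : IsOpenInterval I) (hA : IsOpenInterval A)
    (hB : IsOpenInterval B) (hθ : InClass I θ) (h : IsAdmissible (box I A B) P θ θ') {p : R3}
    (hp : p ∈ box I A B) : dx (du (compU P)) p = 0 ∧ du (du (compU P)) p = 0 := by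
  obtain ⟨t, x, u⟩ := p
  obtain ⟨hTx, hTu, hTt, hXu, hXx, hg⟩ := h.first_order hI hA hB hθ hp
  have hU := (contDiffAt_components (h.contDiffAt hI hA hB hp)).2.2
  have hgne : (θ t).2.2 ≠ 0 := right_ne_zero_of_mul (hθ.2 _ hp.1)
  have key : ∀ q, dx (du (compU P)) (t, x, u) + du (du (compU P)) (t, x, u) * q = 0 := by
    intro q
    have hs : -(((θ t).1 * u + (θ t).2.1 * u ^ 2) * q) + ((θ t).1 * u + (θ t).2.1 * u ^ 2) * q
      + (θ t).2.2 * 0 = 0 := by ring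
    have e0 := determining_equation hI hA hB hθ h hp.1 hp.2.1 hp.2.2 (r := 0) hs
    have e1 := determining_equation hI hA hB hθ h hp.1 hp.2.1 hp.2.2 (r := 1) hs
    have hN : ∀ r, iteratedDeriv 3 (fun y => compU P (t, y, jet (t, x) u
        (-(((θ t).1 * u + (θ t).2.1 * u ^ 2) * q)) q r 0 0 (t, y))) x =
        iteratedDeriv 3 (fun y => compU P (t, y, u + q * (y - x) + r / 2 * (y - x) ^ 2)) x := by
      intro r
      congr 1
      ext y
      simp [jet]
    have hN' := fun r : ℝ => iteratedDeriv_three_comp_slice (H := compU P) (t := t) (x := x)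
      (c := fun y => u + q * (y - x) + r / 2 * (y - x) ^ 2) (c₁ := fun y => q + r * (y - x))
      (c₂ := fun _ => r) (c₃ := 0) (by simpa using hU)
      (fun y => by
        have h1 : HasDerivAt (fun y : ℝ => y - x) 1 y := (hasDerivAt_id _).sub_const _
        refine (((h1.const_mul q).const_add u).add ((h1.pow 2).const_mul (r / 2))).congr_deriv ?_
        simp; ring)
      (fun y => by
        have h1 : HasDerivAt (fun y : ℝ => y - x) 1 y := (hasDerivAt_id _).sub_const _
        simpa using ((h1.const_mul r).const_add q)) (hasDerivAt_const _ _)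
    simp only [hN, hN'] at e0 e1
    simp only [sub_self, mul_zero, add_zero, ne_eq, OfNat.ofNat_ne_zero, not_false_eq_true,
      zero_pow, mul_one] at e0 e1
    have h3 : (θ t).2.2 * dx (compX P) (t, x, u) *
        (dx (du (compU P)) (t, x, u) + du (du (compU P)) (t, x, u) * q) = 0 := by
      linear_combination (e1 - e0) / 3
    exact (mul_eq_zero.1 h3).resolve_left (mul_ne_zero hgne hXx)
  have k0 := key 0
  have k1 := key 1
  rw [mul_zero, add_zero] at k0
  refine ⟨k0, ?_⟩
  rw [k0, zero_add, mul_one] at k1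
  exact k1

/-- Otherwise the `u`-direction would lie in the kernel of the differential of `P`, as `T_u = X_u =
0`. -/
theorem du_compU_ne_zero (hI : IsOpenInterval I) (hA : IsOpenInterval A)
    (hB : IsOpenInterval B) (hθ : InClass I θ) (h : IsAdmissible (box I A B) P θ θ') {p : R3}
    (hp : p ∈ box I A B) : du (compU P) p ≠ 0 := by
  intro h0
  obtain ⟨-, hTu, -, hXu, -, -⟩ := h.first_order hI hA hB hθ hp
  have hP := (h.contDiffAt hI hA hB hp).differentiableAt (by simp)
  have e : fderiv ℝ P p (0, 0, 1) = fderiv ℝ P p 0 := by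
    rw [fderiv_eq_components hP, map_zero]
    exact Prod.ext hTu (Prod.ext hXu h0)
  have := (h.2.1 p hp).1 e
  simp at this

/-- Once `U_xu = U_uu = 0`, the determining equation for jets without second and third derivatives
is affine in the slope `q`. The coefficient of `q`, divided by `U_u`, is the first relation;
inserting it into the part free of `q` and dividing by `X_x` leaves the second. -/
theorem reduced_equations (hI : IsOpenInterval I) (hA : IsOpenInterval A)
    (hB : IsOpenInterval B) (hθ : InClass I θ) (h : IsAdmissible (box I A B) P θ θ')
    {t x u : ℝ} (ht : t ∈ I) (hx : x ∈ A) (hu : u ∈ B) :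
    dt (compT P) (t, x, u) * ((θ' (compT P (t, x, u))).1 * compU P (t, x, u)
        + (θ' (compT P (t, x, u))).2.1 * compU P (t, x, u) ^ 2)
      - dx (compX P) (t, x, u) * ((θ t).1 * u + (θ t).2.1 * u ^ 2)
      - dt (compX P) (t, x, u) = 0 ∧
    dt (compU P) (t, x, u) + ((θ t).1 * u + (θ t).2.1 * u ^ 2) * dx (compU P) (t, x, u)
      + (θ t).2.2 * dx (dx (dx (compU P))) (t, x, u) = 0 := by
  have hp := mem_box ht hx hu
  have hD := isOpen_box hI.1 hA.1 hB.1
  obtain ⟨hTx, hTu, hTt, hXu, hXx, hg⟩ := h.first_order hI hA hB hθ hp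
  have hUs : ∀ p ∈ box I A B, ContDiffAt ℝ ∞ (compU P) p := fun p hp =>
    (contDiffAt_components (h.contDiffAt hI hA hB hp)).2.2
  have z1 : ∀ p ∈ box I A B, dx (du (compU P)) p = 0 := fun p hp =>
    (second_order hI hA hB hθ h hp).1
  have z2 : ∀ p ∈ box I A B, du (du (compU P)) p = 0 := fun p hp =>
    (second_order hI hA hB hθ h hp).2
  have z3 : ∀ p ∈ box I A B, du (dx (compU P)) p = 0 := fun p hp => by
    rw [← dx_du_comm (hUs p hp)]; exact z1 p hp
  have z4 : du (dx (dx (compU P))) (t, x, u) = 0 := by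
    rw [← dx_du_comm (H := dx (compU P)) (contDiffAt_fderiv_apply (hUs _ hp) (0, 1, 0))]
    exact dx_eq_zero_of_eqOn hD z3 hp
  have key : ∀ q : ℝ,
      dx (compX P) (t, x, u) * (dt (compU P) (t, x, u)
        - du (compU P) (t, x, u) * ((θ t).1 * u + (θ t).2.1 * u ^ 2) * q)
      + (dx (compU P) (t, x, u) + du (compU P) (t, x, u) * q)
        * (dt (compT P) (t, x, u) * ((θ' (compT P (t, x, u))).1 * compU P (t, x, u)
          + (θ' (compT P (t, x, u))).2.1 * compU P (t, x, u) ^ 2) - dt (compX P) (t, x, u))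
      + (θ t).2.2 * dx (compX P) (t, x, u) * dx (dx (dx (compU P))) (t, x, u) = 0 := by
    intro q
    have hs : -(((θ t).1 * u + (θ t).2.1 * u ^ 2) * q) + ((θ t).1 * u + (θ t).2.1 * u ^ 2) * q
      + (θ t).2.2 * 0 = 0 := by ring
    have e0 := determining_equation hI hA hB hθ h ht hx hu (r := 0) hs
    have hN : iteratedDeriv 3 (fun y => compU P (t, y, jet (t, x) u
        (-(((θ t).1 * u + (θ t).2.1 * u ^ 2) * q)) q 0 0 0 (t, y))) x =
        iteratedDeriv 3 (fun y => compU P (t, y, u + q * (y - x))) x := by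
      congr 1
      ext y
      simp [jet]
    have hN' := iteratedDeriv_three_comp_slice (H := compU P) (t := t) (x := x)
      (c := fun y => u + q * (y - x)) (c₁ := fun y => q)
      (c₂ := fun _ => 0) (c₃ := 0) (by simpa using hUs _ hp)
      (fun y => by
        have h1 : HasDerivAt (fun y : ℝ => y - x) 1 y := (hasDerivAt_id _).sub_const _
        simpa using (h1.const_mul q).const_add u)
      (fun y => hasDerivAt_const _ _) (hasDerivAt_const _ _)
    simp only [hN, hN'] at e0
    simp only [sub_self, mul_zero, add_zero, z4, dx_eq_zero_of_eqOn hD z3 hp,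
      du_eq_zero_of_eqOn hD z3 hp, dx_eq_zero_of_eqOn hD z2 hp, du_eq_zero_of_eqOn hD z2 hp,
      dx_eq_zero_of_eqOn hD z1 hp, du_eq_zero_of_eqOn hD z1 hp, zero_mul] at e0
    linear_combination e0
  have hUu := du_compU_ne_zero hI hA hB hθ h hp
  have k0 := key 0
  have k1 := key 1
  have r1 : dt (compT P) (t, x, u) * ((θ' (compT P (t, x, u))).1 * compU P (t, x, u)
        + (θ' (compT P (t, x, u))).2.1 * compU P (t, x, u) ^ 2)
      - dx (compX P) (t, x, u) * ((θ t).1 * u + (θ t).2.1 * u ^ 2)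
      - dt (compX P) (t, x, u) = 0 := by
    refine (mul_eq_zero.1 (?_ : du (compU P) (t, x, u) * _ = 0)).resolve_left hUu
    linear_combination k1 - k0
  refine ⟨r1, (mul_eq_zero.1 (?_ : dx (compX P) (t, x, u) * _ = 0)).resolve_left hXx⟩
  linear_combination k0 - dx (compU P) (t, x, u) * r1

/-- The necessary form of an admissible transformation. -/
theorem IsAdmissible.exists_params (hI : IsOpenInterval I) (hA : IsOpenInterval A)
    (hB : IsOpenInterval B) (hθ : InClass I θ) (h : IsAdmissible (box I A B) P θ θ') :
    ∃ (c : Params) (Θ : ℝ → R3), c.Valid I ∧ IsAntideriv I Θ θ ∧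
      ∀ p ∈ box I A B, P p = (c.transf (p, θ p.1, Θ p.1)).1 ∧
        θ' (c.α p.1) = (c.transf (p, θ p.1, Θ p.1)).2 := by
  have hD := isOpen_box hI.1 hA.1 hB.1
  have top : (∞ : WithTop ℕ∞) ≠ 0 := by simp
  have hdT : ∀ p ∈ box I A B, DifferentiableAt ℝ (compT P) p := fun p hp =>
    (contDiffAt_components (h.contDiffAt hI hA hB hp)).1.differentiableAt top
  have hdX : ∀ p ∈ box I A B, DifferentiableAt ℝ (compX P) p := fun p hp =>
    (contDiffAt_components (h.contDiffAt hI hA hB hp)).2.1.differentiableAt top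
  have hUs : ∀ p ∈ box I A B, ContDiffAt ℝ ∞ (compU P) p := fun p hp =>
    (contDiffAt_components (h.contDiffAt hI hA hB hp)).2.2
  have hdU : ∀ p ∈ box I A B, DifferentiableAt ℝ (compU P) p := fun p hp =>
    (hUs p hp).differentiableAt top
  obtain ⟨t₀, ht₀⟩ := hI.2.2
  obtain ⟨x₀, hx₀⟩ := hA.2.2
  obtain ⟨u₀, hu₀⟩ := hB.2.2
  let α : ℝ → ℝ := fun t => compT P (t, x₀, u₀)
  let a : ℝ → ℝ := fun t => dx (compX P) (t, x₀, u₀)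
  let b : ℝ → ℝ := fun t => du (compU P) (t, x₀, u₀)
  have hα : ∀ t ∈ I, HasDerivAt α (dt (compT P) (t, x₀, u₀)) t := fun t ht =>
    hasDerivAt_dt (hdT _ (mem_box ht hx₀ hu₀))
  have hT : ∀ t ∈ I, ∀ x ∈ A, ∀ u ∈ B, compT P (t, x, u) = α t := fun t ht x hx u hu =>
    compT_eq hI hA hB hθ h ht hx hx₀ hu hu₀
  have hTt : ∀ t ∈ I, ∀ x ∈ A, ∀ u ∈ B, dt (compT P) (t, x, u) = deriv α t :=
    fun t ht x hx u hu => by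
      rw [(hα t ht).deriv]
      exact dt_eq_of_eq hI.1 ht (hdT _ (mem_box ht hx hu)) (hdT _ (mem_box ht hx₀ hu₀)) (c := 0)
        fun s hs => by rw [add_zero]; exact hT s hs x hx u hu
  have hXx : ∀ t ∈ I, ∀ x ∈ A, ∀ u ∈ B, dx (compX P) (t, x, u) = a t := fun t ht x hx u hu =>
    dx_compX_eq hI hA hB hθ h ht hx hx₀ hu hu₀
  have hX : ∀ t ∈ I, ∀ x ∈ A, ∀ u ∈ B,
      compX P (t, x, u) = compX P (t, x₀, u₀) + a t * (x - x₀) := fun t ht x hx u hu =>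
    compX_eq hI hA hB hθ h ht hx₀ hx hu₀ hu
  have hUu : ∀ t ∈ I, ∀ x ∈ A, ∀ u ∈ B, du (compU P) (t, x, u) = b t := fun t ht x hx u hu => by
    have := sub_eq_of_partials (H := du (compU P)) (t := t) (a := 0) (b := 0) hA hB
      (fun x hx u hu => (contDiffAt_fderiv_apply (hUs _ (mem_box ht hx hu)) (0, 0, 1)).differentiableAt
        top)
      (fun y hy v hv => (second_order hI hA hB hθ h (mem_box ht hy hv)).1)
      (fun y hy v hv => (second_order hI hA hB hθ h (mem_box ht hy hv)).2) hx hx₀ hu hu₀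
    rw [this]; ring
  have hαne : ∀ t ∈ I, deriv α t ≠ 0 := fun t ht => by
    rw [(hα t ht).deriv]
    exact (h.first_order hI hA hB hθ (mem_box ht hx₀ hu₀)).2.2.1
  have hane : ∀ t ∈ I, a t ≠ 0 := fun t ht =>
    (h.first_order hI hA hB hθ (mem_box ht hx₀ hu₀)).2.2.2.2.1
  have hbne : ∀ t ∈ I, b t ≠ 0 := fun t ht => du_compU_ne_zero hI hA hB hθ h (mem_box ht hx₀ hu₀)
  have hg : ∀ t ∈ I, (θ t).2.2 * a t ^ 3 = (θ' (α t)).2.2 * deriv α t := fun t ht => by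
    have := (h.first_order hI hA hB hθ (mem_box ht hx₀ hu₀)).2.2.2.2.2
    rw [hTt t ht x₀ hx₀ u₀ hu₀] at this
    exact this
  -- `U` is affine in `u`
  have hUaff : ∀ t ∈ I, ∀ x ∈ A, ∀ u ∈ B, compU P (t, x, u) = compU P (t, x, u₀) + b t * (u - u₀) := by
    intro t ht x hx u hu
    have hder : ∀ v ∈ B, HasDerivAt (fun v => compU P (t, x, v) - b t * v) 0 v := by
      intro v hv
      have h1 := HasFDerivAt.comp_hasDerivAt v (l := compU P) (f := fun s : ℝ => ((t, x, s) : R3))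
        (hdU _ (mem_box ht hx hv)).hasFDerivAt
        ((hasDerivAt_const v t).prodMk ((hasDerivAt_const v x).prodMk (hasDerivAt_id v)))
      refine (h1.sub ((hasDerivAt_id v).const_mul (b t))).congr_deriv ?_
      have := hUu t ht x hx v hv
      rw [du] at this
      rw [this]; ring
    have := eq_of_hasDerivAt_zero hB hder hu hu₀
    linear_combination this
  have hXt : ∀ t ∈ I, ∀ x ∈ A, ∀ u ∈ B, dt (compX P) (t, x, u) = dt (compX P) (t, x, u₀) :=
    fun t ht x hx u hu => dt_eq_of_eq hI.1 ht (hdX _ (mem_box ht hx hu))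
      (hdX _ (mem_box ht hx hu₀)) (c := 0) fun s hs => by
        rw [hX s hs x hx u hu, hX s hs x hx u₀ hu₀, add_zero]
  let V : ℝ → ℝ → ℝ := fun t x => compU P (t, x, u₀) - b t * u₀
  have hUV : ∀ t ∈ I, ∀ x ∈ A, ∀ u ∈ B, compU P (t, x, u) = b t * u + V t x := by
    intro t ht x hx u hu
    rw [hUaff t ht x hx u hu]; simp only [V]; ring
  -- With `U = b u + V` the first reduced equation is a quadratic polynomial in `u` whose
  -- coefficients do not involve `u`.
  have hcoef : ∀ t ∈ I, ∀ x ∈ A,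
      deriv α t * ((θ' (α t)).1 * V t x + (θ' (α t)).2.1 * V t x ^ 2)
        - dt (compX P) (t, x, u₀) = 0 ∧
      deriv α t * ((θ' (α t)).1 * b t + 2 * (θ' (α t)).2.1 * b t * V t x) - a t * (θ t).1 = 0 ∧
      deriv α t * (θ' (α t)).2.1 * b t ^ 2 - a t * (θ t).2.1 = 0 := by
    intro t ht x hx
    refine eq_zero_of_quadratic hB fun u hu => ?_
    have := (reduced_equations hI hA hB hθ h ht hx hu).1
    rw [hTt t ht x hx u hu, hT t ht x hx u hu, hUV t ht x hx u hu, hXx t ht x hx u hu,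
      hXt t ht x hx u hu] at this
    linear_combination this
  have hf'ne : ∀ t ∈ I, (θ' (α t)).2.1 ≠ 0 := fun t ht hz => by
    have h1 := (hcoef t ht x₀ hx₀).2.2
    rw [hz, mul_zero, zero_mul, zero_sub, neg_eq_zero] at h1
    exact (left_ne_zero_of_mul (hθ.2 t ht)) ((mul_eq_zero.1 h1).resolve_left (hane t ht))
  -- The coefficient of `u` is affine in `V` with the nonzero factor `2 α_t f' b`, and everything
  -- else in it depends on `t` only.
  have hVx : ∀ t ∈ I, ∀ x ∈ A, V t x = V t x₀ := by
    intro t ht x hx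
    have h1 := (hcoef t ht x hx).2.1
    have h2 := (hcoef t ht x₀ hx₀).2.1
    have h3 : (deriv α t * (θ' (α t)).2.1 * b t) * (V t x - V t x₀) = 0 := by
      linear_combination (h1 - h2) / 2
    have := (mul_eq_zero.1 h3).resolve_left
      (mul_ne_zero (mul_ne_zero (hαne t ht) (hf'ne t ht)) (hbne t ht))
    linarith
  have hUx : ∀ p ∈ box I A B, dx (compU P) p = 0 := by
    rintro ⟨t, x, u⟩ ⟨ht, hx, hu⟩
    have h1 := HasFDerivAt.comp_hasDerivAt x (l := compU P) (f := fun s : ℝ => ((t, s, u) : R3))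
      (hdU _ (mem_box ht hx hu)).hasFDerivAt
      ((hasDerivAt_const x t).prodMk ((hasDerivAt_id x).prodMk (hasDerivAt_const x u)))
    refine h1.unique ((hasDerivAt_const x (b t * u + V t x₀)).congr_of_eventuallyEq ?_)
    filter_upwards [hA.1.mem_nhds hx] with y hy
    have := hUV t ht y hy u hu
    rw [hVx t ht y hy] at this
    exact this
  have hUt : ∀ t ∈ I, ∀ u ∈ B, dt (compU P) (t, x₀, u) = 0 := by
    intro t ht u hu
    have h1 := (reduced_equations hI hA hB hθ h ht hx₀ hu).2
    have z1 := fun p (hp : p ∈ box I A B) => dx_eq_zero_of_eqOn hD hUx hp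
    rw [hUx _ (mem_box ht hx₀ hu), dx_eq_zero_of_eqOn hD z1 (mem_box ht hx₀ hu)] at h1
    linear_combination h1
  have hUc : ∀ t ∈ I, ∀ u ∈ B, compU P (t, x₀, u) = compU P (t₀, x₀, u) := fun t ht u hu =>
    eq_of_hasDerivAt_zero hI (f := fun s => compU P (s, x₀, u)) (fun s hs => by
      have := hasDerivAt_dt (hdU _ (mem_box hs hx₀ hu))
      rwa [hUt s hs u hu] at this) ht ht₀
  have hbV : ∀ t ∈ I, V t x₀ = V t₀ x₀ ∧ b t = b t₀ := by
    intro t ht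
    have := eq_zero_of_quadratic hB (a := V t x₀ - V t₀ x₀) (b := b t - b t₀) (c := 0)
      fun u hu => by
        have := hUc t ht u hu
        rw [hUV t ht x₀ hx₀ u hu, hUV t₀ ht₀ x₀ hx₀ u hu] at this
        linear_combination this
    exact ⟨by linarith [this.1], by linarith [this.2.1]⟩
  -- The `u`-free coefficient shows that `X_t` does not depend on `x`, so the increment of `X` over
  -- a fixed `x`-interval, a multiple of `a t`, is constant in `t`.
  have hat : ∀ t ∈ I, a t = a t₀ := by
    intro t ht
    obtain ⟨ε, hε, hball⟩ := Metric.isOpen_iff.1 hA.1 x₀ hx₀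
    have hx₁ : x₀ + ε / 2 ∈ A := hball (by simp [abs_of_pos hε, hε])
    have hd : ∀ s ∈ I, HasDerivAt
        (fun s => compX P (s, x₀ + ε / 2, u₀) - compX P (s, x₀, u₀)) 0 s := by
      intro s hs
      refine ((hasDerivAt_dt (hdX _ (mem_box hs hx₁ hu₀))).sub
        (hasDerivAt_dt (hdX _ (mem_box hs hx₀ hu₀)))).congr_deriv ?_
      have h1 := (hcoef s hs _ hx₁).1
      have h2 := (hcoef s hs _ hx₀).1
      rw [hVx s hs _ hx₁] at h1
      linear_combination h2 - h1
    have h1 := eq_of_hasDerivAt_zero hI hd ht ht₀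
    rw [hX t ht _ hx₁ _ hu₀, hX t₀ ht₀ _ hx₁ _ hu₀] at h1
    refine sub_eq_zero.1 ((mul_eq_zero.1 (?_ : (a t - a t₀) * ε = 0)).resolve_right hε.ne')
    linear_combination 2 * h1
  obtain ⟨Θ, hΘ, -⟩ := exists_antideriv hI hθ.1.continuousOn ht₀ 0
  set d₁ := a t₀ with hd₁
  set d₂ := b t₀ with hd₂
  set d₃ := V t₀ x₀ with hd₃
  have hd₁ne : d₁ ≠ 0 := hane t₀ ht₀
  have hd₂ne : d₂ ≠ 0 := hbne t₀ ht₀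
  -- What remains of `X` after removing `δ₁ x` and the expected integral term; it turns out to be
  -- the constant `δ₄`.
  let ψ : ℝ → ℝ := fun t => compX P (t, x₀, u₀) - d₁ * x₀
    - d₁ * d₃ / d₂ ^ 2 * (d₂ * (Θ t).1 - d₃ * (Θ t).2.1)
  have hf' : ∀ t ∈ I, (θ' (α t)).2.1 = d₁ / (d₂ ^ 2 * deriv α t) * (θ t).2.1 := by
    intro t ht
    have h1 := (hcoef t ht x₀ hx₀).2.2
    rw [(hbV t ht).2, hat t ht] at h1
    have := hαne t ht
    field_simp
    linear_combination h1
  have hk' : ∀ t ∈ I, (θ' (α t)).1 =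
      d₁ / (d₂ * deriv α t) * ((θ t).1 - 2 * (d₃ / d₂) * (θ t).2.1) := by
    intro t ht
    have h1 := (hcoef t ht x₀ hx₀).2.1
    have := hαne t ht
    rw [(hbV t ht).2, (hbV t ht).1, hat t ht, hf' t ht] at h1
    field_simp at h1 ⊢
    linear_combination h1
  have hψ : ∀ t ∈ I, HasDerivAt ψ 0 t := by
    intro t ht
    have h1 := hasDerivAt_dt (hdX _ (mem_box ht hx₀ hu₀))
    have h2 : HasDerivAt (fun s => (Θ s).1) (θ t).1 t := (hΘ t ht).fst
    have h3 : HasDerivAt (fun s => (Θ s).2.1) (θ t).2.1 t := (hΘ t ht).snd.fst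
    refine ((h1.sub_const (d₁ * x₀)).sub (((h2.const_mul d₂).sub (h3.const_mul d₃)).const_mul
      (d₁ * d₃ / d₂ ^ 2))).congr_deriv ?_
    have h4 := (hcoef t ht x₀ hx₀).1
    have := hαne t ht
    rw [(hbV t ht).1, hk' t ht, hf' t ht] at h4
    field_simp at h4 ⊢
    linear_combination -h4
  refine ⟨⟨α, d₁, d₂, d₃, ψ t₀⟩, Θ, ⟨?_, hαne, mul_ne_zero hd₁ne hd₂ne⟩, hΘ, ?_⟩
  · intro t ht
    have h1 := (contDiffAt_components (h.contDiffAt hI hA hB (mem_box ht hx₀ hu₀))).1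
    exact (ContDiffAt.comp t (f := fun s : ℝ => ((s, x₀, u₀) : R3)) h1
      (by fun_prop)).contDiffWithinAt
  · rintro ⟨t, x, u⟩ ⟨ht, hx, hu⟩
    refine ⟨Prod.ext (hT t ht x hx u hu) (Prod.ext ?_ ?_), Prod.ext (hk' t ht)
      (Prod.ext (hf' t ht) ?_)⟩
    · have h1 := hX t ht x hx u hu
      have h2 := eq_of_hasDerivAt_zero hI hψ ht₀ ht
      rw [hat t ht] at h1
      show compX P (t, x, u) = d₁ * x + d₁ * d₃ / d₂ ^ 2 * (d₂ * (Θ t).1 - d₃ * (Θ t).2.1) + ψ t₀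
      rw [h2, h1]
      simp only [ψ]
      ring
    · have h1 := hUV t ht x hx u hu
      rw [hVx t ht x hx, (hbV t ht).1, (hbV t ht).2] at h1
      exact h1
    · have h1 := hg t ht
      have := hαne t ht
      rw [hat t ht] at h1
      show (θ' (α t)).2.2 = d₁ ^ 3 / deriv α t * (θ t).2.2
      field_simp
      linear_combination -h1

end Admissible

/-! ### Sufficiency of the stated form. -/

/-- A smooth function with nonvanishing derivative on an open interval is invertible. -/
theorem exists_smooth_inverse {I : Set ℝ} (hI : IsOpenInterval I) {α : ℝ → ℝ}
    (hα : ContDiffOn ℝ ∞ α I) (hne : ∀ t ∈ I, deriv α t ≠ 0) :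
    IsOpenInterval (α '' I) ∧ ∃ β : ℝ → ℝ, ContDiffOn ℝ ∞ β (α '' I) ∧ (∀ t ∈ I, β (α t) = t) ∧
      ∀ t ∈ I, deriv β (α t) = (deriv α t)⁻¹ := by
  have hc : ∀ t ∈ I, ContDiffAt ℝ ∞ α t := fun t ht => hα.contDiffAt (hI.1.mem_nhds ht)
  have hlt : ∀ s ∈ I, ∀ t ∈ I, s < t → α s ≠ α t := by
    intro s hs t ht hst he
    have hsub := hI.2.1.out hs ht
    obtain ⟨r, hr, hr0⟩ := exists_deriv_eq_zero hst (hα.continuousOn.mono hsub) he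
    exact hne r (hsub ⟨hr.1.le, hr.2.le⟩) hr0
  have hinj : Set.InjOn α I := by
    intro s hs t ht he
    rcases lt_trichotomy s t with h | h | h
    · exact absurd he (hlt s hs t ht h)
    · exact h
    · exact absurd he.symm (hlt t ht s hs h)
  have hloc : ∀ t ∈ I, ∃ g : ℝ → ℝ, ContDiffAt ℝ ∞ g (α t) ∧ g (α t) = t ∧
      ∀ᶠ y in 𝓝 (α t), g y ∈ I ∧ α (g y) = y := by
    intro t ht
    have hb : Function.Bijective (fderiv ℝ α t) := by
      have hd := ((hc t ht).differentiableAt (by simp)).hasDerivAt.hasFDerivAt.fderiv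
      rw [hd]
      constructor
      · intro a b hab
        simpa [hne t ht] using hab
      · intro a
        exact ⟨a / deriv α t, by simp [hne t ht]⟩
    obtain ⟨g, hg, hg0, -, hr⟩ := exists_local_inverse (hc t ht) hb
    refine ⟨g, hg, hg0, ?_⟩
    have : ∀ᶠ y in 𝓝 (α t), g y ∈ I :=
      hg.continuousAt.eventually (hI.1.mem_nhds (by rw [hg0]; exact ht))
    exact this.and hr
  refine ⟨⟨?_, ?_, hI.2.2.image α⟩, Function.invFunOn α I, ?_, ?_, ?_⟩
  · rw [isOpen_iff_mem_nhds]
    rintro _ ⟨t, ht, rfl⟩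
    obtain ⟨g, -, -, hr⟩ := hloc t ht
    filter_upwards [hr] with y hy
    exact ⟨g y, hy.1, hy.2⟩
  · exact (hI.2.1.isPreconnected.image α hα.continuousOn).ordConnected
  · rintro _ ⟨t, ht, rfl⟩
    obtain ⟨g, hg, -, hr⟩ := hloc t ht
    refine (hg.congr_of_eventuallyEq ?_).contDiffWithinAt
    filter_upwards [hr] with y hy
    rw [← hy.2]
    conv_rhs => rw [hy.2]
    exact hinj.leftInvOn_invFunOn hy.1
  · intro t ht
    exact hinj.leftInvOn_invFunOn ht
  · intro t ht
    obtain ⟨g, hg, hg0, hr⟩ := hloc t ht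
    have he : Function.invFunOn α I =ᶠ[𝓝 (α t)] g := by
      filter_upwards [hr] with y hy
      rw [← hy.2]
      conv_rhs => rw [hy.2]
      exact hinj.leftInvOn_invFunOn hy.1
    rw [he.deriv_eq]
    have h1 := (hg.differentiableAt (by simp)).hasDerivAt.comp t
      ((hc t ht).differentiableAt (by simp)).hasDerivAt
    have h2 : g ∘ α =ᶠ[𝓝 t] id := by
      have h3 : ∀ᶠ s in 𝓝 t, g (α s) ∈ I ∧ α (g (α s)) = α s :=
        (hc t ht).continuousAt.eventually hr
      filter_upwards [h3, hI.1.mem_nhds ht] with s hs hsI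
      exact hinj hs.1 hsI hs.2
    have h3 := h1.unique ((hasDerivAt_id t).congr_of_eventuallyEq h2)
    exact eq_inv_of_mul_eq_one_left h3

theorem IsAntideriv.contDiffOn {I : Set ℝ} (hI : IsOpen I) {Θ θ : ℝ → R3}
    (h : IsAntideriv I Θ θ) (hθ : ContDiffOn ℝ ∞ θ I) : ContDiffOn ℝ ∞ Θ I := by
  rw [contDiffOn_infty_iff_deriv_of_isOpen hI]
  exact ⟨fun t ht => (h t ht).differentiableAt.differentiableWithinAt,
    hθ.congr fun t ht => (h t ht).deriv⟩

theorem Params.Valid.d1_ne {c : Params} {I : Set ℝ} (h : c.Valid I) : c.d1 ≠ 0 :=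
  left_ne_zero_of_mul h.2.2

theorem Params.Valid.d2_ne {c : Params} {I : Set ℝ} (h : c.Valid I) : c.d2 ≠ 0 :=
  right_ne_zero_of_mul h.2.2

theorem Params.Valid.hasDerivAt {c : Params} {I : Set ℝ} (hI : IsOpen I) (h : c.Valid I) {t : ℝ}
    (ht : t ∈ I) : HasDerivAt c.α (deriv c.α t) t :=
  ((h.1.contDiffAt (hI.mem_nhds ht)).differentiableAt (by simp)).hasDerivAt

/-- The new coefficients as functions of the old `t`. -/
def Params.coeff (c : Params) (θ : ℝ → R3) (t : ℝ) : R3 :=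
  (c.d1 / (c.d2 * deriv c.α t) * ((θ t).1 - 2 * (c.d3 / c.d2) * (θ t).2.1),
    c.d1 / (c.d2 ^ 2 * deriv c.α t) * (θ t).2.1, c.d1 ^ 3 / deriv c.α t * (θ t).2.2)

/-- The shift of `x` as a function of `t`. -/
def Params.shift (c : Params) (Θ : ℝ → R3) (t : ℝ) : ℝ :=
  c.d1 * c.d3 / c.d2 ^ 2 * (c.d2 * (Θ t).1 - c.d3 * (Θ t).2.1) + c.d4

/-- The point transformation with the given parameters. -/
def Params.point (c : Params) (Θ : ℝ → R3) (p : R3) : R3 :=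
  (c.α p.1, c.d1 * p.2.1 + c.shift Θ p.1, c.d2 * p.2.2 + c.d3)

theorem Params.transf_eq (c : Params) (θ Θ : ℝ → R3) (p : R3) :
    c.transf (p, θ p.1, Θ p.1) = (c.point Θ p, c.coeff θ p.1) := by
  simp only [Params.transf, Params.point, Params.coeff, Params.shift, add_assoc]

section Sufficiency

variable {I A B : Set ℝ} {c : Params} {θ Θ θ' : ℝ → R3}

theorem Params.contDiffOn_deriv (hI : IsOpen I) (hc : c.Valid I) :
    ContDiffOn ℝ ∞ (deriv c.α) I :=
  ((contDiffOn_infty_iff_deriv_of_isOpen hI).1 hc.1).2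

theorem Params.contDiffOn_coeff (hI : IsOpen I) (hc : c.Valid I) (hθ : InClass I θ) :
    ContDiffOn ℝ ∞ (c.coeff θ) I := by
  have h1 := hθ.1.fst
  have h2 := hθ.1.snd.fst
  have h3 := hθ.1.snd.snd
  have h4 := Params.contDiffOn_deriv hI hc
  refine ContDiffOn.prodMk ?_ (ContDiffOn.prodMk ?_ ?_)
  · exact (contDiffOn_const.div (contDiffOn_const.mul h4)
      fun t ht => mul_ne_zero hc.d2_ne (hc.2.1 t ht)).mul (h1.sub (contDiffOn_const.mul h2))
  · exact (contDiffOn_const.div (contDiffOn_const.mul h4)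
      fun t ht => mul_ne_zero (pow_ne_zero 2 hc.d2_ne) (hc.2.1 t ht)).mul h2
  · exact (contDiffOn_const.div h4 hc.2.1).mul h3

theorem Params.coeff_mem_regular (hc : c.Valid I) (hθ : InClass I θ) {t : ℝ} (ht : t ∈ I) :
    c.coeff θ t ∈ regular := by
  have h1 := hθ.2 t ht
  have h2 := hc.2.1 t ht
  have h3 := hc.d1_ne
  have h4 := hc.d2_ne
  have h5 := left_ne_zero_of_mul h1
  have h6 := right_ne_zero_of_mul h1
  exact mul_ne_zero (mul_ne_zero (div_ne_zero h3 (mul_ne_zero (pow_ne_zero 2 h4) h2)) h5)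
    (mul_ne_zero (div_ne_zero (pow_ne_zero 3 h3) h2) h6)

theorem Params.inClass (hI : IsOpenInterval I) (hc : c.Valid I) (hθ : InClass I θ)
    (h : ∀ t ∈ I, θ' (c.α t) = c.coeff θ t) : InClass (c.α '' I) θ' := by
  obtain ⟨-, β, hβ, hβα, -⟩ := exists_smooth_inverse hI hc.1 hc.2.1
  constructor
  · refine ((Params.contDiffOn_coeff hI.1 hc hθ).comp hβ ?_).congr ?_
    · rintro _ ⟨t, ht, rfl⟩
      rw [hβα t ht]; exact ht
    · rintro _ ⟨t, ht, rfl⟩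
      simp only [Function.comp, hβα t ht, h t ht]
  · rintro _ ⟨t, ht, rfl⟩
    rw [h t ht]
    exact Params.coeff_mem_regular hc hθ ht

theorem Params.hasDerivAt_shift (hΘ : IsAntideriv I Θ θ) {t : ℝ} (ht : t ∈ I) :
    HasDerivAt (c.shift Θ)
      (c.d1 * c.d3 / c.d2 ^ 2 * (c.d2 * (θ t).1 - c.d3 * (θ t).2.1)) t := by
  have h2 : HasDerivAt (fun s => (Θ s).1) (θ t).1 t := (hΘ t ht).fst
  have h3 : HasDerivAt (fun s => (Θ s).2.1) (θ t).2.1 t := (hΘ t ht).snd.fst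
  exact (((h2.const_mul c.d2).sub (h3.const_mul c.d3)).const_mul _).add_const _

theorem Params.contDiffOn_point (hI : IsOpen I) (hc : c.Valid I) (hθ : InClass I θ)
    (hΘ : IsAntideriv I Θ θ) : ContDiffOn ℝ ∞ (c.point Θ) (box I A B) := by
  have h1 := hΘ.contDiffOn hI hθ.1
  have hs : ContDiffOn ℝ ∞ (c.shift Θ) I :=
    (contDiffOn_const.mul ((contDiffOn_const.mul h1.fst).sub
      (contDiffOn_const.mul h1.snd.fst))).add contDiffOn_const
  have hm : Set.MapsTo (fun p : R3 => p.1) (box I A B) I := fun p hp => hp.1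
  refine (hc.1.comp contDiffOn_fst hm).prodMk (ContDiffOn.prodMk ?_ ?_)
  · exact (contDiffOn_const.mul contDiffOn_snd.fst).add (hs.comp contDiffOn_fst hm)
  · exact (contDiffOn_const.mul contDiffOn_snd.snd).add contDiffOn_const

theorem Params.bijective_fderiv_point (hI : IsOpen I) (hc : c.Valid I)
    (hΘ : IsAntideriv I Θ θ) {p : R3} (hp : p.1 ∈ I) :
    Function.Bijective (fderiv ℝ (c.point Θ) p) := by
  have h1 := (hc.hasDerivAt hI hp).comp_hasFDerivAt p (hasFDerivAt_fst (𝕜 := ℝ) (p := p))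
  have h2 := (Params.hasDerivAt_shift (c := c) hΘ hp).comp_hasFDerivAt p
    (hasFDerivAt_fst (𝕜 := ℝ) (p := p))
  have h3 : HasFDerivAt (c.point Θ) _ p := h1.prodMk
    (((hasFDerivAt_snd (𝕜 := ℝ) (p := p)).fst.const_mul c.d1 |>.add h2).prodMk
      (((hasFDerivAt_snd (𝕜 := ℝ) (p := p)).snd.const_mul c.d2).add_const c.d3))
  have hv : ∀ v : R3, fderiv ℝ (c.point Θ) p v = (deriv c.α p.1 * v.1,
      c.d1 * v.2.1 + c.d1 * c.d3 / c.d2 ^ 2 * (c.d2 * (θ p.1).1 - c.d3 * (θ p.1).2.1) * v.1,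
      c.d2 * v.2.2) := by
    intro v
    rw [h3.fderiv]
    rfl
  have hi : Function.Injective (fderiv ℝ (c.point Θ) p).toLinearMap := by
    rw [← LinearMap.ker_eq_bot, LinearMap.ker_eq_bot']
    rintro ⟨a, b, d⟩ h0
    have h0' : fderiv ℝ (c.point Θ) p (a, b, d) = 0 := h0
    rw [hv] at h0'
    have e1 : _ = (0 : ℝ) := congrArg Prod.fst h0'
    have e2 : _ = (0 : ℝ) := congrArg (fun y => y.2.1) h0'
    have e3 : _ = (0 : ℝ) := congrArg (fun y => y.2.2) h0'
    obtain rfl : a = 0 := (mul_eq_zero.1 e1).resolve_left (hc.2.1 _ hp)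
    obtain rfl : d = 0 := (mul_eq_zero.1 e3).resolve_left hc.d2_ne
    simp only [mul_zero, add_zero] at e2
    obtain rfl : b = 0 := (mul_eq_zero.1 e2).resolve_left hc.d1_ne
    rfl
  exact ⟨hi, LinearMap.injective_iff_surjective.1 hi⟩

/-- The two left-hand sides are proportional: `α_t` times the new one is `δ₂` times the old one. In
`k' u' + f' u'²` the correction in `k'` cancels the cross terms `f u` coming from `u' = δ₂ u + δ₃`,
and the part free of `u` is balanced by the `t`-derivative of the shift of `x`. -/
theorem Params.mapsEquation (hI : IsOpenInterval I) (hA : IsOpenInterval A)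
    (hB : IsOpenInterval B) (hc : c.Valid I) (hΘ : IsAntideriv I Θ θ) {P : R3 → R3}
    (hP : ∀ p ∈ box I A B, P p = c.point Θ p) (hθ' : ∀ t ∈ I, θ' (c.α t) = c.coeff θ t) :
    MapsEquation (box I A B) P θ θ' := by
  intro t x w w' hp hw _ hw' hr
  have top : (∞ : WithTop ℕ∞) ≠ 0 := by simp
  have ht : t ∈ I := hp.1
  have hd1 := hc.d1_ne
  have hd2 := hc.d2_ne
  have hαt := hc.2.1 t ht
  rw [hP _ hp] at hw' ⊢
  set y₀ : ℝ × ℝ := (c.α t, c.d1 * x + c.shift Θ t) with hy₀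
  have hw'' : ContDiffAt ℝ ∞ w' y₀ := hw'
  have hev : ∀ᶠ z : ℝ × ℝ in 𝓝 (t, x),
      w' (c.α z.1, c.d1 * z.2 + c.shift Θ z.1) = c.d2 * w z + c.d3 := by
    have hcont : ContinuousAt (fun z : ℝ × ℝ => ((z.1, z.2, w z) : R3)) (t, x) :=
      (contDiffAt_graph hw).continuousAt
    filter_upwards [hr, hcont.eventually ((isOpen_box hI.1 hA.1 hB.1).mem_nhds hp)] with z hz hz2
    rw [hP _ hz2] at hz
    exact hz
  have hw0 : w' y₀ = c.d2 * w (t, x) + c.d3 := hev.self_of_nhds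
  have hdw := hw.differentiableAt top
  have hdw' := (hw''.differentiableAt top).hasFDerivAt
  have hct : Tendsto (fun s : ℝ => ((s, x) : ℝ × ℝ)) (𝓝 t) (𝓝 (t, x)) :=
    (continuousAt_id.prodMk continuousAt_const).tendsto
  have hcx : Tendsto (fun y : ℝ => ((t, y) : ℝ × ℝ)) (𝓝 x) (𝓝 (t, x)) :=
    (continuousAt_const.prodMk continuousAt_id).tendsto
  -- the derivative with respect to `t`
  have e1 : fderiv ℝ w' y₀ (deriv c.α t,
      c.d1 * c.d3 / c.d2 ^ 2 * (c.d2 * (θ t).1 - c.d3 * (θ t).2.1))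
      = c.d2 * fderiv ℝ w (t, x) (1, 0) := by
    have h1 := HasFDerivAt.comp_hasDerivAt t (l := w')
      (f := fun s => ((c.α s, c.d1 * x + c.shift Θ s) : ℝ × ℝ)) hdw'
      ((hc.hasDerivAt hI.1 ht).prodMk ((Params.hasDerivAt_shift (c := c) hΘ ht).const_add _))
    refine h1.unique ((((deriv_fst hdw).const_mul c.d2).add_const c.d3).congr_of_eventuallyEq ?_)
    exact hct.eventually hev
  have hlin : ∀ y : ℝ, c.d1 * y + c.shift Θ t = y₀.2 + c.d1 * (y - x) := by
    intro y; simp only [hy₀]; ring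
  have hevx : (fun y => w' (y₀.1, y₀.2 + c.d1 * (y - x))) =ᶠ[𝓝 x]
      fun y => c.d2 * w (t, y) + c.d3 := by
    filter_upwards [hcx.eventually hev] with y hy
    rw [← hlin y]
    exact hy
  have e2 : fderiv ℝ w' y₀ (0, c.d1) = c.d2 * fderiv ℝ w (t, x) (0, 1) := by
    have h0 : HasDerivAt (fun y : ℝ => ((c.α t, c.d1 * y + c.shift Θ t) : ℝ × ℝ)) (0, c.d1) x := by
      refine (hasDerivAt_const x _).prodMk ?_
      simpa using ((hasDerivAt_id x).const_mul c.d1).add_const (c.shift Θ t)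
    have h1 := HasFDerivAt.comp_hasDerivAt x (l := w') hdw' h0
    refine h1.unique ((((deriv_snd hdw).const_mul c.d2).add_const c.d3).congr_of_eventuallyEq ?_)
    exact hcx.eventually hev
  have hslice' : ContDiffAt ℝ ∞ (fun y => w' (y₀.1, y)) y₀.2 :=
    ContDiffAt.comp y₀.2 (f := fun y : ℝ => ((y₀.1, y) : ℝ × ℝ)) hw'' (by fun_prop)
  have hslice : ContDiffAt ℝ ∞ (fun y => w (t, y)) x :=
    ContDiffAt.comp x (f := fun y : ℝ => ((t, y) : ℝ × ℝ)) hw (by fun_prop)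
  have e3 : c.d1 ^ 3 * iteratedDeriv 3 (fun y => w' (y₀.1, y)) y₀.2
      = c.d2 * iteratedDeriv 3 (fun y => w (t, y)) x := by
    rw [← iteratedDeriv_three_comp_affine (x₀ := x) hslice', hevx.iteratedDeriv_eq]
    have h3 : ContDiffAt ℝ (3 : ℕ) (fun y => w (t, y)) x :=
      hslice.of_le (WithTop.coe_le_coe.2 le_top)
    rw [iteratedDeriv_fun_add (contDiffAt_const.mul h3) contDiffAt_const,
      iteratedDeriv_const_mul_field]
    simp [iteratedDeriv_const]
  rw [fderiv_eq_partials] at e1 e2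
  simp only [smul_eq_mul, zero_mul, zero_add] at e1 e2
  have g1 := gardner_eq (θ := θ) hdw
  have g2 := gardner_eq (θ := θ') (hw''.differentiableAt top)
  rw [hw0, show θ' y₀.1 = c.coeff θ t from hθ' t ht] at g2
  have key : deriv c.α t * gardner θ' w' y₀.1 y₀.2 = c.d2 * gardner θ w t x := by
    have g1' : gardner θ w t x = _ := g1
    rw [g1', g2]
    simp only [Params.coeff]
    set wt := fderiv ℝ w (t, x) (1, 0)
    set wx := fderiv ℝ w (t, x) (0, 1)
    set w3 := iteratedDeriv 3 (fun y => w (t, y)) x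
    set vt := fderiv ℝ w' y₀ (1, 0)
    set vx := fderiv ℝ w' y₀ (0, 1)
    set v3 := iteratedDeriv 3 (fun y => w' (y₀.1, y)) y₀.2
    have hvx : vx = c.d2 * wx / c.d1 := by field_simp; linear_combination e2
    have hv3 : v3 = c.d2 * w3 / c.d1 ^ 3 := by field_simp; linear_combination e3
    have hvt : vt = (c.d2 * wt - c.d1 * c.d3 / c.d2 ^ 2 * (c.d2 * (θ t).1 - c.d3 * (θ t).2.1) * vx)
        / deriv c.α t := by field_simp; field_simp at e1; linear_combination e1
    rw [hvt, hv3, hvx]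
    field_simp
    ring
  show gardner θ w t x = 0 ↔ gardner θ' w' y₀.1 y₀.2 = 0
  constructor
  · intro h0
    rw [h0, mul_zero] at key
    exact (mul_eq_zero.1 key).resolve_left hαt
  · intro h0
    rw [h0, mul_zero] at key
    exact (mul_eq_zero.1 key.symm).resolve_left hd2

theorem Params.isAdmissible (hI : IsOpenInterval I) (hA : IsOpenInterval A)
    (hB : IsOpenInterval B) (hc : c.Valid I) (hθ : InClass I θ) (hΘ : IsAntideriv I Θ θ)
    {P : R3 → R3} (hP : ∀ p ∈ box I A B, P p = c.point Θ p)
    (hθ' : ∀ t ∈ I, θ' (c.α t) = c.coeff θ t) : IsAdmissible (box I A B) P θ θ' := by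
  refine ⟨(Params.contDiffOn_point hI.1 hc hθ hΘ).congr hP, fun p hp => ?_, ?_,
    Params.mapsEquation hI hA hB hc hΘ hP hθ'⟩
  · have : P =ᶠ[𝓝 p] c.point Θ := by
      filter_upwards [(isOpen_box hI.1 hA.1 hB.1).mem_nhds hp] with q hq using hP q hq
    rw [this.fderiv_eq]
    exact Params.bijective_fderiv_point hI.1 hc hΘ hp.1
  · have : (fun p => (P p).1) '' box I A B ⊆ c.α '' I := by
      rintro _ ⟨p, hp, rfl⟩
      exact ⟨p.1, hp.1, by simp only [hP p hp]; rfl⟩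
    have h1 := Params.inClass hI hc hθ hθ'
    exact ⟨h1.1.mono this, fun s hs => h1.2 s (this hs)⟩

theorem isAdmissible_iff (hI : IsOpenInterval I) (hA : IsOpenInterval A)
    (hB : IsOpenInterval B) (hθ : InClass I θ) {P : R3 → R3} :
    IsAdmissible (box I A B) P θ θ' ↔ ∃ (c : Params) (Θ : ℝ → R3), c.Valid I ∧
      IsAntideriv I Θ θ ∧ ∀ p ∈ box I A B, P p = (c.transf (p, θ p.1, Θ p.1)).1 ∧
        θ' (c.α p.1) = (c.transf (p, θ p.1, Θ p.1)).2 := by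
  refine ⟨fun h => h.exists_params hI hA hB hθ, ?_⟩
  rintro ⟨c, Θ, hc, hΘ, h⟩
  simp only [Params.transf_eq] at h
  obtain ⟨x, hx⟩ := hA.2.2
  obtain ⟨u, hu⟩ := hB.2.2
  exact Params.isAdmissible hI hA hB hc hθ hΘ (fun p hp => (h p hp).1)
    fun t ht => (h _ (mem_box ht hx hu)).2

end Sufficiency

theorem isOpen_regular : IsOpen regular :=
  isOpen_ne_fun (f := fun a : R3 => a.2.1 * a.2.2) (by fun_prop) continuous_const

theorem dense_regular : Dense regular := by
  have h : Dense ((Set.univ : Set ℝ) ×ˢ (({0}ᶜ : Set ℝ) ×ˢ ({0}ᶜ : Set ℝ))) :=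
    dense_univ.prod ((dense_compl_singleton 0).prod (dense_compl_singleton 0))
  refine h.mono ?_
  rintro ⟨k, f, g⟩ ⟨-, hf, hg⟩
  exact mul_ne_zero hf hg

theorem isOpen_domain {D W : Set R3} (hD : IsOpen D) (hW : IsOpen W) : IsOpen (domain D W) :=
  (hD.preimage continuous_fst).inter (hW.preimage (continuous_fst.comp continuous_snd))

section Sufficiency

variable {I A B : Set ℝ} {c : Params} {W : Set R3} {Φ : Transf}

theorem Params.contDiffOn_transf (hI : IsOpen I) (hc : c.Valid I) :
    ContDiffOn ℝ ∞ c.transf (domain (box I A B) W) := by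
  have hm : Set.MapsTo (fun q : R3 × R3 × R3 => q.1.1) (domain (box I A B) W) I :=
    fun q hq => hq.1.1
  have h4 := (Params.contDiffOn_deriv hI hc).comp (contDiffOn_fst.fst) hm
  have h4' : ∀ q ∈ domain (box I A B) W, (deriv c.α ∘ fun q : R3 × R3 × R3 => q.1.1) q ≠ 0 :=
    fun q hq => hc.2.1 _ (hm hq)
  have h5 := hc.1.comp (contDiffOn_fst.fst) hm
  refine ContDiffOn.congr (ContDiffOn.prodMk (f := fun q : R3 × R3 × R3 =>
      ((c.α q.1.1, c.d1 * q.1.2.1 + c.d1 * c.d3 / c.d2 ^ 2 * (c.d2 * q.2.2.1 - c.d3 * q.2.2.2.1)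
        + c.d4, c.d2 * q.1.2.2 + c.d3) : R3))
    (g := fun q : R3 × R3 × R3 => ((c.d1 / (c.d2 * deriv c.α q.1.1) *
        (q.2.1.1 - 2 * (c.d3 / c.d2) * q.2.1.2.1),
      c.d1 / (c.d2 ^ 2 * deriv c.α q.1.1) * q.2.1.2.1,
      c.d1 ^ 3 / deriv c.α q.1.1 * q.2.1.2.2) : R3)) ?_ ?_) (fun q _ => rfl)
  · exact h5.prodMk (ContDiffOn.prodMk (by fun_prop) (by fun_prop))
  · refine ContDiffOn.prodMk ?_ (ContDiffOn.prodMk ?_ ?_)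
    · exact (contDiffOn_const.div (contDiffOn_const.mul h4)
        fun q hq => mul_ne_zero hc.d2_ne (h4' q hq)).mul (by fun_prop)
    · exact (contDiffOn_const.div (contDiffOn_const.mul h4)
        fun q hq => mul_ne_zero (pow_ne_zero 2 hc.d2_ne) (h4' q hq)).mul (by fun_prop)
    · exact (contDiffOn_const.div h4 h4').mul (by fun_prop)

theorem Params.bijective_fderiv_transf (hI : IsOpen I) (hc : c.Valid I) {p : R3} (hp : p.1 ∈ I)
    (a b : R3) :
    Function.Bijective (fderiv ℝ (fun q : R3 × R3 => c.transf (q.1, q.2, b)) (p, a)) := by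
  have hd : DifferentiableAt ℝ (deriv c.α) p.1 :=
    ((Params.contDiffOn_deriv hI hc).contDiffAt (hI.mem_nhds hp)).differentiableAt (by simp)
  have hα0 := hc.2.1 _ hp
  have hd1 := hc.d1_ne
  have hd2 := hc.d2_ne
  have hA : DifferentiableAt ℝ (fun t => c.d1 / (c.d2 * deriv c.α t)) p.1 :=
    (differentiableAt_const _).div (hd.const_mul _) (mul_ne_zero hd2 hα0)
  have hB : DifferentiableAt ℝ (fun t => c.d1 / (c.d2 ^ 2 * deriv c.α t)) p.1 :=
    (differentiableAt_const _).div (hd.const_mul _) (mul_ne_zero (pow_ne_zero 2 hd2) hα0)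
  have hC : DifferentiableAt ℝ (fun t => c.d1 ^ 3 / deriv c.α t) p.1 :=
    (differentiableAt_const _).div hd hα0
  have hp1 : HasFDerivAt (fun q : R3 × R3 => q.1) _ (p, a) := hasFDerivAt_fst (𝕜 := ℝ)
  have hp2 : HasFDerivAt (fun q : R3 × R3 => q.2) _ (p, a) := hasFDerivAt_snd (𝕜 := ℝ)
  have h1 := (hc.hasDerivAt hI hp).comp_hasFDerivAt (p, a) hp1.fst
  have hA1 := hA.hasDerivAt.comp_hasFDerivAt (p, a) hp1.fst
  have hB1 := hB.hasDerivAt.comp_hasFDerivAt (p, a) hp1.fst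
  have hC1 := hC.hasDerivAt.comp_hasFDerivAt (p, a) hp1.fst
  have h3 : HasFDerivAt (fun q : R3 × R3 => c.transf (q.1, q.2, b)) _ (p, a) :=
    (h1.prodMk ((((hp1.snd.fst.const_mul c.d1).add_const _).add_const _).prodMk
      ((hp1.snd.snd.const_mul c.d2).add_const _))).prodMk
    ((hA1.mul (hp2.fst.sub (hp2.snd.fst.const_mul _))).prodMk
      ((hB1.mul hp2.snd.fst).prodMk (hC1.mul hp2.snd.snd)))
  have hv : ∀ v : R3 × R3, v.1.1 = 0 →
      fderiv ℝ (fun q : R3 × R3 => c.transf (q.1, q.2, b)) (p, a) v =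
      ((0, c.d1 * v.1.2.1, c.d2 * v.1.2.2),
        (c.d1 / (c.d2 * deriv c.α p.1) * (v.2.1 - 2 * (c.d3 / c.d2) * v.2.2.1),
        c.d1 / (c.d2 ^ 2 * deriv c.α p.1) * v.2.2.1, c.d1 ^ 3 / deriv c.α p.1 * v.2.2.2)) := by
    intro v hv0
    rw [h3.fderiv]
    ext <;> simp [hv0]
  have hv1 : ∀ v : R3 × R3, (fderiv ℝ (fun q : R3 × R3 => c.transf (q.1, q.2, b)) (p, a) v).1.1 =
      deriv c.α p.1 * v.1.1 := by
    intro v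
    rw [h3.fderiv]
    simp
  have hi : Function.Injective
      (fderiv ℝ (fun q : R3 × R3 => c.transf (q.1, q.2, b)) (p, a)).toLinearMap := by
    rw [← LinearMap.ker_eq_bot, LinearMap.ker_eq_bot']
    intro v h0
    have h0' : fderiv ℝ (fun q : R3 × R3 => c.transf (q.1, q.2, b)) (p, a) v = 0 := h0
    have e0 := hv1 v
    rw [h0'] at e0
    have v0 : v.1.1 = 0 := (mul_eq_zero.1 e0.symm).resolve_left hα0
    rw [hv v v0] at h0'
    simp only [Prod.ext_iff, Prod.fst_zero, Prod.snd_zero, mul_eq_zero, div_eq_zero_iff, hd1, hd2,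
      hα0, pow_eq_zero_iff, ne_eq, OfNat.ofNat_ne_zero, not_false_eq_true, or_self, false_or,
      true_and] at h0'
    obtain ⟨⟨e1, e2⟩, e3, e4, e5⟩ := h0'
    rw [e4, mul_zero, sub_zero] at e3
    exact Prod.ext (Prod.ext v0 (Prod.ext e1 e2)) (Prod.ext e3 (Prod.ext e4 e5))
  exact ⟨hi, LinearMap.injective_iff_surjective.1 hi⟩

theorem Params.isEquivTransf (hI : IsOpenInterval I) (hA : IsOpenInterval A)
    (hB : IsOpenInterval B) (hW : IsOpen W) (hreg : regular ⊆ W) (hc : c.Valid I)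
    (h : Set.EqOn Φ c.transf (domain (box I A B) W)) : IsEquivTransf I A B W Φ := by
  refine ⟨(Params.contDiffOn_transf hI.1 hc).congr h, ?_, ?_⟩
  · intro p hp a ha b
    have : (fun q : R3 × R3 => Φ (q.1, q.2, b)) =ᶠ[𝓝 (p, a)]
        fun q : R3 × R3 => c.transf (q.1, q.2, b) := by
      filter_upwards [((isOpen_box hI.1 hA.1 hB.1).prod hW).mem_nhds
        (Set.mk_mem_prod hp (hreg ha))] with q hq
      exact h ⟨hq.1, hq.2⟩
    rw [this.fderiv_eq]
    exact Params.bijective_fderiv_transf hI.1 hc hp.1 a b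
  · intro θ Θ hθ hΘ
    obtain ⟨-, β, -, hβ, -⟩ := exists_smooth_inverse hI hc.1 hc.2.1
    have hΦ : ∀ p ∈ box I A B, Φ (p, θ p.1, Θ p.1) = (c.point Θ p, c.coeff θ p.1) := by
      intro p hp
      rw [← Params.transf_eq]
      exact h ⟨hp, hreg (hθ.2 _ hp.1)⟩
    have hθ' : ∀ t ∈ I, (c.coeff θ ∘ β) (c.α t) = c.coeff θ t := fun t ht => by
      simp only [Function.comp, hβ t ht]
    refine ⟨c.coeff θ ∘ β, fun p hp => ?_, Params.isAdmissible hI hA hB hc hθ hΘ (fun p hp => ?_)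
      hθ'⟩
    · rw [Transf.at, hΦ p hp]
      exact hθ' _ hp.1
    · rw [Transf.at, hΦ p hp]

end Sufficiency

/-! ### Dependence of the parameters on the coefficients. -/

section Necessity

variable {I A B : Set ℝ} {W : Set R3} {Φ : Transf} {θ Θ : ℝ → R3}

/-- The antiderivatives supplied by `IsAdmissible.exists_params` differ from the given ones by a
constant on the interval, which is absorbed into `δ₄`. The parameters found here may still vary with
`θ` and `Θ`. -/
theorem IsEquivTransf.exists_params (hI : IsOpenInterval I) (hA : IsOpenInterval A)
    (hB : IsOpenInterval B) (h : IsEquivTransf I A B W Φ) (hθ : InClass I θ)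
    (hΘ : IsAntideriv I Θ θ) :
    ∃ c : Params, c.Valid I ∧
      ∀ p ∈ box I A B, Φ (p, θ p.1, Θ p.1) = c.transf (p, θ p.1, Θ p.1) := by
  obtain ⟨θ', h1, h2⟩ := h.2.2 θ Θ hθ hΘ
  obtain ⟨c, Θ₂, hc, hΘ₂, h3⟩ := h2.exists_params hI hA hB hθ
  obtain ⟨t₀, ht₀⟩ := hI.2.2
  have hdiff : ∀ t ∈ I, Θ₂ t = Θ t + (Θ₂ t₀ - Θ t₀) := by
    intro t ht
    have := hI.1.is_const_of_deriv_eq_zero (f := fun t => Θ₂ t - Θ t)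
      hI.2.1.convex.isPreconnected
      (fun s hs => ((hΘ₂ s hs).sub (hΘ s hs)).differentiableAt.differentiableWithinAt)
      (fun s hs => by
        have := ((hΘ₂ s hs).sub (hΘ s hs)).deriv
        rw [sub_self] at this
        exact this) ht ht₀
    rw [← this]; abel
  set δ := Θ₂ t₀ - Θ t₀
  refine ⟨⟨c.α, c.d1, c.d2, c.d3,
    c.d4 + c.d1 * c.d3 / c.d2 ^ 2 * (c.d2 * δ.1 - c.d3 * δ.2.1)⟩, hc, fun p hp => ?_⟩
  have e1 := (h3 p hp).1
  have e2 := (h3 p hp).2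
  have e3 := h1 p hp
  rw [e1] at e3
  have e4 : (c.transf (p, θ p.1, Θ₂ p.1)).1.1 = c.α p.1 := rfl
  rw [e4, e2] at e3
  refine Prod.ext ?_ e3.symm
  rw [Transf.at] at e1
  rw [e1, hdiff _ hp.1]
  refine Prod.ext rfl (Prod.ext ?_ rfl)
  simp only [Params.transf]
  ring

/-- An affine `k` together with exponentials for `f` and `g` realizes any derivative without leaving
`f g ≠ 0`. Thus through every regular point pass curves `(t, θ t, Θ t)` with tangent vector `(1, v,
a)`, where `v` is arbitrary. -/
theorem exists_coefficients (hI : IsOpenInterval I) {t : ℝ} (ht : t ∈ I) {a : R3}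
    (ha : a ∈ regular) (v b : R3) :
    ∃ θ Θ : ℝ → R3, InClass I θ ∧ IsAntideriv I Θ θ ∧ θ t = a ∧ HasDerivAt θ v t ∧ Θ t = b := by
  obtain ⟨k, f, g⟩ := a
  obtain ⟨v₁, v₂, v₃⟩ := v
  have hf : f ≠ 0 := left_ne_zero_of_mul ha
  have hg : g ≠ 0 := right_ne_zero_of_mul ha
  let θ : ℝ → R3 := fun s =>
    (k + v₁ * (s - t), f * Real.exp (v₂ / f * (s - t)), g * Real.exp (v₃ / g * (s - t)))
  have hsm : ContDiff ℝ ∞ θ := by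
    refine ContDiff.prodMk (by fun_prop) (ContDiff.prodMk ?_ ?_)
    · exact contDiff_const.mul (Real.contDiff_exp.comp (by fun_prop))
    · exact contDiff_const.mul (Real.contDiff_exp.comp (by fun_prop))
  obtain ⟨Θ, hΘ, hΘt⟩ := exists_antideriv hI hsm.continuous.continuousOn ht b
  have h1 : HasDerivAt (fun s : ℝ => s - t) 1 t := (hasDerivAt_id _).sub_const _
  refine ⟨θ, Θ, ⟨hsm.contDiffOn, fun s _ => ?_⟩, hΘ, by simp [θ], ?_, hΘt⟩
  · exact mul_ne_zero (mul_ne_zero hf (Real.exp_ne_zero _)) (mul_ne_zero hg (Real.exp_ne_zero _))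
  · refine HasDerivAt.prodMk ?_ (HasDerivAt.prodMk ?_ ?_)
    · simpa using (h1.const_mul v₁).const_add k
    · refine (((h1.const_mul (v₂ / f)).exp).const_mul f).congr_deriv ?_
      simp; field_simp
    · refine (((h1.const_mul (v₃ / g)).exp).const_mul g).congr_deriv ?_
      simp; field_simp

/-- The values of `α` outside `I` are irrelevant: since `I` is open, agreement on it carries over to
the derivative. -/
theorem Params.transf_congr (hI : IsOpen I) {c c' : Params} (h1 : c.d1 = c'.d1)
    (h2 : c.d2 = c'.d2) (h3 : c.d3 = c'.d3) (h4 : c.d4 = c'.d4) (hα : Set.EqOn c.α c'.α I)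
    {q : R3 × R3 × R3} (hq : q.1.1 ∈ I) : c.transf q = c'.transf q := by
  have hd : deriv c.α q.1.1 = deriv c'.α q.1.1 :=
    (hα.eventuallyEq_of_mem (hI.mem_nhds hq)).deriv_eq
  obtain ⟨⟨t, x, u⟩, ⟨k, f, g⟩, ⟨K, F, G⟩⟩ := q
  simp only [Params.transf] at hd ⊢
  rw [hd, hα hq, h1, h2, h3, h4]

end Necessity

section Necessity

variable {I A B : Set ℝ} {W : Set R3} {Φ : Transf} {θ Θ : ℝ → R3}

/-- The space of `t`, the values of the coefficients and of their antiderivatives. -/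
abbrev jetSpace (I : Set ℝ) : Set (ℝ × R3 × R3) := I ×ˢ Set.univ

theorem isOpen_jetSpace (hI : IsOpen I) : IsOpen (jetSpace I) := hI.prod isOpen_univ

theorem hasDerivAt_along {D : ℝ × R3 × R3 → ℝ} {t : ℝ} {v : R3}
    (hD : DifferentiableAt ℝ D (t, θ t, Θ t)) (hθ : HasDerivAt θ v t)
    (hΘ : HasDerivAt Θ (θ t) t) :
    HasDerivAt (fun s => D (s, θ s, Θ s)) (fderiv ℝ D (t, θ t, Θ t) (1, v, θ t)) t :=
  HasFDerivAt.comp_hasDerivAt t (l := D) (f := fun s : ℝ => ((s, θ s, Θ s) : ℝ × R3 × R3))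
    hD.hasFDerivAt ((hasDerivAt_id t).prodMk (hθ.prodMk hΘ))

theorem continuous_fderiv_coeff (hI : IsOpen I) {D : ℝ × R3 × R3 → ℝ}
    (hD : ContDiffOn ℝ ∞ D (jetSpace I)) {t : ℝ} (ht : t ∈ I) (b : R3) :
    Continuous fun a : R3 => fderiv ℝ D (t, a, b) := by
  rw [continuous_iff_continuousAt]
  intro a
  have h1 : ContDiffAt ℝ ∞ D (t, a, b) :=
    hD.contDiffAt ((isOpen_jetSpace hI).mem_nhds ⟨ht, trivial⟩)
  have h2 : ContinuousAt (fderiv ℝ D) (t, a, b) :=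
    (h1.fderiv_right (m := ∞) (by simp)).continuousAt
  exact ContinuousAt.comp (f := fun a : R3 => ((t, a, b) : ℝ × R3 × R3)) h2 (by fun_prop)

/-- A function is independent of the coefficient values if its derivative with respect to them
vanishes at all regular values. -/
theorem eq_of_fderiv_coeff_eq_zero (hI : IsOpen I) {D : ℝ × R3 × R3 → ℝ}
    (hD : ContDiffOn ℝ ∞ D (jetSpace I))
    (h : ∀ t ∈ I, ∀ a ∈ regular, ∀ b v : R3, fderiv ℝ D (t, a, b) (0, v, 0) = 0) {t : ℝ}
    (ht : t ∈ I) (a a' b : R3) : D (t, a, b) = D (t, a', b) := by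
  -- Smoothness at values with `f g = 0` matters here: density extends the vanishing from `regular`,
  -- which is disconnected, to the connected space of all values.
  have hz : ∀ a v : R3, fderiv ℝ D (t, a, b) (0, v, 0) = 0 := by
    intro a v
    have hc : Continuous fun a : R3 => fderiv ℝ D (t, a, b) (0, v, 0) :=
      (continuous_fderiv_coeff hI hD ht b).clm_apply continuous_const
    exact congrFun (hc.ext_on dense_regular continuous_const fun a ha => h t ht a ha b v) a
  have hd : ∀ a, HasFDerivAt (fun a : R3 => D (t, a, b)) ((fderiv ℝ D (t, a, b)).comp
      ((ContinuousLinearMap.inr ℝ ℝ (R3 × R3)).comp (ContinuousLinearMap.inl ℝ R3 R3))) a := by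
    intro a
    have h1 : DifferentiableAt ℝ D (t, a, b) :=
      (hD.contDiffAt ((isOpen_jetSpace hI).mem_nhds ⟨ht, trivial⟩)).differentiableAt (by simp)
    exact HasFDerivAt.comp a (f := fun a : R3 => ((t, a, b) : ℝ × R3 × R3)) h1.hasFDerivAt
      ((hasFDerivAt_prodMk_right t (a, b)).comp a (hasFDerivAt_prodMk_left a b))
  exact is_const_of_fderiv_eq_zero (𝕜 := ℝ) (f := fun a : R3 => D (t, a, b))
    (fun a => (hd a).differentiableAt)
    (fun a => by rw [(hd a).fderiv]; ext <;> simpa using hz a _) a a'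

theorem differentiableAt_reduced (hI : IsOpen I) {D : ℝ × R3 × R3 → ℝ}
    (hD : ContDiffOn ℝ ∞ D (jetSpace I)) {t : ℝ} (ht : t ∈ I) (b : R3) :
    DifferentiableAt ℝ (fun z : ℝ × R3 => D (z.1, 0, z.2)) (t, b) := by
  have h1 : DifferentiableAt ℝ D (t, 0, b) :=
    (hD.contDiffAt ((isOpen_jetSpace hI).mem_nhds ⟨ht, trivial⟩)).differentiableAt (by simp)
  exact DifferentiableAt.comp (t, b) (f := fun z : ℝ × R3 => ((z.1, 0, z.2) : ℝ × R3 × R3)) h1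
    (by fun_prop)

/-- A function of `t`, of the coefficients and of their antiderivatives that does not depend on
`t` for any choice of the coefficients is constant. -/
theorem eq_of_const_along (hI : IsOpenInterval I) {D : ℝ × R3 × R3 → ℝ}
    (hD : ContDiffOn ℝ ∞ D (jetSpace I))
    (h : ∀ θ Θ, InClass I θ → IsAntideriv I Θ θ → ∀ s ∈ I, ∀ t ∈ I,
      D (s, θ s, Θ s) = D (t, θ t, Θ t)) {t t' : ℝ} (ht : t ∈ I) (ht' : t' ∈ I) (a a' b b' : R3) :
    D (t, a, b) = D (t', a', b') := by
  have hdiff : ∀ t ∈ I, ∀ a b, DifferentiableAt ℝ D (t, a, b) := fun t ht a b =>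
    (hD.contDiffAt ((isOpen_jetSpace hI.1).mem_nhds ⟨ht, trivial⟩)).differentiableAt (by simp)
  have hzero : ∀ t ∈ I, ∀ a ∈ regular, ∀ b v : R3, fderiv ℝ D (t, a, b) (1, v, a) = 0 := by
    intro t ht a ha b v
    obtain ⟨θ, Θ, hθ, hΘ, rfl, hv, rfl⟩ := exists_coefficients hI ht ha v b
    refine (hasDerivAt_along (hdiff t ht _ _) hv (hΘ t ht)).unique ?_
    refine (hasDerivAt_const t (D (t, θ t, Θ t))).congr_of_eventuallyEq ?_
    filter_upwards [hI.1.mem_nhds ht] with s hs using h θ Θ hθ hΘ s hs t ht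
  have hind := fun t (ht : t ∈ I) => eq_of_fderiv_coeff_eq_zero hI.1 hD (fun t ht a ha b v => by
    -- Two curves through the same point with different `θ_t`: their difference isolates the
    -- coefficient direction.
    have h1 := hzero t ht a ha b v
    have h2 := hzero t ht a ha b 0
    have : ((0, v, 0) : ℝ × R3 × R3) = (1, v, a) - (1, 0, a) := by simp
    rw [this, map_sub, h1, h2, sub_zero]) (t := t) ht
  set D₀ : ℝ × R3 → ℝ := fun z => D (z.1, 0, z.2) with hD₀
  have hD₀d := fun t (ht : t ∈ I) b => differentiableAt_reduced hI.1 hD ht b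
  have hreg : ∀ t ∈ I, ∀ b : R3, ∀ a ∈ regular, fderiv ℝ D₀ (t, b) (1, a) = 0 := by
    intro t ht b a ha
    obtain ⟨θ, Θ, hθ, hΘ, rfl, -, rfl⟩ := exists_coefficients hI ht ha 0 b
    have h1 := HasFDerivAt.comp_hasDerivAt t (l := D₀) (f := fun s : ℝ => ((s, Θ s) : ℝ × R3))
      (hD₀d t ht _).hasFDerivAt ((hasDerivAt_id t).prodMk (hΘ t ht))
    refine h1.unique ((hasDerivAt_const t (D₀ (t, Θ t))).congr_of_eventuallyEq ?_)
    filter_upwards [hI.1.mem_nhds ht] with s hs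
    have := h θ Θ hθ hΘ s hs t ht
    rwa [hind s hs _ 0, hind t ht _ 0] at this
  have hall : ∀ t ∈ I, ∀ b a : R3, fderiv ℝ D₀ (t, b) (1, a) = 0 := by
    intro t ht b a
    have hc : Continuous fun a : R3 => fderiv ℝ D₀ (t, b) (1, a) := by fun_prop
    exact congrFun (hc.ext_on dense_regular continuous_const fun a ha => hreg t ht b a ha) a
  have hf : ∀ z ∈ I ×ˢ (Set.univ : Set R3), fderiv ℝ D₀ z = 0 := by
    rintro ⟨t, b⟩ ⟨ht, -⟩
    have h0 := hall t ht b 0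
    ext
    · simpa using h0
    all_goals
      · simp only [ContinuousLinearMap.comp_apply, ContinuousLinearMap.inr_apply,
          ContinuousLinearMap.inl_apply, zero_apply]
        have : ∀ w : R3, fderiv ℝ D₀ (t, b) (0, w) = 0 := fun w => by
          have e : ((0, w) : ℝ × R3) = (1, w) - (1, 0) := by simp
          rw [e, map_sub, hall t ht b w, h0, sub_zero]
        exact this _
  have key := (hI.1.prod isOpen_univ).is_const_of_fderiv_eq_zero (𝕜 := ℝ) (f := D₀)
    (hI.2.1.convex.prod convex_univ).isPreconnected
    (fun z hz => (hD₀d z.1 hz.1 z.2).differentiableWithinAt) hf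
    (x := (t, b)) (y := (t', b')) ⟨ht, trivial⟩ ⟨ht', trivial⟩
  rw [hind t ht a 0, hind t' ht' a' 0]
  exact key

theorem smul_mem_regular {r : ℝ} (hr : r ≠ 0) {a : R3} (ha : a ∈ regular) : r • a ∈ regular :=
  mul_ne_zero (mul_ne_zero hr (left_ne_zero_of_mul ha)) (mul_ne_zero hr (right_ne_zero_of_mul ha))

theorem contDiffOn_slice
    (h : IsEquivTransf I A B univ Φ) {x u : ℝ} (hx : x ∈ A) (hu : u ∈ B) :
    ContDiffOn ℝ ∞ (fun z : ℝ × R3 × R3 => Φ ((z.1, x, u), z.2)) (jetSpace I) :=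
  h.1.comp (f := fun z : ℝ × R3 × R3 => (((z.1, x, u), z.2) : R3 × R3 × R3)) (by fun_prop)
    fun z hz => ⟨mem_box hz.1 hx hu, trivial⟩

/-- The transformation of `t` in an element of the generalized extended equivalence group involves
neither the coefficients nor their antiderivatives. -/
theorem time_independent (hI : IsOpenInterval I) (hA : IsOpenInterval A)
    (hB : IsOpenInterval B) (h : IsEquivTransf I A B univ Φ) {t x u : ℝ} (ht : t ∈ I)
    (hx : x ∈ A) (hu : u ∈ B) (a a' b b' : R3) :
    (Φ ((t, x, u), a, b)).1.1 = (Φ ((t, x, u), a', b')).1.1 := by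
  set T : ℝ × R3 × R3 → ℝ := fun z => (Φ ((z.1, x, u), z.2)).1.1 with hT
  have hTs : ContDiffOn ℝ ∞ T (jetSpace I) := (contDiffOn_slice h hx hu).fst.fst
  have hdiff : ∀ t ∈ I, ∀ a b, DifferentiableAt ℝ T (t, a, b) := fun t ht a b =>
    (hTs.contDiffAt ((isOpen_jetSpace hI.1).mem_nhds ⟨ht, trivial⟩)).differentiableAt (by simp)
  have halong : ∀ t ∈ I, ∀ θ Θ, InClass I θ → IsAntideriv I Θ θ → ∃ r ≠ 0,
      HasDerivAt (fun s => T (s, θ s, Θ s)) r t := by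
    intro t ht θ Θ hθ hΘ
    obtain ⟨c, hc, hform⟩ := h.exists_params hI hA hB hθ hΘ
    refine ⟨deriv c.α t, hc.2.1 t ht, (hc.hasDerivAt hI.1 ht).congr_of_eventuallyEq ?_⟩
    filter_upwards [hI.1.mem_nhds ht] with s hs
    have := hform (s, x, u) (mem_box hs hx hu)
    simp only [hT]
    rw [this]
    rfl
  -- Along such a curve `T` coincides with some `α`, whose derivative is nonzero.
  have hne : ∀ t ∈ I, ∀ a ∈ regular, ∀ b v : R3, fderiv ℝ T (t, a, b) (1, v, a) ≠ 0 := by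
    intro t ht a ha b v
    obtain ⟨θ, Θ, hθ, hΘ, rfl, hv, rfl⟩ := exists_coefficients hI ht ha v b
    obtain ⟨r, hr, hd⟩ := halong t ht θ Θ hθ hΘ
    rw [(hasDerivAt_along (hdiff t ht _ _) hv (hΘ t ht)).unique hd]
    exact hr
  have hind := fun t (ht : t ∈ I) => eq_of_fderiv_coeff_eq_zero hI.1 hTs (fun t ht a ha b v => by
    -- A nonzero linear part would give the affine function of `v` a zero on the line spanned by
    -- `v`.
    by_contra h0
    refine hne t ht a ha b
      ((-(fderiv ℝ T (t, a, b) (1, 0, a)) / fderiv ℝ T (t, a, b) (0, v, 0)) • v) ?_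
    have e : ∀ r : ℝ, ((1, r • v, a) : ℝ × R3 × R3) = (1, 0, a) + r • (0, v, 0) := by
      intro r; simp
    rw [e, map_add, map_smul, smul_eq_mul, div_mul_cancel₀ _ h0]
    ring) (t := t) ht
  set T₀ : ℝ × R3 → ℝ := fun z => T (z.1, 0, z.2) with hT₀
  have hT₀d := fun t (ht : t ∈ I) b => differentiableAt_reduced hI.1 hTs ht b
  have hreg : ∀ t ∈ I, ∀ b : R3, ∀ a ∈ regular, fderiv ℝ T₀ (t, b) (1, a) ≠ 0 := by
    intro t ht b a ha
    obtain ⟨θ, Θ, hθ, hΘ, rfl, -, rfl⟩ := exists_coefficients hI ht ha 0 b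
    have h1 := HasFDerivAt.comp_hasDerivAt t (l := T₀) (f := fun s : ℝ => ((s, Θ s) : ℝ × R3))
      (hT₀d t ht _).hasFDerivAt ((hasDerivAt_id t).prodMk (hΘ t ht))
    obtain ⟨r, hr, hd⟩ := halong t ht θ Θ hθ hΘ
    have h2 := h1.unique (hd.congr_of_eventuallyEq (by
      filter_upwards [hI.1.mem_nhds ht] with s hs using hind s hs 0 (θ s) (Θ s)))
    rw [h2]
    exact hr
  have hspace : ∀ t ∈ I, ∀ x' ∈ A, ∀ u' ∈ B, ∀ a ∈ regular, ∀ b,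
      (Φ ((t, x', u'), a, b)).1.1 = T (t, a, b) := by
    intro t ht x' hx' u' hu' a ha b
    obtain ⟨θ, Θ, hθ, hΘ, rfl, -, rfl⟩ := exists_coefficients hI ht ha 0 b
    obtain ⟨c, hc, hform⟩ := h.exists_params hI hA hB hθ hΘ
    have h1 := hform (t, x', u') (mem_box ht hx' hu')
    have h2 := hform (t, x, u) (mem_box ht hx hu)
    simp only [hT]
    simp only at h1 h2
    rw [h1, h2]
    rfl
  -- Otherwise the new `t`, which does not depend on `x`, `u` or the coefficients, would be
  -- stationary in all six variables at fixed antiderivatives, against the nondegeneracy of `Φ`.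
  have htime : ∀ t ∈ I, ∀ b : R3, fderiv ℝ T₀ (t, b) (1, 0) ≠ 0 := by
    intro t ht b h0
    have ha : ((0, 1, 1) : R3) ∈ regular := by simp [regular]
    have hp := mem_box ht hx hu
    have hs := (h.2.1 _ hp _ ha b).2
    obtain ⟨v, hv⟩ := hs ((1, 0, 0), 0)
    have hF : DifferentiableAt ℝ (fun q : R3 × R3 => Φ (q.1, q.2, b)) ((t, x, u), (0, 1, 1)) := by
      have h1 : ContDiffAt ℝ ∞ Φ ((t, x, u), (0, 1, 1), b) :=
        h.1.contDiffAt ((isOpen_domain (isOpen_box hI.1 hA.1 hB.1) isOpen_univ).mem_nhds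
          ⟨hp, trivial⟩)
      exact DifferentiableAt.comp _ (f := fun q : R3 × R3 => ((q.1, q.2, b) : R3 × R3 × R3))
        (h1.differentiableAt (by simp)) (by fun_prop)
    have h1 := hF.hasFDerivAt.fst.fst
    have hpr : HasFDerivAt (fun q : R3 × R3 => ((q.1.1, b) : ℝ × R3))
        (((ContinuousLinearMap.fst ℝ ℝ (ℝ × ℝ)).comp (ContinuousLinearMap.fst ℝ R3 R3)).prod 0)
        ((t, x, u), (0, 1, 1)) :=
      (hasFDerivAt_fst.fst).prodMk (hasFDerivAt_const b _)
    have h2 := HasFDerivAt.comp ((t, x, u), ((0, 1, 1) : R3)) (g := T₀)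
      (f := fun q : R3 × R3 => ((q.1.1, b) : ℝ × R3)) (hT₀d t ht b).hasFDerivAt hpr
    have h3 := h1.unique (h2.congr_of_eventuallyEq (by
      filter_upwards [((isOpen_box hI.1 hA.1 hB.1).prod isOpen_regular).mem_nhds
        (Set.mk_mem_prod hp ha)] with q hq
      have e1 := hspace q.1.1 hq.1.1 q.1.2.1 hq.1.2.1 q.1.2.2 hq.1.2.2 q.2 hq.2 b
      have e2 := hind q.1.1 hq.1.1 q.2 0 b
      exact e1.trans e2))
    have h4 : (fderiv ℝ (fun q : R3 × R3 => Φ (q.1, q.2, b)) ((t, x, u), (0, 1, 1)) v).1.1 =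
        fderiv ℝ T₀ (t, b) (v.1.1, 0) := congrArg (fun l : R3 × R3 →L[ℝ] ℝ => l v) h3
    have e : ((v.1.1, 0) : ℝ × R3) = v.1.1 • (1, 0) := by simp
    rw [hv, e, map_smul, h0, smul_zero] at h4
    exact one_ne_zero h4
  have hzero : ∀ t ∈ I, ∀ b a : R3, fderiv ℝ T₀ (t, b) (0, a) = 0 := by
    intro t ht b a
    have hc : Continuous fun a : R3 => fderiv ℝ T₀ (t, b) (0, a) := by fun_prop
    refine congrFun (hc.ext_on dense_regular continuous_const fun a ha => ?_) a
    by_contra h0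
    have h1 := htime t ht b
    -- Rescaling the coefficients by this `r` would make the derivative along the curve zero; `r •
    -- a` is still regular because `htime` gives `r ≠ 0`.
    set r := -(fderiv ℝ T₀ (t, b) (1, 0)) / fderiv ℝ T₀ (t, b) (0, a) with hr
    refine hreg t ht b (r • a) (smul_mem_regular (div_ne_zero (neg_ne_zero.2 h1) h0) ha) ?_
    have e : ((1, r • a) : ℝ × R3) = (1, 0) + r • (0, a) := by simp
    rw [e, map_add, map_smul, smul_eq_mul, hr, div_mul_cancel₀ _ h0]
    ring
  have hd : ∀ b, HasFDerivAt (fun b : R3 => T₀ (t, b)) ((fderiv ℝ T₀ (t, b)).comp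
      (ContinuousLinearMap.inr ℝ ℝ R3)) b := fun b =>
    HasFDerivAt.comp b (f := fun b : R3 => ((t, b) : ℝ × R3)) (hT₀d t ht b).hasFDerivAt
      (hasFDerivAt_prodMk_right t b)
  have hconst := is_const_of_fderiv_eq_zero (𝕜 := ℝ) (f := fun b : R3 => T₀ (t, b))
    (fun b => (hd b).differentiableAt)
    (fun b => by rw [(hd b).fderiv]; ext <;> simpa using hzero t ht b _) b b'
  have e1 := hind t ht a 0 b
  have e2 := hind t ht a' 0 b'
  exact (e1.trans hconst).trans e2.symm

end Necessity

/-! ### Determination of the two equivalence groups. -/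

section Groups

variable {I A B : Set ℝ} {W : Set R3} {Φ : Transf}

theorem IsOpenInterval.exists_ne (hA : IsOpenInterval A) : ∃ x ∈ A, ∃ y ∈ A, x ≠ y := by
  obtain ⟨x, hx⟩ := hA.2.2
  obtain ⟨ε, hε, hb⟩ := Metric.isOpen_iff.1 hA.1 x hx
  exact ⟨x, hx, x + ε / 2, hb (by simp [abs_of_pos hε, hε]), by simp [hε.ne']⟩

/-- A reference equation supplies `c₀`. For any other equation `δ₁`, `δ₂`, `δ₃` and `δ₄` are
recovered from values and differences of components of `Φ` that are constant along the curves, so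
`eq_of_const_along` makes them universal; `time_independent` does this for `α`. -/
theorem IsGenExtEquiv.exists_params (hI : IsOpenInterval I) (hA : IsOpenInterval A)
    (hB : IsOpenInterval B) (h : IsGenExtEquiv I A B Φ) :
    ∃ c : Params, c.Valid I ∧ Set.EqOn Φ c.transf (domain (box I A B) univ) := by
  obtain ⟨t₀, ht₀⟩ := hI.2.2
  obtain ⟨x₀, hx₀, x₁, hx₁, hx⟩ := hA.exists_ne
  obtain ⟨u₀, hu₀, u₁, hu₁, hu⟩ := hB.exists_ne
  have ha₀ : ((0, 1, 1) : R3) ∈ regular := by simp [regular]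
  have hF : ∀ {x u}, x ∈ A → u ∈ B →
      ContDiffOn ℝ ∞ (fun z : ℝ × R3 × R3 => Φ ((z.1, x, u), z.2)) (jetSpace I) :=
    fun hx hu => contDiffOn_slice h hx hu
  have hp := fun θ Θ (hθ : InClass I θ) (hΘ : IsAntideriv I Θ θ) =>
    IsEquivTransf.exists_params hI hA hB h hθ hΘ
  have hval : ∀ {θ Θ : ℝ → R3} {c : Params},
      (∀ p ∈ box I A B, Φ (p, θ p.1, Θ p.1) = c.transf (p, θ p.1, Θ p.1)) → ∀ {t x u}, t ∈ I →
      x ∈ A → u ∈ B → (Φ ((t, x, u), θ t, Θ t)).1 = c.point Θ (t, x, u) := by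
    intro θ Θ c hc t x u ht hx hu
    have h1 := hc _ (mem_box ht hx hu)
    rw [Params.transf_eq] at h1
    exact congrArg Prod.fst h1
  obtain ⟨θ₀, Θ₀, hθ₀, hΘ₀, -⟩ := exists_coefficients hI ht₀ ha₀ 0 0
  obtain ⟨c₀, hc₀, hform₀⟩ := hp θ₀ Θ₀ hθ₀ hΘ₀
  have c1 : ∀ {t t'}, t ∈ I → t' ∈ I → ∀ a a' b b', _ := fun {t t'} ht ht' =>
    eq_of_const_along (D := fun z => (Φ ((z.1, x₁, u₀), z.2)).1.2.1 - (Φ ((z.1, x₀, u₀), z.2)).1.2.1)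
      hI ((hF hx₁ hu₀).fst.snd.fst.sub (hF hx₀ hu₀).fst.snd.fst)
      (fun θ Θ hθ hΘ s hs t ht => by
        obtain ⟨c, -, hf⟩ := hp θ Θ hθ hΘ
        simp only [hval hf hs hx₁ hu₀, hval hf hs hx₀ hu₀, hval hf ht hx₁ hu₀, hval hf ht hx₀ hu₀,
          Params.point]
        ring) (t := t) (t' := t') ht ht'
  have c2 : ∀ {t t'}, t ∈ I → t' ∈ I → ∀ a a' b b', _ := fun {t t'} ht ht' =>
    eq_of_const_along (D := fun z => (Φ ((z.1, x₀, u₁), z.2)).1.2.2 - (Φ ((z.1, x₀, u₀), z.2)).1.2.2)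
      hI ((hF hx₀ hu₁).fst.snd.snd.sub (hF hx₀ hu₀).fst.snd.snd)
      (fun θ Θ hθ hΘ s hs t ht => by
        obtain ⟨c, -, hf⟩ := hp θ Θ hθ hΘ
        simp only [hval hf hs hx₀ hu₁, hval hf hs hx₀ hu₀, hval hf ht hx₀ hu₁, hval hf ht hx₀ hu₀,
          Params.point]) (t := t) (t' := t') ht ht'
  have c3 : ∀ {t t'}, t ∈ I → t' ∈ I → ∀ a a' b b', _ := fun {t t'} ht ht' =>
    eq_of_const_along (D := fun z => (Φ ((z.1, x₀, u₀), z.2)).1.2.2)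
      hI (hF hx₀ hu₀).fst.snd.snd
      (fun θ Θ hθ hΘ s hs t ht => by
        obtain ⟨c, -, hf⟩ := hp θ Θ hθ hΘ
        simp only [hval hf hs hx₀ hu₀, hval hf ht hx₀ hu₀, Params.point]) (t := t) (t' := t') ht ht'
  have hd : ∀ θ Θ, InClass I θ → IsAntideriv I Θ θ → ∀ c : Params,
      (∀ p ∈ box I A B, Φ (p, θ p.1, Θ p.1) = c.transf (p, θ p.1, Θ p.1)) →
      c.d1 = c₀.d1 ∧ c.d2 = c₀.d2 ∧ c.d3 = c₀.d3 := by
    intro θ Θ hθ hΘ c hf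
    have e1 := c1 ht₀ ht₀ (θ t₀) (θ₀ t₀) (Θ t₀) (Θ₀ t₀)
    have e2 := c2 ht₀ ht₀ (θ t₀) (θ₀ t₀) (Θ t₀) (Θ₀ t₀)
    have e3 := c3 ht₀ ht₀ (θ t₀) (θ₀ t₀) (Θ t₀) (Θ₀ t₀)
    simp only [hval hf ht₀ hx₁ hu₀, hval hf ht₀ hx₀ hu₀, hval hf ht₀ hx₀ hu₁,
      hval hform₀ ht₀ hx₁ hu₀, hval hform₀ ht₀ hx₀ hu₀, hval hform₀ ht₀ hx₀ hu₁,
      Params.point] at e1 e2 e3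
    have f1 : c.d1 = c₀.d1 := by
      refine sub_eq_zero.1 ((mul_eq_zero.1 (?_ : _ * (x₁ - x₀) = 0)).resolve_right
        (sub_ne_zero.2 hx.symm))
      linear_combination e1
    have f2 : c.d2 = c₀.d2 := by
      refine sub_eq_zero.1 ((mul_eq_zero.1 (?_ : _ * (u₁ - u₀) = 0)).resolve_right
        (sub_ne_zero.2 hu.symm))
      linear_combination e2
    refine ⟨f1, f2, ?_⟩
    rw [f2] at e3
    linear_combination e3
  -- The integral term varies along the curves. Since `δ₁`, `δ₂`, `δ₃` are already universal, it can
  -- be subtracted as an explicit function of the antiderivatives, leaving `δ₁ x₀ + δ₄`.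
  have c4 : ∀ {t t'}, t ∈ I → t' ∈ I → ∀ a a' b b', _ := fun {t t'} ht ht' =>
    eq_of_const_along (D := fun z => (Φ ((z.1, x₀, u₀), z.2)).1.2.1
        - c₀.d1 * c₀.d3 / c₀.d2 ^ 2 * (c₀.d2 * z.2.2.1 - c₀.d3 * z.2.2.2.1))
      hI ((hF hx₀ hu₀).fst.snd.fst.sub (by fun_prop))
      (fun θ Θ hθ hΘ s hs t ht => by
        obtain ⟨c, -, hf⟩ := hp θ Θ hθ hΘ
        obtain ⟨f1, f2, f3⟩ := hd θ Θ hθ hΘ c hf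
        simp only [hval hf hs hx₀ hu₀, hval hf ht hx₀ hu₀, Params.point, Params.shift, f1, f2, f3]
        ring) (t := t) (t' := t') ht ht'
  have hd4 : ∀ θ Θ, InClass I θ → IsAntideriv I Θ θ → ∀ c : Params,
      (∀ p ∈ box I A B, Φ (p, θ p.1, Θ p.1) = c.transf (p, θ p.1, Θ p.1)) → c.d4 = c₀.d4 := by
    intro θ Θ hθ hΘ c hf
    obtain ⟨f1, f2, f3⟩ := hd θ Θ hθ hΘ c hf
    have e4 := c4 ht₀ ht₀ (θ t₀) (θ₀ t₀) (Θ t₀) (Θ₀ t₀)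
    simp only [hval hf ht₀ hx₀ hu₀, hval hform₀ ht₀ hx₀ hu₀, Params.point, Params.shift, f1, f2, f3]
      at e4
    linear_combination e4
  have hα : ∀ θ Θ : ℝ → R3, ∀ c : Params,
      (∀ p ∈ box I A B, Φ (p, θ p.1, Θ p.1) = c.transf (p, θ p.1, Θ p.1)) →
      Set.EqOn c.α c₀.α I := by
    intro θ Θ c hf t ht
    have e := time_independent hI hA hB h ht hx₀ hu₀ (θ t) (θ₀ t) (Θ t) (Θ₀ t)
    simpa only [hval hf ht hx₀ hu₀, hval hform₀ ht hx₀ hu₀, Params.point] using e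
  refine ⟨c₀, hc₀, ?_⟩
  have hreg : ∀ p ∈ box I A B, ∀ a ∈ regular, ∀ b, Φ (p, a, b) = c₀.transf (p, a, b) := by
    intro p hpb a ha b
    obtain ⟨θ, Θ, hθ, hΘ, rfl, -, rfl⟩ := exists_coefficients hI hpb.1 ha 0 b
    obtain ⟨c, -, hf⟩ := hp θ Θ hθ hΘ
    obtain ⟨f1, f2, f3⟩ := hd θ Θ hθ hΘ c hf
    rw [hf p hpb]
    exact Params.transf_congr hI.1 f1 f2 f3 (hd4 θ Θ hθ hΘ c hf) (hα θ Θ c hf) hpb.1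
  -- The values with `f g = 0` follow by continuity of both sides in the coefficients.
  rintro ⟨p, a, b⟩ ⟨hpb, -⟩
  have hcont : ∀ {Ψ : Transf}, ContDiffOn ℝ ∞ Ψ (domain (box I A B) univ) →
      Continuous fun a => Ψ (p, a, b) := by
    intro Ψ hΨ
    refine hΨ.continuousOn.comp_continuous (f := fun a : R3 => ((p, a, b) : R3 × R3 × R3))
      (by fun_prop) fun a => ⟨hpb, trivial⟩
  exact congrFun ((hcont h.1).ext_on dense_regular (hcont (Params.contDiffOn_transf hI.1 hc₀))
    fun a ha => hreg p hpb a ha b) a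

theorem isGenExtEquiv_iff (hI : IsOpenInterval I) (hA : IsOpenInterval A)
    (hB : IsOpenInterval B) : IsGenExtEquiv I A B Φ ↔
      ∃ c : Params, c.Valid I ∧ Set.EqOn Φ c.transf (domain (box I A B) univ) :=
  ⟨fun h => h.exists_params hI hA hB, fun ⟨_, hc, h⟩ =>
    Params.isEquivTransf hI hA hB isOpen_univ (subset_univ _) hc h⟩

/-- The transformation of `(t, x, u)` is the same for all equations, so comparison with a reference
equation fixes `α`, `δ₁`, `δ₂`, `δ₃` and the whole shift of `x` directly. No continuation across `f
g = 0` is involved, so smoothness on `regular` is enough. -/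
theorem IsUsualEquiv.exists_params (hI : IsOpenInterval I) (hA : IsOpenInterval A)
    (hB : IsOpenInterval B) (h : IsUsualEquiv I A B Φ) :
    ∃ c : Params, c.Valid I ∧ c.d3 = 0 ∧ Set.EqOn Φ c.transf (domain (box I A B) regular) := by
  obtain ⟨t₀, ht₀, t₁, ht₁, ht⟩ := hI.exists_ne
  obtain ⟨x₀, hx₀, x₁, hx₁, hx⟩ := hA.exists_ne
  obtain ⟨u₀, hu₀, u₁, hu₁, hu⟩ := hB.exists_ne
  have ha₀ : ((0, 1, 1) : R3) ∈ regular := by simp [regular]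
  have hp := fun θ Θ (hθ : InClass I θ) (hΘ : IsAntideriv I Θ θ) =>
    IsEquivTransf.exists_params hI hA hB h.1 hθ hΘ
  obtain ⟨θ₀, Θ₀, hθ₀, hΘ₀, -⟩ := exists_coefficients hI ht₀ ha₀ 0 0
  obtain ⟨c₀, hc₀, hform₀⟩ := hp θ₀ Θ₀ hθ₀ hΘ₀
  have hpt : ∀ θ Θ, InClass I θ → ∀ c : Params,
      (∀ p ∈ box I A B, Φ (p, θ p.1, Θ p.1) = c.transf (p, θ p.1, Θ p.1)) →
      ∀ t ∈ I, ∀ x ∈ A, ∀ u ∈ B, c.point Θ (t, x, u) = c₀.point Θ₀ (t, x, u) := by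
    intro θ Θ hθ c hf t ht x hx u hu
    have h1 := hf _ (mem_box ht hx hu)
    have h2 := hform₀ _ (mem_box ht hx hu)
    rw [Params.transf_eq] at h1 h2
    have h3 := h.2.1 _ (mem_box ht hx hu) _ (hθ.2 t ht) _ (hθ₀.2 t ht) (Θ t) (Θ₀ t)
    simp only at h1 h2
    rw [h1, h2] at h3
    exact h3
  have hd : ∀ θ Θ, InClass I θ → ∀ c : Params,
      (∀ p ∈ box I A B, Φ (p, θ p.1, Θ p.1) = c.transf (p, θ p.1, Θ p.1)) →
      c.d1 = c₀.d1 ∧ c.d2 = c₀.d2 ∧ c.d3 = c₀.d3 ∧ Set.EqOn c.α c₀.α I ∧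
      ∀ t ∈ I, c.shift Θ t = c₀.shift Θ₀ t := by
    intro θ Θ hθ c hf
    have key := hpt θ Θ hθ c hf
    have e0 := key t₀ ht₀ x₀ hx₀ u₀ hu₀
    have e1 := key t₀ ht₀ x₁ hx₁ u₀ hu₀
    have e2 := key t₀ ht₀ x₀ hx₀ u₁ hu₁
    simp only [Params.point, Prod.mk.injEq] at e0 e1 e2
    have f1 : c.d1 = c₀.d1 := by
      refine sub_eq_zero.1 ((mul_eq_zero.1 (?_ : _ * (x₁ - x₀) = 0)).resolve_right
        (sub_ne_zero.2 hx.symm))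
      linear_combination e1.2.1 - e0.2.1
    have f2 : c.d2 = c₀.d2 := by
      refine sub_eq_zero.1 ((mul_eq_zero.1 (?_ : _ * (u₁ - u₀) = 0)).resolve_right
        (sub_ne_zero.2 hu.symm))
      linear_combination e2.2.2 - e0.2.2
    refine ⟨f1, f2, ?_, fun t ht => congrArg Prod.fst (key t ht x₀ hx₀ u₀ hu₀), fun t ht => ?_⟩
    · have := e0.2.2
      rw [f2] at this
      linear_combination this
    · have := congrArg (fun y => y.2.1) (key t ht x₀ hx₀ u₀ hu₀)
      simp only [Params.point, f1] at this
      linear_combination this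
  have hd1 := hc₀.d1_ne
  have hd2 := hc₀.d2_ne
  -- adding a constant to the first coefficient does not change the transformation of `x`
  have h3 : c₀.d3 = 0 := by
    let θ₁ : ℝ → R3 := fun t => θ₀ t + (1, 0, 0)
    let Θ₁ : ℝ → R3 := fun t => Θ₀ t + (t, 0, 0)
    have hθ₁ : InClass I θ₁ := by
      refine ⟨hθ₀.1.add contDiffOn_const, fun t ht => ?_⟩
      have := hθ₀.2 t ht
      simpa [regular, θ₁] using this
    have hΘ₁ : IsAntideriv I Θ₁ θ₁ := fun t ht =>
      (hΘ₀ t ht).add ((hasDerivAt_id t).prodMk (hasDerivAt_const t (0, 0)))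
    obtain ⟨c, -, hf⟩ := hp θ₁ Θ₁ hθ₁ hΘ₁
    obtain ⟨f1, f2, f3, -, f5⟩ := hd θ₁ Θ₁ hθ₁ c hf
    have e0 := f5 t₀ ht₀
    have e1 := f5 t₁ ht₁
    simp only [Params.shift, f1, f2, f3, Θ₁, Prod.fst_add, Prod.snd_add, add_zero] at e0 e1
    have e2 : c₀.d1 * c₀.d3 / c₀.d2 ^ 2 * c₀.d2 * (t₁ - t₀) = 0 := by
      linear_combination e1 - e0
    have := (mul_eq_zero.1 e2).resolve_right (sub_ne_zero.2 ht.symm)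
    field_simp at this
    simpa [hd1] using this
  refine ⟨c₀, hc₀, h3, ?_⟩
  rintro ⟨p, a, b⟩ ⟨hpb, ha⟩
  obtain ⟨θ, Θ, hθ, hΘ, hθp, -, hΘp⟩ := exists_coefficients hI hpb.1 ha 0 b
  obtain ⟨c, -, hf⟩ := hp θ Θ hθ hΘ
  obtain ⟨f1, f2, f3, f4, f5⟩ := hd θ Θ hθ c hf
  have e := hf p hpb
  simp only at hθp hΘp
  rw [hθp, hΘp] at e
  rw [e]
  refine Params.transf_congr hI.1 f1 f2 f3 ?_ f4 hpb.1
  -- With `δ₃ = 0` the shift of `x` is `δ₄` alone.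
  have := f5 t₀ ht₀
  simpa [Params.shift, f3, h3] using this

theorem isUsualEquiv_iff (hI : IsOpenInterval I) (hA : IsOpenInterval A)
    (hB : IsOpenInterval B) : IsUsualEquiv I A B Φ ↔
      ∃ c : Params, c.Valid I ∧ c.d3 = 0 ∧
        Set.EqOn Φ c.transf (domain (box I A B) regular) := by
  refine ⟨fun h => h.exists_params hI hA hB, ?_⟩
  rintro ⟨c, hc, h3, h⟩
  refine ⟨Params.isEquivTransf hI hA hB isOpen_regular subset_rfl hc h, ?_, ?_⟩
  · intro p hp a ha a' ha' b b'
    rw [h ⟨hp, ha⟩, h ⟨hp, ha'⟩]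
    simp [Params.transf, h3]
  · intro p hp a ha b b'
    rw [h ⟨hp, ha⟩, h ⟨hp, ha⟩]
    rfl

end Groups

/-! ### Composition and inversion. -/

theorem isOpenInterval_univ : IsOpenInterval univ :=
  ⟨isOpen_univ, ordConnected_univ, univ_nonempty⟩

/-- The parameters of the identity. -/
def Params.one : Params := ⟨id, 1, 1, 0, 0⟩

/-- The parameters of the composition of two transformations, the second argument being
applied first. -/
def Params.comp (c' c : Params) : Params :=
  ⟨c'.α ∘ c.α, c'.d1 * c.d1, c'.d2 * c.d2, c'.d2 * c.d3 + c'.d3, c'.d1 * c.d4 + c'.d4⟩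

/-- The parameters of the inverse transformation, given an inverse of `α`. -/
def Params.inv (c : Params) (β : ℝ → ℝ) : Params :=
  ⟨β, c.d1⁻¹, c.d2⁻¹, -c.d3 / c.d2, -c.d4 / c.d1⟩

theorem Params.one_transf (q : R3 × R3 × R3) : Params.one.transf q = idTransf q := by
  obtain ⟨⟨t, x, u⟩, ⟨k, f, g⟩, ⟨K, F, G⟩⟩ := q
  simp [Params.transf, Params.one, idTransf]

section Composition

variable {I J : Set ℝ} {c c' : Params} {Φ Ψ Χ : Transf}

theorem Params.one_valid : Params.one.Valid I :=
  ⟨contDiffOn_id, fun t _ => by simp [Params.one], by simp [Params.one]⟩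

theorem Params.deriv_comp (hI : IsOpen I) (hJ : IsOpen J) (hc : c.Valid I) (hc' : c'.Valid J)
    (h : Set.MapsTo c.α I J) {t : ℝ} (ht : t ∈ I) :
    deriv (c'.comp c).α t = deriv c'.α (c.α t) * deriv c.α t :=
  ((hc'.hasDerivAt hJ (h ht)).comp t (hc.hasDerivAt hI ht)).deriv

theorem Params.comp_valid (hI : IsOpen I) (hJ : IsOpen J) (hc : c.Valid I) (hc' : c'.Valid J)
    (h : Set.MapsTo c.α I J) : (c'.comp c).Valid I := by
  refine ⟨hc'.1.comp hc.1 h, fun t ht => ?_,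
    mul_ne_zero (mul_ne_zero hc'.d1_ne hc.d1_ne) (mul_ne_zero hc'.d2_ne hc.d2_ne)⟩
  rw [Params.deriv_comp hI hJ hc hc' h ht]
  exact mul_ne_zero (hc'.2.1 _ (h ht)) (hc.2.1 t ht)

/-- Antiderivatives of the new coefficients, as functions of the old `t`. -/
def Params.antideriv (c : Params) (Θ : ℝ → R3) (t : ℝ) : R3 :=
  (c.d1 / c.d2 * ((Θ t).1 - 2 * (c.d3 / c.d2) * (Θ t).2.1),
    c.d1 / c.d2 ^ 2 * (Θ t).2.1, c.d1 ^ 3 * (Θ t).2.2)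

theorem Params.hasDerivAt_antideriv (hc : c.Valid I) {θ Θ : ℝ → R3} (hΘ : IsAntideriv I Θ θ)
    {t : ℝ} (ht : t ∈ I) :
    HasDerivAt (c.antideriv Θ) (deriv c.α t • c.coeff θ t) t := by
  have h1 : HasDerivAt (fun s => (Θ s).1) (θ t).1 t := (hΘ t ht).fst
  have h2 : HasDerivAt (fun s => (Θ s).2.1) (θ t).2.1 t := (hΘ t ht).snd.fst
  have h3 : HasDerivAt (fun s => (Θ s).2.2) (θ t).2.2 t := (hΘ t ht).snd.snd
  have hα := hc.2.1 t ht
  have hd2 := hc.d2_ne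
  refine (((h1.sub (h2.const_mul _)).const_mul _).prodMk
    ((h2.const_mul _).prodMk (h3.const_mul _))).congr_deriv ?_
  simp only [Params.coeff, Prod.smul_mk, smul_eq_mul, Prod.mk.injEq]
  refine ⟨?_, ?_, ?_⟩ <;> field_simp

/-- `Params.antideriv` carries no constant of its own, so the integral terms add up to that of the
composite and the constants combine exactly as in `Params.comp`. -/
theorem Params.transf_comp (hI : IsOpen I) (hJ : IsOpen J) (hc : c.Valid I) (hc' : c'.Valid J)
    (h : Set.MapsTo c.α I J) {θ Θ : ℝ → R3} {p : R3} (hp : p.1 ∈ I) :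
    (c'.comp c).transf (p, θ p.1, Θ p.1) =
      c'.transf (c.point Θ p, c.coeff θ p.1, c.antideriv Θ p.1) := by
  have hα := hc.2.1 _ hp
  have hα' := hc'.2.1 _ (h hp)
  have hd1 := hc.d1_ne
  have hd2 := hc.d2_ne
  have hd1' := hc'.d1_ne
  have hd2' := hc'.d2_ne
  rw [Params.transf_eq]
  simp only [Params.transf, Params.point, Params.shift, Params.coeff, Params.antideriv,
    Params.deriv_comp hI hJ hc hc' h hp]
  simp only [Params.comp, Function.comp, Prod.mk.injEq, true_and]
  refine ⟨⟨?_, ?_⟩, ?_, ?_, ?_⟩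
  all_goals
    field_simp
    try ring

theorem Params.isComp (hI : IsOpenInterval I) (hJ : IsOpenInterval J) (hc : c.Valid I)
    (hc' : c'.Valid J) (h : Set.MapsTo c.α I J)
    (hΦ : Set.EqOn Φ c.transf (domain (box I univ univ) regular))
    (hΨ : Set.EqOn Ψ c'.transf (domain (box J univ univ) regular))
    (hΧ : Set.EqOn Χ (c'.comp c).transf (domain (box I univ univ) regular)) :
    IsComp I J Ψ Φ Χ := by
  intro θ Θ hθ hΘ
  obtain ⟨hopen, β, hβ, hβα, hβ'⟩ := exists_smooth_inverse hI hc.1 hc.2.1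
  -- The transformed antiderivatives, read as functions of the new `t`: the derivative of `β`
  -- removes the factor `α_t`.
  refine ⟨c.antideriv Θ ∘ β, fun p hp => ?_⟩
  have hp1 := hp.1
  rw [Transf.at, hΦ ⟨hp, hθ.2 _ hp1⟩, hΧ ⟨hp, hθ.2 _ hp1⟩, Params.transf_eq,
    Params.transf_comp hI.1 hJ.1 hc hc' h hp1]
  have hmem : c.α p.1 ∈ c.α '' I := ⟨_, hp1, rfl⟩
  have hinv : β (c.point Θ p).1 = p.1 := hβα _ hp1
  refine ⟨h hp1, ?_, ?_⟩
  · have h1 : HasDerivAt β (deriv c.α p.1)⁻¹ (c.α p.1) := by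
      rw [← hβ' _ hp1]
      exact ((hβ.contDiffAt (hopen.1.mem_nhds hmem)).differentiableAt (by simp)).hasDerivAt
    have h2 := Params.hasDerivAt_antideriv hc hΘ hp1
    rw [← hβα _ hp1] at h2
    have h3 := h2.scomp (c.α p.1) h1
    rw [hβα _ hp1, inv_smul_smul₀ (hc.2.1 _ hp1)] at h3
    exact h3
  · simp only [Function.comp, hinv]
    exact (hΨ ⟨⟨h hp1, trivial, trivial⟩, Params.coeff_mem_regular hc hθ hp1⟩).symm

theorem Params.inv_valid (hc : c.Valid I) {β : ℝ → ℝ} (hβ : ContDiffOn ℝ ∞ β (c.α '' I))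
    (hβ' : ∀ t ∈ I, deriv β (c.α t) = (deriv c.α t)⁻¹) : (c.inv β).Valid (c.α '' I) := by
  refine ⟨hβ, ?_, mul_ne_zero (inv_ne_zero hc.d1_ne) (inv_ne_zero hc.d2_ne)⟩
  rintro _ ⟨t, ht, rfl⟩
  exact (hβ' t ht).trans_ne (inv_ne_zero (hc.2.1 t ht))

theorem Params.inv_comp_transf (hI : IsOpen I) (hc : c.Valid I) {β : ℝ → ℝ}
    (hβ : Set.EqOn (β ∘ c.α) id I) :
    Set.EqOn idTransf ((c.inv β).comp c).transf (domain (box I univ univ) regular) := by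
  intro q hq
  have hd1 := hc.d1_ne
  have hd2 := hc.d2_ne
  rw [← Params.one_transf]
  refine Params.transf_congr hI ?_ ?_ ?_ ?_ hβ.symm hq.1.1 <;>
    simp only [Params.one, Params.comp, Params.inv] <;> field_simp <;> ring

theorem Params.comp_inv_transf (hJ : IsOpen J) (hc : c.Valid I) {β : ℝ → ℝ}
    (hβ : Set.EqOn (c.α ∘ β) id J) :
    Set.EqOn idTransf (c.comp (c.inv β)).transf (domain (box J univ univ) regular) := by
  intro q hq
  have hd1 := hc.d1_ne
  have hd2 := hc.d2_ne
  rw [← Params.one_transf]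
  refine Params.transf_congr hJ ?_ ?_ ?_ ?_ hβ.symm hq.1.1 <;>
    simp only [Params.one, Params.comp, Params.inv] <;> field_simp <;> ring

end Composition

/-- The transformations given by parameters with a property `Q` that holds for the identity and
is preserved by compositions and inverses form a group. -/
theorem formGroup_of_params {M : Set ℝ → Transf → Prop} {Q : Params → Prop} {W : Set R3}
    (hW : regular ⊆ W)
    (hM : ∀ I, IsOpenInterval I → ∀ Φ, M I Φ ↔ ∃ c : Params, c.Valid I ∧ Q c ∧
      Set.EqOn Φ c.transf (domain (box I univ univ) W))
    (hone : Q Params.one) (hcomp : ∀ c c', Q c → Q c' → Q (c'.comp c))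
    (hinv : ∀ c β, Q c → Q (c.inv β)) : FormGroup M := by
  have hmono (I : Set ℝ) : domain (box I univ univ) regular ⊆ domain (box I univ univ) W :=
    fun _ hq => ⟨hq.1, hW hq.2⟩
  refine ⟨fun I hI => (hM I hI _).2 ⟨Params.one, Params.one_valid, hone,
    fun q _ => (Params.one_transf q).symm⟩, ?_, ?_⟩
  · intro I J hI hJ Φ Ψ hΦ hΨ h
    obtain ⟨c, hc, hQ, hΦ⟩ := (hM I hI _).1 hΦ
    obtain ⟨c', hc', hQ', hΨ⟩ := (hM J hJ _).1 hΨ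
    -- The new `t` depends only on `t`, so a single test value of the other arguments is enough.
    have hmaps : Set.MapsTo c.α I J := by
      intro t ht
      have ha : ((0, 1, 1) : R3) ∈ regular := by simp [regular]
      have hp : ((t, 0, 0) : R3) ∈ box I univ univ := ⟨ht, trivial, trivial⟩
      have := h _ hp _ ha 0
      rwa [hΦ ⟨hp, hW ha⟩] at this
    exact ⟨(c'.comp c).transf, (hM I hI _).2 ⟨_, Params.comp_valid hI.1 hJ.1 hc hc' hmaps,
      hcomp _ _ hQ hQ', fun q _ => rfl⟩, Params.isComp hI hJ hc hc' hmaps (hΦ.mono (hmono _))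
      (hΨ.mono (hmono _)) fun q _ => rfl⟩
  · intro I hI Φ hΦ
    obtain ⟨c, hc, hQ, hΦ⟩ := (hM I hI _).1 hΦ
    obtain ⟨hJ, β, hβ, hβα, hβ'⟩ := exists_smooth_inverse hI hc.1 hc.2.1
    have hc' := Params.inv_valid hc hβ hβ'
    refine ⟨c.α '' I, (c.inv β).transf, hJ, (hM _ hJ _).2 ⟨_, hc', hinv c β hQ, fun q _ => rfl⟩,
      Params.isComp hI hJ hc hc' (Set.mapsTo_image _ _) (hΦ.mono (hmono _)) (fun q _ => rfl)
        (Params.inv_comp_transf hI.1 hc hβα),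
      Params.isComp hJ hI hc' hc ?_ (fun q _ => rfl) (hΦ.mono (hmono _))
        (Params.comp_inv_transf hJ.1 hc ?_)⟩
    · rintro _ ⟨t, ht, rfl⟩
      exact (congrArg (· ∈ I) (hβα t ht)).mpr ht
    · rintro _ ⟨t, ht, rfl⟩
      exact congrArg c.α (hβα t ht)

theorem formGroup_isGenExtEquiv : FormGroup fun I Φ => IsGenExtEquiv I univ univ Φ :=
  formGroup_of_params (Q := fun _ => True) (subset_univ _)
    (fun I hI Φ => by
      simpa using isGenExtEquiv_iff hI isOpenInterval_univ isOpenInterval_univ)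
    trivial (fun _ _ _ _ => trivial) fun _ _ _ => trivial

theorem formGroup_isUsualEquiv : FormGroup fun I Φ => IsUsualEquiv I univ univ Φ :=
  formGroup_of_params (Q := fun c => c.d3 = 0) subset_rfl
    (fun I hI Φ => isUsualEquiv_iff hI isOpenInterval_univ isOpenInterval_univ)
    rfl (fun c c' h h' => by simp [Params.comp, h, h']) fun c β h => by simp [Params.inv, h]

end Gardner

end

theorem theorem1 :
    -- the generalized extended equivalence group
    (∀ I A B : Set ℝ, Gardner.IsOpenInterval I → Gardner.IsOpenInterval A →
      Gardner.IsOpenInterval B → ∀ Φ : Gardner.Transf,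
        (Gardner.IsGenExtEquiv I A B Φ ↔
          ∃ c : Gardner.Params, c.Valid I ∧
            Set.EqOn Φ c.transf (Gardner.domain (Gardner.box I A B) Set.univ))) ∧
    -- the usual equivalence group
    (∀ I A B : Set ℝ, Gardner.IsOpenInterval I → Gardner.IsOpenInterval A →
      Gardner.IsOpenInterval B → ∀ Φ : Gardner.Transf,
        (Gardner.IsUsualEquiv I A B Φ ↔
          ∃ c : Gardner.Params, c.Valid I ∧ c.d3 = 0 ∧
            Set.EqOn Φ c.transf (Gardner.domain (Gardner.box I A B) Gardner.regular))) ∧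
    -- transformations depending on the coefficients in an arbitrary way
    (∀ I A B : Set ℝ, Gardner.IsOpenInterval I → Gardner.IsOpenInterval A →
      Gardner.IsOpenInterval B → ∀ θ θ' : ℝ → Gardner.R3, Gardner.InClass I θ →
        ∀ P : Gardner.R3 → Gardner.R3,
          (Gardner.IsAdmissible (Gardner.box I A B) P θ θ' ↔
            ∃ (c : Gardner.Params) (Θ : ℝ → Gardner.R3), c.Valid I ∧
              Gardner.IsAntideriv I Θ θ ∧
              ∀ p ∈ Gardner.box I A B,
                P p = (c.transf (p, θ p.1, Θ p.1)).1 ∧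
                θ' (c.α p.1) = (c.transf (p, θ p.1, Θ p.1)).2)) ∧
    -- both sets are groups
    Gardner.FormGroup (fun I Φ => Gardner.IsGenExtEquiv I Set.univ Set.univ Φ) ∧
    Gardner.FormGroup (fun I Φ => Gardner.IsUsualEquiv I Set.univ Set.univ Φ) := by
  exact ⟨fun I A B hI hA hB Φ => Gardner.isGenExtEquiv_iff hI hA hB,
    fun I A B hI hA hB Φ => Gardner.isUsualEquiv_iff hI hA hB,
    fun I A B hI hA hB θ θ' hθ P => Gardner.isAdmissible_iff hI hA hB hθ,
    Gardner.formGroup_isGenExtEquiv, Gardner.formGroup_isUsualEquiv⟩
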